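/- Let $\mathfrak g$ be a finite-dimensional simple, simply laced complex Lie algebra of rank $l$, with Cartan subalgebra $\mathfrak h$, simple roots $\alpha_1,\dots,\alpha_l$, Cartan matrix $(a_{ij})$, and let $\mathfrak h_{\mathbb R}^*$ be the real span of the roots with the inner product given by $\langle\alpha_i,\alpha_j\rangle=a_{ij}$ and $|x|^2=\langle x,x\rangle$. Let $\Lambda^R$ be the root lattice, $\Lambda^W$ the weight lattice (spanned by the fundamental weights $\lambda_i$ with $\langle\lambda_i,\alpha_j\rangle=\delta_{ij}$), $\operatorname{vol}$ the covolume of a lattice, $W$ the Weyl group, $\Delta_+$ the set of positive roots, $\rho$ half the sum of the positive roots, $\alpha_0$ the highest root, $h$ the Coxeter number (equal to the dual Coxeter number), $r\ge h$ an integer, and $C_r=\{x : \langle x,\alpha_i\rangle\ge 0 \text{ for } i=1,\dots,l,\ \langle x,\alpha_0\rangle\le r\}$. For $\lambda,\mu\in\Lambda^W$ put $$\tilde\Xi_{\lambda\mu}=\frac{\sqrt{-1}^{\,|\Delta_+|}}{r^{l/2}}\left|\frac{\operatorname{vol}(\Lambda^W)}{\operatorname{vol}(\Lambda^R)}\right|^{1/2}\sum_{w\in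 W}\det(w)\exp\left(-\frac{2\pi\sqrt{-1}}{r}\langle w(\lambda),\mu\rangle\right),$$ $$\tilde\Theta_{\lambda}=\exp\left(\frac{\pi\sqrt{-1}}{r}|\lambda|^2-\frac{\pi\sqrt{-1}}{h}|\rho|^2\right).$$ Let $t\ge 1$, let $\mathcal C=(m_1,\dots,m_t)$ be a sequence of integers, and for $0\le k\le t$ let $a_k$ and $c_k$ be the first-column entries of $$\begin{pmatrix}a_k&b_k\\c_k&d_k\end{pmatrix}=\Theta^{m_k}\,\Xi\,\Theta^{m_{k-1}}\,\Xi\cdots\Theta^{m_1}\,\Xi,\qquad \Xi=\begin{pmatrix}0&-1\\1&0\end{pmatrix},\quad \Theta=\begin{pmatrix}1&1\\0&1\end{pmatrix}$$ (the identity matrix for $k=0$). Assume $a_k\ne 0$ for $k=1,\dots,t$. For $\lambda_0,\lambda_{t+1}\in C_r\cap\Lambda^W$ let $$\mathcal T^{\mathcal C}_{\lambda_0,\lambda_{t+1}}=\sum_{\lambda_1,\dots,\lambda_t\in C_r\cap\Lambda^W}\tilde\Xi_{\lambda_{t+1}\lambda_t}\tilde\Theta_{\lambda_t}^{m_t}\tilde\Xi_{\lambda_t\lambda_{t-1}}\tilde\Theta_{\lambda_{t-1}}^{m_{t-1}}\cdots\tilde\Theta_{\lambda_1}^{m_1}\tilde\Xi_{\lambda_1\lambda_0}.$$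 Then, for every choice of representatives of the classes $\mu\in\Lambda^R/a_t\Lambda^R$, $$\mathcal T^{\mathcal C}_{\lambda_0,\lambda_{t+1}}=K^{\mathcal C}_{\lambda_0}\sum_{w\in W}\det(w)\sum_{\mu\in\Lambda^R/a_t\Lambda^R}\exp\left(-\frac{\pi\sqrt{-1}\,c_t}{a_t r}\left|\lambda_{t+1}+r\mu+\frac{w(\lambda_0)}{c_t}\right|^2\right),$$ where $$K^{\mathcal C}_{\lambda_0}=\frac{\sqrt{-1}^{\,(t+1)|\Delta_+|}}{(r|a_t|)^{l/2}\operatorname{vol}(\Lambda^R)}\,\zeta^{\,lD_t}\exp\left(-\frac{\pi\sqrt{-1}}{h}\Big(\sum_{i=1}^t m_i\Big)|\rho|^2\right)\exp\left(-\frac{\pi\sqrt{-1}}{r}\Big(\sum_{i=1}^{t-1}\frac1{a_{i-1}a_i}\Big)|\lambda_0|^2\right),$$ $\zeta=\exp\frac{\pi\sqrt{-1}}4$ and $D_t=\operatorname{sign}(a_0a_1)+\cdots+\operatorname{sign}(a_{t-1}a_t)$. -/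

import Mathlib

/-! Notation for a simple, simply laced complex Lie algebra: the real root system on the real span
of the roots, its Cartan inner product, lattices, alcoves, and the matrices `Ξ̃`, `Θ̃`. -/

noncomputable section

namespace SimplyLaced

/-- The root system of `(𝔤, H)` in the real vector space `𝔥_ℝ^*` spanned by the roots inside the
complex dual of `H`. -/
abbrev realRootSystem {𝔤 : Type*} [LieRing 𝔤] [LieAlgebra ℂ 𝔤] [FiniteDimensional ℂ 𝔤]
    [LieAlgebra.IsSimple ℂ 𝔤] (H : LieSubalgebra ℂ 𝔤) [H.IsCartanSubalgebra] :=
  (LieAlgebra.IsKilling.rootSystem H).restrictScalars ℝ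

/-- The real vector space `𝔥_ℝ^*` spanned by the roots. -/
abbrev HR {𝔤 : Type*} [LieRing 𝔤] [LieAlgebra ℂ 𝔤] [FiniteDimensional ℂ 𝔤]
    [LieAlgebra.IsSimple ℂ 𝔤] (H : LieSubalgebra ℂ 𝔤) [H.IsCartanSubalgebra] :=
  (LieAlgebra.IsKilling.rootSystem H).rootSpan ℝ

instance {𝔤 : Type*} [LieRing 𝔤] [LieAlgebra ℂ 𝔤] [FiniteDimensional ℂ 𝔤]
    [LieAlgebra.IsSimple ℂ 𝔤] (H : LieSubalgebra ℂ 𝔤) [H.IsCartanSubalgebra] :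
    (realRootSystem H).IsCrystallographic where
  exists_value i j := by
    obtain ⟨z, hz⟩ :=
      (inferInstance : (LieAlgebra.IsKilling.rootSystem H).IsCrystallographic).exists_value i j
    have := RootPairing.IsValuedIn.trans (LieAlgebra.IsKilling.rootSystem H) ℝ ℤ
    refine ⟨z, ?_⟩
    have h := (LieAlgebra.IsKilling.rootSystem H).restrictScalars_pairing ℝ i j
    rw [← hz] at h
    apply (algebraMap ℝ ℂ).injective
    rw [h]
    simp

section RootSystem

variable {ι V N : Type*} [AddCommGroup V] [Module ℝ V] [AddCommGroup N] [Module ℝ N]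
  {P : RootPairing ι ℝ V N} [P.IsRootSystem] [P.IsCrystallographic]

open Classical in
/-- The bilinear form on `V` with `⟨α_i, α_j⟩ = a_{ij}`, the `(i, j)` entry of the Cartan matrix.
It is an inner product when the Cartan matrix is simply laced. -/
def form (b : P.Base) : LinearMap.BilinForm ℝ V :=
  Matrix.toBilin b.toWeightBasis (b.cartanMatrix.map (fun z : ℤ => (z : ℝ)))

/-- `|x|² = ⟨x, x⟩`. -/
def normSq (b : P.Base) (x : V) : ℝ := form b x x

/-- The root lattice `Λ^R`: the `ℤ`-span of the simple roots. -/
def rootLattice (b : P.Base) : Submodule ℤ V :=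
  Submodule.span ℤ (P.root '' b.support)

open Classical in
/-- `x` is the fundamental weight `λ_i`, i.e. `⟨x, α_j⟩ = δ_{ij}` for all `j`. -/
def IsFundamentalWeight (b : P.Base) (i : b.support) (x : V) : Prop :=
  ∀ j : b.support, form b x (P.root j) = if i = j then 1 else 0

/-- The weight lattice `Λ^W`: the `ℤ`-span of the fundamental weights. -/
def weightLattice (b : P.Base) : Submodule ℤ V :=
  Submodule.span ℤ {x | ∃ i, IsFundamentalWeight b i x}

/-- The closed fundamental Weyl chamber. -/
def closedChamber (b : P.Base) : Set V :=
  {x | ∀ i : b.support, 0 ≤ form b x (P.root i)}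

/-- `θ` is (the index of) the highest root: every root is obtained from it by subtracting a
non-negative integral combination of simple roots. -/
def IsHighestRoot (b : P.Base) (θ : ι) : Prop :=
  ∀ i : ι, P.root θ - P.root i ∈ AddSubmonoid.closure (P.root '' b.support)

/-- The closed `k`-alcove `C_k`, where `θ` is the highest root. -/
def alcove (b : P.Base) (θ : ι) (k : ℕ) : Set V :=
  {x | x ∈ closedChamber b ∧ form b x (P.root θ) ≤ k}

/-- The (dual) Coxeter number of a simply laced root system: one plus the height of the
highest root `θ`. -/
def coxeterNumber (b : P.Base) (θ : ι) : ℤ := 1 + b.height θ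

/-- Half the sum of the positive roots. -/
def rho (b : P.Base) : V := (1 / 2 : ℝ) • ∑ᶠ i ∈ {i : ι | b.IsPos i}, P.root i

/-- The number of positive roots. -/
def numPos (b : P.Base) : ℕ := Set.ncard {i : ι | b.IsPos i}

/-- The rank `l`, i.e. the number of simple roots. -/
def rank (b : P.Base) : ℕ := b.support.card

/-- The determinant of a Weyl group element acting on `V`. -/
def weylDet (w : P.weylGroup) : ℝ := LinearMap.det (P.weylGroupRootRep w)

open Classical in
/-- The volume (covolume) of a lattice `Λ` in `V`: the square root of the Gram determinant of a
`ℤ`-basis of `Λ`. It does not depend on the basis, see `vol_eq`. -/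
def vol (b : P.Base) (Λ : Submodule ℤ V) : ℝ :=
  if h : Nonempty (Module.Basis (Fin (Module.finrank ℤ Λ)) ℤ Λ) then
    √|(Matrix.of fun i j => form b (h.some i : V) (h.some j : V)).det|
  else 0

/-- The volume can be computed from any `ℤ`-basis. -/
theorem vol_eq (b : P.Base) (Λ : Submodule ℤ V) {κ : Type*} [Fintype κ] [DecidableEq κ]
    (e : Module.Basis κ ℤ Λ) :
    vol b Λ = √|(Matrix.of fun i j => form b (e i : V) (e j : V)).det| := by
  have key : ∀ {n : Type} [Fintype n] [DecidableEq n] (f g : Module.Basis n ℤ Λ),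
      |(Matrix.of fun i j => form b (f i : V) (f j : V)).det| =
        |(Matrix.of fun i j => form b (g i : V) (g j : V)).det| := by
    intro n _ _ f g
    set M : Matrix n n ℝ := (g.toMatrix f).map (Int.castRingHom ℝ) with hM
    have hf : ∀ i, (f i : V) = ∑ k, M k i • (g k : V) := by
      intro i
      have h1 := congrArg (Subtype.val) (g.sum_toMatrix_smul_self f i)
      refine h1.symm.trans ?_
      rw [Submodule.coe_sum]
      refine Finset.sum_congr rfl fun k _ => ?_
      simp [hM, Int.cast_smul_eq_zsmul]
    have h2 : (Matrix.of fun i j => form b (f i : V) (f j : V)) =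
        M.transpose * (Matrix.of fun i j => form b (g i : V) (g j : V)) * M := by
      ext i j
      simp only [Matrix.of_apply, hf i, hf j, map_sum, map_smul, LinearMap.sum_apply,
        LinearMap.smul_apply, smul_eq_mul, Matrix.mul_apply, Matrix.transpose_apply]
      refine Finset.sum_congr rfl fun k _ => ?_
      rw [mul_comm]
    have hu : IsUnit (g.toMatrix f).det := by
      rw [← Module.Basis.det_apply]
      exact g.isUnit_det f
    have hd : |M.det| = 1 := by
      rw [hM, ← RingHom.mapMatrix_apply, ← RingHom.map_det]
      rcases Int.isUnit_iff.mp hu with h | h <;> simp [h]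
    rw [h2, Matrix.det_mul, Matrix.det_mul, Matrix.det_transpose, abs_mul, abs_mul, hd]
    ring
  let ε : κ ≃ Fin (Module.finrank ℤ Λ) :=
    Fintype.equivFinOfCardEq (Module.finrank_eq_card_basis e).symm
  have h : Nonempty (Module.Basis (Fin (Module.finrank ℤ Λ)) ℤ Λ) := ⟨e.reindex ε⟩
  have h3 : (Matrix.of fun i j => form b ((e.reindex ε) i : V) ((e.reindex ε) j : V)) =
      (Matrix.of fun i j => form b (e i : V) (e j : V)).submatrix ε.symm ε.symm := by
    ext i j
    simp
  rw [vol, dif_pos h, key h.some (e.reindex ε), h3, Matrix.det_submatrix_equiv_self]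

/-- `Ξ̃_{λμ}` at level `r`, given by its explicit formula for all `λ, μ`. -/
def XiT (b : P.Base) (r : ℕ) (lam mu : V) : ℂ :=
  Complex.I ^ numPos b / (((r : ℝ) ^ ((rank b : ℝ) / 2) : ℝ) : ℂ) *
    ((|vol b (weightLattice b) / vol b (rootLattice b)| ^ (1 / 2 : ℝ) : ℝ) : ℂ) *
    ∑ᶠ w : P.weylGroup, (weylDet w : ℂ) *
      Complex.exp (-(2 * Real.pi * Complex.I / r) * (form b (w • lam) mu : ℝ))

open Classical in
/-- `Θ̃_{λμ}` at level `r`; here `θ` is the highest root. -/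
def ThetaT (b : P.Base) (θ : ι) (r : ℕ) (lam mu : V) : ℂ :=
  if lam = mu then
    Complex.exp (Real.pi * Complex.I / r * (form b lam lam : ℝ)
      - Real.pi * Complex.I / (coxeterNumber b θ : ℂ) * (form b (rho b) (rho b) : ℝ))
  else 0

/-- `B_k = Θ^{m_k} Ξ ⋯ Θ^{m_1} Ξ` in `SL(2, ℤ)`, with `B_0 = 1`; here
`Ξ = S = !![0, -1; 1, 0]` and `Θ = T = !![1, 1; 0, 1]`. -/
def B (m : ℕ → ℤ) : ℕ → Matrix.SpecialLinearGroup (Fin 2) ℤ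
  | 0 => 1
  | k + 1 => ModularGroup.T ^ m (k + 1) * ModularGroup.S * B m k

/-- The upper left entry `a_k` of `B_k`. -/
def a (m : ℕ → ℤ) (k : ℕ) : ℤ := B m k 0 0

/-- The lower left entry `c_k` of `B_k`. -/
def c (m : ℕ → ℤ) (k : ℕ) : ℤ := B m k 1 0

/-- The set of paths `(λ_0, λ_1, …, λ_t, λ_{t+1})` with prescribed ends whose inner points
`λ_1, …, λ_t` lie in `C_r ∩ Λ^W`. -/
def paths (b : P.Base) (θ : ι) (r t : ℕ) (lam0 lam1 : V) : Set (Fin (t + 2) → V) :=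
  {x | x 0 = lam0 ∧ x (Fin.last (t + 1)) = lam1 ∧
    ∀ k : Fin t, x k.succ.castSucc ∈ alcove b θ r ∩ (weightLattice b : Set V)}

/-- The iterated sum `𝒯^𝒞_{λ_0, λ_{t+1}}` for `𝒞 = (m_1, …, m_t)`. -/
def TSum (b : P.Base) (θ : ι) (r t : ℕ) (m : ℕ → ℤ) (lam0 lam1 : V) : ℂ :=
  ∑ᶠ x ∈ paths b θ r t lam0 lam1,
    (∏ k : Fin (t + 1), XiT b r (x k.succ) (x k.castSucc)) *
      ∏ k : Fin t, ThetaT b θ r (x k.succ.castSucc) (x k.succ.castSucc) ^ m ((k : ℕ) + 1)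

/-- `D_t = sign(a_0 a_1) + ⋯ + sign(a_{t-1} a_t)`. -/
def D (m : ℕ → ℤ) (t : ℕ) : ℤ := ∑ k ∈ Finset.Icc 1 t, Int.sign (a m (k - 1) * a m k)

/-- The constant `K^𝒞_{λ_0}` for `𝒞 = (m_1, …, m_t)`. -/
def K (b : P.Base) (θ : ι) (r t : ℕ) (m : ℕ → ℤ) (lam0 : V) : ℂ :=
  Complex.I ^ ((t + 1) * numPos b) /
      (((r * |(a m t : ℝ)|) ^ ((rank b : ℝ) / 2) * vol b (rootLattice b) : ℝ) : ℂ) *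
    Complex.exp (Real.pi * Complex.I / 4) ^ ((rank b : ℤ) * D m t) *
    Complex.exp (-(Real.pi * Complex.I / (coxeterNumber b θ : ℂ)) *
      (∑ i ∈ Finset.Icc 1 t, (m i : ℂ)) * (normSq b (rho b) : ℝ)) *
    Complex.exp (-(Real.pi * Complex.I / r) *
      (∑ i ∈ Finset.Ico 1 t, 1 / ((a m (i - 1) : ℂ) * (a m i : ℂ))) * (normSq b lam0 : ℝ))

/-- The quotient group `Λ / nΛ`. -/
abbrev ModN (Λ : Submodule ℤ V) (n : ℤ) : Type _ :=
  Λ ⧸ LinearMap.range (n • (LinearMap.id : Λ →ₗ[ℤ] Λ))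

end RootSystem

end SimplyLaced

end

/-! Induction on `t`, with the last weight as the running variable. As a function of that weight,
the iterated sum is antisymmetric under the Weyl group and periodic modulo `r Λ^R`, because its
outermost factor `XiT` is (`isAlternating_tSum`).

Alternation removes the alcove. The product of two alternating functions is invariant under the
affine Weyl group `W ⋉ r Λ^R` and vanishes on the walls. The affine group acts freely on the weights
in the open alcove, and every weight has a translate in the closed one. Hence `|W|` times the alcove
sum is the sum over `Λ^W / r Λ^R` (`card_mul_sum_alcove`). There the `|W|` exponentials of `XiT` all
contribute equally and the factor `|W|` cancels (`sum_xiT_mul`).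

Inserting the formula for `t` gives a double sum over `Λ^W / r Λ^R` and `Λ^R / a_t Λ^R`, which is
one sum over `Λ^W / a_t r Λ^R`. Its quadratic coefficient is `m_{t+1}/r - c_t/(a_t r) = a_{t+1}/(a_t
r)`, which is where the recursion of the matrix product enters. The result is a quadratic Gauss sum,
and reciprocity (`gauss_reciprocity`) converts it into a sum over `Λ^R / a_{t+1} Λ^R` with inverted
coefficient, at the cost of a volume, a power of `|a_t r / a_{t+1}|` and a power of `ζ` recording
`sign(a_t a_{t+1})`. Since `c_{t+1} = a_t`, this is the formula for `t + 1`
(`sum_xiT_mul_thetaT_mul`).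

The induction is fed with the square multiplied out, since the completed square divides by `c_t` and
`c_0 = 0`; in this form `XiT` itself is the case `t = 0`. Multiplying the square out adds
`1/(a_{t-1} a_t)` to the sum in the constant, which explains why that sum in `K` stops one term
earlier.

Reciprocity follows from the theta function of the even lattice `Λ^R`, whose dual is `Λ^W`. Poisson
summation gives the inversion law (`tsum_gaussian_eq`). As the parameter tends to a purely imaginary
rational multiple, the leading asymptotics of each side is a Gauss sum, and comparing the two limits
gives the identity (`gauss_reciprocity_aux`). -/

set_option linter.unusedSectionVars false

/-! ### Poisson summation for Gaussians and the inversion law of theta functions -/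

noncomputable section

namespace SimplyLaced

section Theta

open MeasureTheory Filter Topology Matrix Complex

variable {κ : Type*} [Fintype κ]

/-- A finite set of multi-indices lies in the box of its coordinate projections, and over a box the
sum factors. -/
theorem summable_prod_comp {f : ℤ → ℝ} (hf0 : ∀ n, 0 ≤ f n) (hf : Summable f) :
    Summable fun n : κ → ℤ => ∏ i, f (n i) := by
  classical
  refine summable_of_sum_le (c := ∏ _i : κ, ∑' n, f n)
    (fun n => Finset.prod_nonneg fun i _ => hf0 _) fun s => ?_
  calc ∑ n ∈ s, ∏ i, f (n i)
      ≤ ∑ n ∈ Fintype.piFinset fun i => s.image fun n => n i, ∏ i, f (n i) := by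
        refine Finset.sum_le_sum_of_subset_of_nonneg (fun n hn => ?_)
          fun n _ _ => Finset.prod_nonneg fun i _ => hf0 _
        exact Fintype.mem_piFinset.2 fun i => Finset.mem_image_of_mem _ hn
    _ = ∏ i, ∑ z ∈ s.image fun n => n i, f z := by rw [Finset.prod_univ_sum]
    _ ≤ _ := Finset.prod_le_prod (fun i _ => Finset.sum_nonneg fun z _ => hf0 _)
        fun i _ => hf.sum_le_tsum _ fun z _ => hf0 z

theorem summable_exp_neg_mul_sum_sq {c : ℝ} (hc : 0 < c) :
    Summable fun n : κ → ℤ => Real.exp (-c * ∑ i, (n i : ℝ) ^ 2) := by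
  have h1 : Summable fun n : ℤ => Real.exp (-c * (n : ℝ) ^ 2) := by
    have h2 : Summable fun n : ℕ => Real.exp (-c * n) := by
      have := Real.summable_exp_nat_mul_iff.2 (neg_lt_zero.2 hc)
      exact this.congr fun n => by rw [mul_comm]
    have h3 : Summable fun n : ℕ => Real.exp (-c * (n : ℝ) ^ 2) := by
      refine h2.of_nonneg_of_le (fun _ => (Real.exp_pos _).le) fun n => ?_
      rw [Real.exp_le_exp]
      have : (n : ℝ) ≤ (n : ℝ) ^ 2 := by exact_mod_cast Nat.le_self_pow two_ne_zero n
      nlinarith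
    exact Summable.of_nat_of_neg (by simpa using h3) (by simpa using h3)
  refine (summable_prod_comp (fun n => (Real.exp_pos _).le) h1).congr fun n => ?_
  rw [← Real.exp_sum, Finset.mul_sum]

/-- Write `v = M⁻¹ (M v)` and apply Cauchy–Schwarz row by row; `S` is the squared Frobenius norm of
`M⁻¹`. Using `S + 1` keeps the constant positive also when `κ` is empty. -/
theorem exists_mul_sum_sq_le_mulVec [DecidableEq κ] (M : Matrix κ κ ℝ) (hM : M.det ≠ 0) :
    ∃ c > 0, ∀ v : κ → ℝ, c * ∑ i, v i ^ 2 ≤ (M *ᵥ v) ⬝ᵥ (M *ᵥ v) := by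
  set S : ℝ := ∑ i, ∑ j, M⁻¹ i j ^ 2
  have hS : 0 ≤ S := by positivity
  refine ⟨(S + 1)⁻¹, by positivity, fun v => ?_⟩
  have hv : v = M⁻¹ *ᵥ (M *ᵥ v) := by
    rw [mulVec_mulVec, nonsing_inv_mul _ (isUnit_iff_ne_zero.2 hM), one_mulVec]
  set u := M *ᵥ v
  have hu : 0 ≤ u ⬝ᵥ u := by
    simp only [dotProduct]; exact Finset.sum_nonneg fun i _ => mul_self_nonneg _
  have h1 : ∑ i, v i ^ 2 ≤ S * (u ⬝ᵥ u) := by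
    rw [Finset.sum_mul]
    refine Finset.sum_le_sum fun i _ => ?_
    have h2 : v i = ∑ j, M⁻¹ i j * u j := by
      conv_lhs => rw [hv]
      rfl
    rw [h2]
    refine (Finset.sum_mul_sq_le_sq_mul_sq _ _ _).trans_eq ?_
    simp [dotProduct, sq]
  rw [inv_mul_le_iff₀ (by positivity)]
  nlinarith

variable (M : Matrix κ κ ℝ)

/-- The Gaussian `exp(-π a |M x|²)`. -/
def gaussian (a : ℂ) (x : κ → ℝ) : ℂ :=
  cexp (-(Real.pi * a) * (((M *ᵥ x) ⬝ᵥ (M *ᵥ x) : ℝ) : ℂ))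

theorem continuous_gaussian (a : ℂ) : Continuous (gaussian M a) := by
  unfold gaussian
  fun_prop

theorem norm_gaussian (a : ℂ) (x : κ → ℝ) :
    ‖gaussian M a x‖ = Real.exp (-(Real.pi * a.re) * ((M *ᵥ x) ⬝ᵥ (M *ᵥ x))) := by
  rw [gaussian, norm_exp]
  simp

variable {M}

theorem norm_gaussian_le {c : ℝ} (hc : ∀ v : κ → ℝ, c * ∑ i, v i ^ 2 ≤ (M *ᵥ v) ⬝ᵥ (M *ᵥ v))
    {a : ℂ} (ha : 0 < a.re) (x : κ → ℝ) :
    ‖gaussian M a x‖ ≤ Real.exp (-(Real.pi * a.re * c) * ∑ i, x i ^ 2) := by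
  rw [norm_gaussian, Real.exp_le_exp]
  have := hc x
  have : 0 < Real.pi * a.re := by positivity
  nlinarith

/-- Since `|x + n|² ≥ |n|²/2 - |x|²`, the translates are dominated by one summable sequence,
uniformly for `x` in a ball. This yields both summability and continuity of the periodization. -/
theorem norm_gaussian_add_le {c : ℝ} (hc0 : 0 < c)
    (hc : ∀ v : κ → ℝ, c * ∑ i, v i ^ 2 ≤ (M *ᵥ v) ⬝ᵥ (M *ᵥ v))
    {a : ℂ} (ha : 0 < a.re) {R : ℝ} (x : κ → ℝ) (hx : ∑ i, x i ^ 2 ≤ R) (n : κ → ℤ) :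
    ‖gaussian M a (x + fun i => (n i : ℝ))‖ ≤ Real.exp (Real.pi * a.re * c * R) *
      Real.exp (-(Real.pi * a.re * c / 2) * ∑ i, (n i : ℝ) ^ 2) := by
  refine (norm_gaussian_le hc ha _).trans ?_
  rw [← Real.exp_add, Real.exp_le_exp]
  have h0 : 0 < Real.pi * a.re * c := by positivity
  have h1 : (∑ i, (n i : ℝ) ^ 2) / 2 - ∑ i, x i ^ 2 ≤ ∑ i, (x + fun i => (n i : ℝ)) i ^ 2 := by
    rw [Finset.sum_div, ← Finset.sum_sub_distrib]
    refine Finset.sum_le_sum fun i _ => ?_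
    simp only [Pi.add_apply]
    nlinarith [sq_nonneg (2 * x i + n i)]
  nlinarith

theorem integrable_gaussian [DecidableEq κ] (hM : M.det ≠ 0) {a : ℂ} (ha : 0 < a.re) :
    Integrable (gaussian M a) := by
  obtain ⟨c, hc0, hc⟩ := exists_mul_sum_sq_le_mulVec M hM
  have h : Integrable fun x : κ → ℝ => ∏ i, Real.exp (-(Real.pi * a.re * c) * x i ^ 2) :=
    Integrable.fintype_prod fun i => integrable_exp_neg_mul_sq (by positivity)
  refine h.mono' (continuous_gaussian M a).aestronglyMeasurable (Eventually.of_forall fun x => ?_)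
  refine (norm_gaussian_le hc ha x).trans_eq ?_
  rw [← Real.exp_sum, Finset.mul_sum]

theorem summable_gaussian [DecidableEq κ] (hM : M.det ≠ 0) {a : ℂ} (ha : 0 < a.re) (x : κ → ℝ) :
    Summable fun n : κ → ℤ => gaussian M a (x + fun i => (n i : ℝ)) := by
  obtain ⟨c, hc0, hc⟩ := exists_mul_sum_sq_le_mulVec M hM
  refine Summable.of_norm_bounded ((summable_exp_neg_mul_sum_sq ?_).mul_left _)
    fun n => norm_gaussian_add_le hc0 hc ha x le_rfl n
  positivity

theorem continuous_tsum_gaussian [DecidableEq κ] (hM : M.det ≠ 0) {a : ℂ} (ha : 0 < a.re) :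
    Continuous fun x : κ → ℝ => ∑' n : κ → ℤ, gaussian M a (x + fun i => (n i : ℝ)) := by
  obtain ⟨c, hc0, hc⟩ := exists_mul_sum_sq_le_mulVec M hM
  rw [continuous_iff_continuousAt]
  intro x0
  set U : Set (κ → ℝ) := {x | ∑ i, x i ^ 2 < ∑ i, x0 i ^ 2 + 1}
  have hU : IsOpen U := isOpen_lt (by fun_prop) (by fun_prop)
  refine ContinuousOn.continuousAt (s := U) ?_ (hU.mem_nhds (by simp [U]))
  refine continuousOn_tsum (fun n => ((continuous_gaussian M a).comp
    (by fun_prop)).continuousOn) ((summable_exp_neg_mul_sum_sq ?_).mul_left _)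
    fun n x hx => norm_gaussian_add_le hc0 hc ha x (le_of_lt hx) n
  positivity

/-- Integral of a Gaussian against a character. -/
theorem integral_gaussian_mul_character [DecidableEq κ] (hM : M.det ≠ 0) {a : ℂ} (ha : 0 < a.re)
    (k : κ → ℝ) :
    ∫ x : κ → ℝ, cexp (-(2 * Real.pi * I) * ((k ⬝ᵥ x : ℝ) : ℂ)) * gaussian M a x =
      ((|M.det|⁻¹ : ℝ) : ℂ) * (1 / a) ^ (Fintype.card κ / 2 : ℂ) * gaussian (M⁻¹)ᵀ (1 / a) k := by
  have ha0 : a ≠ 0 := fun h => by simp [h] at ha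
  set F : (κ → ℝ) → ℂ := fun y => cexp (-(Real.pi * a) * ∑ i, (y i : ℂ) ^ 2 +
    ∑ i, (-(2 * Real.pi * I) * (((M⁻¹)ᵀ *ᵥ k) i : ℝ)) * y i) with hF
  have h1 : ∀ x : κ → ℝ, cexp (-(2 * Real.pi * I) * ((k ⬝ᵥ x : ℝ) : ℂ)) * gaussian M a x =
      F (Matrix.toLin' M x) := by
    intro x
    -- The substitution `y = M x` turns the integrand into a standard Gaussian against the character
    -- of frequency `M⁻ᵀ k`.
    have e1 : k ⬝ᵥ x = ((M⁻¹)ᵀ *ᵥ k) ⬝ᵥ (M *ᵥ x) := by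
      rw [mulVec_transpose, ← dotProduct_mulVec, mulVec_mulVec,
        nonsing_inv_mul _ (isUnit_iff_ne_zero.2 hM), one_mulVec]
    rw [gaussian, ← Complex.exp_add, hF, e1]
    simp only [Matrix.toLin'_apply]
    congr 1
    simp only [dotProduct, Complex.ofReal_sum, Complex.ofReal_mul, Finset.mul_sum, sq, mul_assoc]
    rw [add_comm]
  simp_rw [h1]
  have hFc : Continuous F := by fun_prop
  have h2 := Real.map_matrix_volume_pi_eq_smul_volume_pi hM
  have h3 : ∫ x, F (Matrix.toLin' M x) = ∫ y, F y ∂(Measure.map (Matrix.toLin' M) volume) := by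
    rw [integral_map]
    · exact (LinearMap.continuous_of_finiteDimensional _).aemeasurable
    · exact hFc.aestronglyMeasurable
  rw [h3, h2, integral_smul_measure, hF, GaussianFourier.integral_cexp_neg_mul_sum_add]
  swap
  · simpa using mul_pos Real.pi_pos ha
  have hpi : (Real.pi : ℂ) ≠ 0 := by exact_mod_cast Real.pi_ne_zero
  rw [ENNReal.toReal_ofReal (abs_nonneg _), abs_inv, Complex.real_smul, mul_assoc,
    div_mul_cancel_left₀ hpi, one_div, mul_assoc]
  congr 2
  · rw [gaussian]
    congr 1
    simp only [dotProduct, Complex.ofReal_sum, Complex.ofReal_mul, Finset.mul_sum, Finset.sum_div]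
    refine Finset.sum_congr rfl fun i _ => ?_
    field_simp
    rw [Complex.I_sq]
    ring

/-- The integer translates of the half-open unit cube tile the space; the tile containing `x` has
label `⌈x i⌉ - 1`. The endpoint is written `0 + 1` to match the Fourier coefficient integral based
at `0`. -/
theorem integral_eq_tsum_setIntegral {g : (κ → ℝ) → ℂ} (hg : Integrable g) :
    HasSum (fun n : κ → ℤ => ∫ x in {x : κ → ℝ | ∀ i, x i ∈ Set.Ioc (0 : ℝ) (0 + 1)},
      g (x + fun i => (n i : ℝ))) (∫ x, g x) := by
  set C : Set (κ → ℝ) := {x : κ → ℝ | ∀ i, x i ∈ Set.Ioc (0 : ℝ) (0 + 1)}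
  have hC : MeasurableSet C := MeasurableSet.univ_pi' fun i => measurableSet_Ioc
  let S : (κ → ℤ) → Set (κ → ℝ) := fun n => (fun x => x + fun i => -(n i : ℝ)) ⁻¹' C
  have hSm : ∀ n, MeasurableSet (S n) := fun n => (measurable_add_const _) hC
  have hkey : ∀ n x, x ∈ S n ↔ ∀ i, n i = ⌈x i⌉ - 1 := by
    intro n x
    simp only [S, C, Set.mem_preimage, Set.mem_ofPred_eq, Set.mem_Ioc, Pi.add_apply]
    refine forall_congr' fun i => ?_
    rw [eq_sub_iff_add_eq, eq_comm, Int.ceil_eq_iff]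
    push_cast
    constructor <;> rintro ⟨h1, h2⟩ <;> constructor <;> linarith
  have hdisj : Pairwise (Function.onFun Disjoint S) := by
    intro n n' hne
    refine Set.disjoint_left.2 fun x hx hx' => hne ?_
    rw [hkey] at hx hx'
    exact funext fun i => (hx i).trans (hx' i).symm
  have hunion : ⋃ n, S n = Set.univ :=
    Set.eq_univ_of_forall fun x => Set.mem_iUnion.2 ⟨fun i => ⌈x i⌉ - 1, (hkey _ _).2 fun i => rfl⟩
  have h := hasSum_integral_iUnion hSm hdisj (f := g) (μ := volume) hg.integrableOn
  rw [hunion, Measure.restrict_univ] at h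
  suffices e : (fun n : κ → ℤ => ∫ x in C, g (x + fun i => (n i : ℝ))) =
      fun n => ∫ x in S n, g x by
    rw [e]
    exact h
  funext n
  have := (measurePreserving_add_right (volume : Measure (κ → ℝ))
    (fun i => -(n i : ℝ))).setIntegral_preimage_emb (measurableEmbedding_addRight _)
    (fun x => g (x + fun i => (n i : ℝ))) C
  rw [← this]
  refine setIntegral_congr_fun (hSm n) fun x _ => congrArg g ?_
  ext i
  simp

theorem summable_setIntegral_norm {g : (κ → ℝ) → ℂ} (hg : Integrable g) :
    Summable (fun n : κ → ℤ => ∫ x in {x : κ → ℝ | ∀ i, x i ∈ Set.Ioc (0 : ℝ) (0 + 1)},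
      ‖g (x + fun i => (n i : ℝ))‖) := by
  have h := (integral_eq_tsum_setIntegral (g := fun x => (‖g x‖ : ℂ)) hg.norm.ofReal).summable
  have h2 := h.norm
  refine h2.congr fun n => ?_
  rw [integral_complex_ofReal, Complex.norm_real, Real.norm_of_nonneg]
  exact integral_nonneg fun x => norm_nonneg _

theorem tsum_gaussian_add_intCast (a : ℂ) (x : κ → ℝ) (m : κ → ℤ) :
    ∑' n : κ → ℤ, gaussian M a ((x + fun i => (m i : ℝ)) + fun i => (n i : ℝ)) =
      ∑' n : κ → ℤ, gaussian M a (x + fun i => (n i : ℝ)) := by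
  rw [← (Equiv.addLeft m).tsum_eq fun n : κ → ℤ => gaussian M a (x + fun i => (n i : ℝ))]
  refine tsum_congr fun n => congrArg _ ?_
  ext i
  simp [add_assoc]

theorem tsum_gaussian_out (a : ℂ) (x : κ → ℝ) :
    ∑' n : κ → ℤ, gaussian M a ((fun i => Quotient.out (x i : UnitAddCircle)) +
      fun i => (n i : ℝ)) = ∑' n : κ → ℤ, gaussian M a (x + fun i => (n i : ℝ)) := by
  have h : ∀ i, ∃ m : ℤ, Quotient.out (x i : UnitAddCircle) = x i + m := by
    intro i
    have h1 : ((Quotient.out (x i : UnitAddCircle) : ℝ) : UnitAddCircle) = (x i : UnitAddCircle) :=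
      Quotient.out_eq _
    rw [← sub_eq_zero, ← AddCircle.coe_sub, AddCircle.coe_eq_zero_iff] at h1
    obtain ⟨m, hm⟩ := h1
    refine ⟨m, ?_⟩
    rw [zsmul_one] at hm
    rw [hm]
    ring
  choose m hm using h
  rw [← tsum_gaussian_add_intCast a x m]
  refine tsum_congr fun n => congrArg _ ?_
  ext i
  simp [hm]

/-- The periodization of a Gaussian as a function on the torus. -/
def gaussianTorus [DecidableEq κ] (hM : M.det ≠ 0) {a : ℂ} (ha : 0 < a.re) :
    C(UnitAddTorus κ, ℂ) where
  toFun z := ∑' n : κ → ℤ, gaussian M a ((fun i => Quotient.out (z i)) + fun i => (n i : ℝ))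
  continuous_toFun := by
    -- `Quotient.out` is not continuous, so continuity is checked after pulling back along the
    -- quotient map, where the choice of representative no longer matters.
    have hq : IsOpenQuotientMap (Pi.map fun _ : κ => ((↑) : ℝ → UnitAddCircle)) :=
      IsOpenQuotientMap.piMap fun _ => QuotientAddGroup.isOpenQuotientMap_mk
    rw [← hq.continuous_comp_iff]
    refine (continuous_tsum_gaussian hM ha).congr fun x => ?_
    exact (tsum_gaussian_out a x).symm

theorem gaussianTorus_coe [DecidableEq κ] (hM : M.det ≠ 0) {a : ℂ} (ha : 0 < a.re) (x : κ → ℝ) :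
    gaussianTorus hM ha (fun i => (x i : UnitAddCircle)) =
      ∑' n : κ → ℤ, gaussian M a (x + fun i => (n i : ℝ)) :=
  tsum_gaussian_out a x

theorem mFourier_coe (k : κ → ℤ) (x : κ → ℝ) :
    UnitAddTorus.mFourier k (fun i => (x i : UnitAddCircle)) =
      cexp (2 * Real.pi * I * (((fun i => (k i : ℝ)) ⬝ᵥ x : ℝ) : ℂ)) := by
  simp only [UnitAddTorus.mFourier, ContinuousMap.coe_mk, fourier_coe_apply, ← Complex.exp_sum,
    dotProduct, Complex.ofReal_sum, Finset.mul_sum]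
  congr 1
  refine Finset.sum_congr rfl fun i _ => ?_
  push_cast
  ring

/-- Unfolding: integrating the periodization over a cube against a periodic character is integrating
the Gaussian over the whole space, so the coefficient is its Fourier transform at `k`. -/
theorem mFourierCoeff_gaussianTorus [DecidableEq κ] (hM : M.det ≠ 0) {a : ℂ} (ha : 0 < a.re)
    (k : κ → ℤ) :
    UnitAddTorus.mFourierCoeff (gaussianTorus hM ha) k =
      ((|M.det|⁻¹ : ℝ) : ℂ) * (1 / a) ^ (Fintype.card κ / 2 : ℂ) *
        gaussian (M⁻¹)ᵀ (1 / a) (fun i => (k i : ℝ)) := by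
  set g : (κ → ℝ) → ℂ := fun x =>
    cexp (-(2 * Real.pi * I) * (((fun i => (k i : ℝ)) ⬝ᵥ x : ℝ) : ℂ)) * gaussian M a x with hgdef
  have hnorm : ∀ x, ‖g x‖ = ‖gaussian M a x‖ := by
    intro x
    rw [hgdef, norm_mul, norm_exp]
    simp
  have hgc : Continuous g := by
    have := continuous_gaussian M a
    fun_prop
  have hg : Integrable g :=
    (integrable_gaussian hM ha).norm.mono' hgc.aestronglyMeasurable
      (Eventually.of_forall fun x => (hnorm x).le)
  rw [← integral_gaussian_mul_character hM ha, ← (integral_eq_tsum_setIntegral hg).tsum_eq,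
    UnitAddTorus.mFourierCoeff_eq_integral _ _ 0]
  rw [integral_tsum_of_summable_integral_norm]
  · refine integral_congr_ae (Eventually.of_forall fun x => ?_)
    simp only [gaussianTorus_coe, smul_eq_mul, mFourier_coe]
    rw [← tsum_mul_left]
    refine tsum_congr fun n => ?_
    rw [hgdef]
    congr 1
    simp only [Pi.neg_apply, Int.cast_neg]
    have h1 : (fun i => -(k i : ℝ)) ⬝ᵥ x = -((fun i => (k i : ℝ)) ⬝ᵥ x) := neg_dotProduct _ _
    rw [h1, dotProduct_add, Complex.exp_eq_exp_iff_exists_int]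
    refine ⟨∑ i, k i * n i, ?_⟩
    simp only [dotProduct]
    push_cast
    ring
  · intro n
    exact (hg.comp_add_right _).integrableOn
  · exact summable_setIntegral_norm hg

/-- The transformation law of the theta function of a lattice. -/
theorem tsum_gaussian_eq [DecidableEq κ] (hM : M.det ≠ 0) {a : ℂ} (ha : 0 < a.re) (x : κ → ℝ) :
    ∑' n : κ → ℤ, gaussian M a (x + fun i => (n i : ℝ)) =
      ((|M.det|⁻¹ : ℝ) : ℂ) * (1 / a) ^ (Fintype.card κ / 2 : ℂ) *
        ∑' k : κ → ℤ, gaussian (M⁻¹)ᵀ (1 / a) (fun i => (k i : ℝ)) *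
          cexp (2 * Real.pi * I * (((fun i => (k i : ℝ)) ⬝ᵥ x : ℝ) : ℂ)) := by
  have ha' : 0 < (1 / a).re := by
    rw [one_div, Complex.inv_re]
    have : a ≠ 0 := fun h => by simp [h] at ha
    have := Complex.normSq_pos.2 this
    positivity
  have hM' : ((M⁻¹)ᵀ).det ≠ 0 := by
    rw [det_transpose, det_nonsing_inv, Ring.inverse_eq_inv']
    exact inv_ne_zero hM
  -- The coefficients are again values of a Gaussian, for the inverse transpose and `1 / a`; their
  -- summability makes the Fourier series converge pointwise.
  have hs : Summable (UnitAddTorus.mFourierCoeff (gaussianTorus hM ha)) := by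
    simp only [funext (mFourierCoeff_gaussianTorus hM ha)]
    refine Summable.mul_left _ ?_
    simpa using summable_gaussian hM' ha' 0
  have h := UnitAddTorus.hasSum_mFourier_series_apply_of_summable hs
    (fun i => (x i : UnitAddCircle))
  rw [gaussianTorus_coe] at h
  rw [← h.tsum_eq, ← tsum_mul_left]
  refine tsum_congr fun k => ?_
  rw [mFourierCoeff_gaussianTorus, mFourier_coe, smul_eq_mul, mul_assoc]

end Theta

end SimplyLaced

end

/-! ### Asymptotics of theta functions and reciprocity for an even lattice -/

noncomputable section

namespace SimplyLaced

section Reciprocity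

open MeasureTheory Filter Topology Matrix Complex

variable {κ : Type*} [Fintype κ] [DecidableEq κ] {M : Matrix κ κ ℝ}
  {V : Type*} [AddCommGroup V] [Module ℝ V] {B : LinearMap.BilinForm ℝ V}
  {e : (κ → ℝ) ≃ₗ[ℝ] V}

/-- The inclusion of integral vectors in real vectors. -/
def intVec (n : κ → ℤ) : κ → ℝ := fun i => (n i : ℝ)

/-- The vector pairing with `e x` to `k ⬝ᵥ x`, where `e` has Gram matrix `Mᵀ M`. -/
def dualVec (M : Matrix κ κ ℝ) (e : (κ → ℝ) ≃ₗ[ℝ] V) (k : κ → ℝ) : V := e (M⁻¹ *ᵥ ((M⁻¹)ᵀ *ᵥ k))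

theorem mulVec_inv_mulVec (hM : M.det ≠ 0) (u : κ → ℝ) : M *ᵥ (M⁻¹ *ᵥ u) = u := by
  rw [mulVec_mulVec, mul_nonsing_inv _ (isUnit_iff_ne_zero.2 hM), one_mulVec]

theorem form_dualVec (hM : M.det ≠ 0) (he : ∀ x y, B (e x) (e y) = (M *ᵥ x) ⬝ᵥ (M *ᵥ y))
    (k x : κ → ℝ) : B (dualVec M e k) (e x) = k ⬝ᵥ x := by
  rw [dualVec, he, mulVec_inv_mulVec hM, mulVec_transpose, ← dotProduct_mulVec, mulVec_mulVec,
    nonsing_inv_mul _ (isUnit_iff_ne_zero.2 hM), one_mulVec]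

omit [DecidableEq κ] in
theorem gaussian_eq (he : ∀ x y, B (e x) (e y) = (M *ᵥ x) ⬝ᵥ (M *ᵥ y)) (a : ℂ) (x : κ → ℝ) :
    gaussian M a x = cexp (-(Real.pi * a) * (B (e x) (e x) : ℝ)) := by
  rw [gaussian, he]

theorem gaussian_dual_eq (hM : M.det ≠ 0) (he : ∀ x y, B (e x) (e y) = (M *ᵥ x) ⬝ᵥ (M *ᵥ y))
    (a : ℂ) (k : κ → ℝ) :
    gaussian (M⁻¹)ᵀ a k =
      cexp (-(Real.pi * a) * (B (dualVec M e k) (dualVec M e k) : ℝ)) := by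
  rw [gaussian, dualVec, he, mulVec_inv_mulVec hM]

/-- Transformation law of the theta function of the lattice spanned by `e`, with dual lattice given
by `dualVec M e`. -/
theorem tsum_theta_eq (hM : M.det ≠ 0) (he : ∀ x y, B (e x) (e y) = (M *ᵥ x) ⬝ᵥ (M *ᵥ y))
    {a : ℂ} (ha : 0 < a.re) (y : V) :
    ∑' n : κ → ℤ, cexp (-(Real.pi * a) * (B (y + e (intVec n)) (y + e (intVec n)) : ℝ)) =
      ((|M.det|⁻¹ : ℝ) : ℂ) * (1 / a) ^ (Fintype.card κ / 2 : ℂ) *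
        ∑' k : κ → ℤ, cexp (-(Real.pi * (1 / a)) *
            (B (dualVec M e (intVec k)) (dualVec M e (intVec k)) : ℝ)) *
          cexp (2 * Real.pi * I * (B (dualVec M e (intVec k)) y : ℝ)) := by
  obtain ⟨x, rfl⟩ := e.surjective y
  have h := tsum_gaussian_eq hM ha x
  simp only [gaussian_dual_eq hM he, gaussian_eq he, map_add e] at h
  simp only [form_dualVec hM he]
  exact h

omit [DecidableEq κ] in
theorem norm_cexp_neg_mul_le {q : ℝ} (hq : 0 ≤ q) {z : ℂ} (hz : 1 ≤ z.re) :
    ‖cexp (-(Real.pi * z) * (q : ℝ))‖ ≤ ‖cexp (-(Real.pi * 1) * (q : ℝ))‖ := by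
  rw [norm_exp, norm_exp, Real.exp_le_exp]
  have := Real.pi_pos
  simp
  have h : Real.pi * 1 ≤ Real.pi * z.re := by gcongr
  nlinarith

omit [DecidableEq κ] in
theorem form_self_nonneg (he : ∀ x y, B (e x) (e y) = (M *ᵥ x) ⬝ᵥ (M *ᵥ y)) (y : V) :
    0 ≤ B y y := by
  obtain ⟨x, rfl⟩ := e.surjective y
  rw [he]
  exact Finset.sum_nonneg fun i _ => mul_self_nonneg _

theorem form_self_pos (hM : M.det ≠ 0) (he : ∀ x y, B (e x) (e y) = (M *ᵥ x) ⬝ᵥ (M *ᵥ y)) {y : V}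
    (hy : y ≠ 0) : 0 < B y y := by
  obtain ⟨x, rfl⟩ := e.surjective y
  rw [he]
  refine (Finset.sum_nonneg fun i _ => mul_self_nonneg _).lt_of_ne' fun h => hy ?_
  have h1 : M *ᵥ x = 0 := dotProduct_self_eq_zero.1 h
  have h2 : x = 0 := by
    have := congrArg (fun u => M⁻¹ *ᵥ u) h1
    simpa [mulVec_mulVec, nonsing_inv_mul _ (isUnit_iff_ne_zero.2 hM)] using this
  rw [h2, map_zero]

theorem dualVec_zero : dualVec M e (intVec (0 : κ → ℤ)) = 0 := by
  have : intVec (0 : κ → ℤ) = 0 := by ext; simp [intVec]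
  simp [dualVec, this]

theorem dualVec_ne_zero (hM : M.det ≠ 0) (he : ∀ x y, B (e x) (e y) = (M *ᵥ x) ⬝ᵥ (M *ᵥ y))
    {k : κ → ℤ} (hk : k ≠ 0) : dualVec M e (intVec k) ≠ 0 := by
  intro h
  obtain ⟨i, hi⟩ := Function.ne_iff.1 hk
  have := form_dualVec hM he (intVec k) (Pi.single i 1)
  rw [h] at this
  simp [intVec] at this
  exact hi (by simpa using this.symm)

/-- Leading asymptotics of the theta function of a lattice. -/
theorem tendsto_tsum_theta (hM : M.det ≠ 0)
    (he : ∀ x y, B (e x) (e y) = (M *ᵥ x) ⬝ᵥ (M *ᵥ y)) {α : Type*} {l : Filter α}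
    {a : α → ℂ} (ha : ∀ᶠ t in l, 0 < (a t).re) (ha' : Tendsto (fun t => (1 / a t).re) l atTop)
    (y : V) :
    Tendsto (fun t => (∑' n : κ → ℤ, cexp (-(Real.pi * a t) *
        (B (y + e (intVec n)) (y + e (intVec n)) : ℝ))) /
          (1 / a t) ^ (Fintype.card κ / 2 : ℂ)) l (𝓝 ((|M.det|⁻¹ : ℝ) : ℂ)) := by
  set Q : (κ → ℤ) → ℝ := fun k => B (dualVec M e (intVec k)) (dualVec M e (intVec k))
  have hM' : ((M⁻¹)ᵀ).det ≠ 0 := by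
    rw [det_transpose, det_nonsing_inv, Ring.inverse_eq_inv']
    exact inv_ne_zero hM
  have hsum : Summable fun k : κ → ℤ => ‖cexp (-(Real.pi * 1) * (Q k : ℝ))‖ := by
    have := (summable_gaussian hM' (a := 1) (by simp) 0).norm
    refine this.congr fun k => ?_
    rw [zero_add, gaussian_dual_eq hM he]
    rfl
  -- On the dual side every term with `k ≠ 0` decays as `Re (1 / a) → ∞`, so only the constant term
  -- survives; the terms at `1 / a = 1` dominate.
  have hlim : Tendsto (fun t => ∑' k : κ → ℤ, cexp (-(Real.pi * (1 / a t)) * (Q k : ℝ)) *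
      cexp (2 * Real.pi * I * (B (dualVec M e (intVec k)) y : ℝ))) l
      (𝓝 (∑' k : κ → ℤ, if k = 0 then 1 else 0)) := by
    refine tendsto_tsum_of_dominated_convergence hsum (fun k => ?_) ?_
    · split_ifs with hk
      · subst hk
        simp only [Q, dualVec_zero]
        simpa using tendsto_const_nhds
      · rw [tendsto_zero_iff_norm_tendsto_zero]
        have hq : 0 < Q k := form_self_pos hM he (dualVec_ne_zero hM he hk)
        have h1 : ∀ t, ‖cexp (-(Real.pi * (1 / a t)) * (Q k : ℝ)) *
            cexp (2 * Real.pi * I * (B (dualVec M e (intVec k)) y : ℝ))‖ =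
            Real.exp (-(Real.pi * Q k * (1 / a t).re)) := by
          intro t
          rw [norm_mul, norm_exp, norm_exp]
          simp
          ring
        simp only [h1]
        refine Real.tendsto_exp_neg_atTop_nhds_zero.comp ?_
        exact ha'.const_mul_atTop (by positivity)
    · filter_upwards [ha'.eventually_ge_atTop 1] with t ht k
      rw [norm_mul]
      have : ‖cexp (2 * Real.pi * I * (B (dualVec M e (intVec k)) y : ℝ))‖ = 1 := by
        rw [norm_exp]; simp
      rw [this, mul_one]
      exact norm_cexp_neg_mul_le (form_self_nonneg he _) ht
  rw [tsum_ite_eq] at hlim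
  have h2 := hlim.const_mul ((|M.det|⁻¹ : ℝ) : ℂ)
  rw [mul_one] at h2
  refine h2.congr' ?_
  filter_upwards [ha] with t ht
  have hne : (1 / a t) ^ (Fintype.card κ / 2 : ℂ) ≠ 0 := by
    have h0 : a t ≠ 0 := fun h => by simp [h] at ht
    rw [Complex.cpow_def_of_ne_zero (one_div_ne_zero h0)]
    exact Complex.exp_ne_zero _
  rw [tsum_theta_eq hM he ht, eq_div_iff hne]
  ring

omit [Fintype κ] [DecidableEq κ] in
theorem ofReal_mul_cpow {x : ℝ} (hx : 0 < x) {z : ℂ} (hz : z ≠ 0) (w : ℂ) :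
    ((x : ℂ) * z) ^ w = (x : ℂ) ^ w * z ^ w := by
  have hx' : (x : ℂ) ≠ 0 := by exact_mod_cast hx.ne'
  rw [cpow_def_of_ne_zero (mul_ne_zero hx' hz), cpow_def_of_ne_zero hx', cpow_def_of_ne_zero hz,
    Complex.log_ofReal_mul hx hz, ← Complex.exp_add, Complex.ofReal_log hx.le, add_mul]

/-- Leading asymptotics of the theta function of a rescaled lattice. -/
theorem tendsto_tsum_theta_smul (hM : M.det ≠ 0)
    (he : ∀ x y, B (e x) (e y) = (M *ᵥ x) ⬝ᵥ (M *ᵥ y)) {α : Type*} {l : Filter α}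
    {a : α → ℂ} (ha : ∀ᶠ t in l, 0 < (a t).re) (ha' : Tendsto (fun t => (1 / a t).re) l atTop)
    (y : V) {N : ℤ} (hN : N ≠ 0) :
    Tendsto (fun t => (∑' n : κ → ℤ, cexp (-(Real.pi * a t) *
        (B (y + (N : ℝ) • e (intVec n)) (y + (N : ℝ) • e (intVec n)) : ℝ))) /
          (1 / a t) ^ (Fintype.card κ / 2 : ℂ)) l
      (𝓝 ((|M.det|⁻¹ * (|(N : ℝ)| ^ Fintype.card κ)⁻¹ : ℝ) : ℂ)) := by
  have hN' : (N : ℝ) ≠ 0 := by exact_mod_cast hN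
  have hN2 : 0 < (N : ℝ) ^ 2 := by positivity
  have hre : ∀ t, (a t * ((N : ℝ) ^ 2 : ℝ)).re = (a t).re * (N : ℝ) ^ 2 := by
    intro t; rw [Complex.re_mul_ofReal]
  have hinv : ∀ t, 1 / (a t * ((N : ℝ) ^ 2 : ℝ)) = (((N : ℝ) ^ 2)⁻¹ : ℝ) * (1 / a t) := by
    intro t; push_cast; field_simp
  -- The theta function of `N` times the lattice at `a` is that of the lattice itself at `a N²`,
  -- with shift `y / N`.
  have h := tendsto_tsum_theta hM he (l := l) (a := fun t => a t * ((N : ℝ) ^ 2 : ℝ)) ?_ ?_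
    ((N : ℝ)⁻¹ • y)
  rotate_left
  · filter_upwards [ha] with t ht
    rw [hre]; positivity
  · simp only [hinv, Complex.re_ofReal_mul]
    exact ha'.const_mul_atTop (by positivity)
  have h2 := h.mul_const (((|(N : ℝ)| ^ Fintype.card κ)⁻¹ : ℝ) : ℂ)
  rw [← Complex.ofReal_mul] at h2
  refine h2.congr' ?_
  filter_upwards [ha] with t ht
  have hat : 1 / a t ≠ 0 := one_div_ne_zero fun h => by simp [h] at ht
  have e1 : (1 / (a t * ((N : ℝ) ^ 2 : ℝ))) ^ (Fintype.card κ / 2 : ℂ) =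
      (((|(N : ℝ)| ^ Fintype.card κ)⁻¹ : ℝ) : ℂ) * (1 / a t) ^ (Fintype.card κ / 2 : ℂ) := by
    rw [hinv, ofReal_mul_cpow (by positivity) hat]
    congr 1
    have : (Fintype.card κ / 2 : ℂ) = ((Fintype.card κ / 2 : ℝ) : ℂ) := by push_cast; rfl
    rw [this, ← Complex.ofReal_cpow (by positivity)]
    congr 1
    rw [← sq_abs, Real.inv_rpow (by positivity), ← Real.rpow_natCast _ 2, ← Real.rpow_mul
      (abs_nonneg _), ← Real.rpow_natCast _ (Fintype.card κ)]
    congr 2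
    push_cast
    ring
  have e2 : ∀ n : κ → ℤ, cexp (-(Real.pi * (a t * ((N : ℝ) ^ 2 : ℝ))) *
      (B ((N : ℝ)⁻¹ • y + e (intVec n)) ((N : ℝ)⁻¹ • y + e (intVec n)) : ℝ)) =
      cexp (-(Real.pi * a t) *
        (B (y + (N : ℝ) • e (intVec n)) (y + (N : ℝ) • e (intVec n)) : ℝ)) := by
    intro n
    have : y + (N : ℝ) • e (intVec n) = (N : ℝ) • ((N : ℝ)⁻¹ • y + e (intVec n)) := by
      rw [smul_add, smul_inv_smul₀ hN']
    rw [this]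
    simp only [map_smul, LinearMap.smul_apply, smul_eq_mul]
    congr 1
    push_cast
    ring
  simp only [e1, e2]
  have : (((|(N : ℝ)| ^ Fintype.card κ)⁻¹ : ℝ) : ℂ) ≠ 0 := by
    rw [Complex.ofReal_ne_zero]
    positivity
  rw [mul_comm (((|(N : ℝ)| ^ Fintype.card κ)⁻¹ : ℝ) : ℂ) (_ ^ _), div_mul_eq_mul_div,
    mul_div_mul_right _ _ this]

theorem tsum_eq_sum_tsum {K α : Type*} [Fintype K] {F : α → ℂ} (hF : Summable F)
    (φ : K × α ≃ α) : ∑' n, F n = ∑ k, ∑' n, F (φ (k, n)) := by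
  rw [← φ.tsum_eq F, ← tsum_fintype (L := SummationFilter.unconditional K)]
  exact Summable.tsum_prod ((φ.summable_iff (f := F)).2 hF)

/-- A weight `p` that is periodic modulo `N` times the lattice is constant on each class. All
classes have the same leading asymptotics, so the limit is the finite sum of `p` over classes: this
is how a Gauss sum appears. -/
theorem tendsto_theta_classes (hM : M.det ≠ 0)
    (he : ∀ x y, B (e x) (e y) = (M *ᵥ x) ⬝ᵥ (M *ᵥ y)) {α : Type*} {l : Filter α}
    {a : α → ℂ} (ha : ∀ᶠ t in l, 0 < (a t).re) (ha' : Tendsto (fun t => (1 / a t).re) l atTop)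
    {N : ℤ} (hN : N ≠ 0) {K : Type*} [Fintype K] (v : K → V) (φ : K × (κ → ℤ) ≃ (κ → ℤ))
    (x : (κ → ℤ) → V) (hφ : ∀ k n, x (φ (k, n)) = v k + (N : ℝ) • e (intVec n))
    (p : V → ℂ) (hp : ∀ k n, p (v k + (N : ℝ) • e (intVec n)) = p (v k))
    (hsum : ∀ᶠ t in l,
      Summable fun n => p (x n) * cexp (-(Real.pi * a t) * (B (x n) (x n) : ℝ))) :
    Tendsto (fun t => (∑' n : κ → ℤ, p (x n) * cexp (-(Real.pi * a t) * (B (x n) (x n) : ℝ))) /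
          (1 / a t) ^ (Fintype.card κ / 2 : ℂ)) l
      (𝓝 ((∑ k, p (v k)) * ((|M.det|⁻¹ * (|(N : ℝ)| ^ Fintype.card κ)⁻¹ : ℝ) : ℂ))) := by
  rw [Finset.sum_mul]
  refine Tendsto.congr' ?_ (tendsto_finsetSum _ fun k _ =>
    (tendsto_tsum_theta_smul hM he ha ha' (v k) hN).const_mul (p (v k)))
  filter_upwards [hsum] with t ht
  rw [tsum_eq_sum_tsum ht φ, Finset.sum_div]
  refine Finset.sum_congr rfl fun k _ => ?_
  rw [← mul_div_assoc, ← tsum_mul_left]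
  simp only [hφ, hp]

/-- Reciprocity for multidimensional quadratic Gauss sums of an even lattice with dual lattice given
by `dualVec M e`. -/
theorem gauss_reciprocity_aux (hM : M.det ≠ 0)
    (he : ∀ x y, B (e x) (e y) = (M *ᵥ x) ⬝ᵥ (M *ᵥ y))
    (heven : ∀ n : κ → ℤ, ∃ z : ℤ, B (e (intVec n)) (e (intVec n)) = 2 * z)
    {N f : ℤ} (hN : N ≠ 0) (hf : f ≠ 0) {ξ : V}
    (hξ : ∃ m : κ → ℤ, (N : ℝ) • ξ = dualVec M e (intVec m))
    {K K' : Type*} [Fintype K] [Fintype K'] (v : K → V) (φ : K × (κ → ℤ) ≃ (κ → ℤ))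
    (hφ : ∀ k n, dualVec M e (intVec (φ (k, n))) = v k + (N : ℝ) • e (intVec n))
    (s : K' → V) (φ' : K' × (κ → ℤ) ≃ (κ → ℤ))
    (hφ' : ∀ k n, e (intVec (φ' (k, n))) = s k + (f : ℝ) • e (intVec n)) :
    (∑ k, cexp (Real.pi * I * (f / N) * (B (v k) (v k) : ℝ) - 2 * Real.pi * I * (B ξ (v k) : ℝ))) *
        (-I * (f / N)) ^ (Fintype.card κ / 2 : ℂ) =
      (|M.det| : ℝ) *
        ∑ k, cexp (-(Real.pi * I * (N / f)) * (B (s k + ξ) (s k + ξ) : ℝ)) := by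
  have hsymm : ∀ x y, B x y = B y x := by
    intro x y
    obtain ⟨x, rfl⟩ := e.surjective x
    obtain ⟨y, rfl⟩ := e.surjective y
    rw [he, he, dotProduct_comm]
  have hint : ∀ k n : κ → ℤ, ∃ z : ℤ, B (dualVec M e (intVec k)) (e (intVec n)) = z := by
    intro k n
    refine ⟨∑ i, k i * n i, ?_⟩
    rw [form_dualVec hM he]
    simp [dotProduct, intVec]
  have hM' : ((M⁻¹)ᵀ).det ≠ 0 := by
    rw [det_transpose, det_nonsing_inv, Ring.inverse_eq_inv']
    exact inv_ne_zero hM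
  have hNC : (N : ℂ) ≠ 0 := by exact_mod_cast hN
  have hfC : (f : ℂ) ≠ 0 := by exact_mod_cast hf
  have hNR : (N : ℝ) ≠ 0 := by exact_mod_cast hN
  have hfR : (f : ℝ) ≠ 0 := by exact_mod_cast hf
  obtain ⟨q, hq⟩ : ∃ q : ℝ, q = f / N := ⟨_, rfl⟩
  have hq0 : q ≠ 0 := hq ▸ div_ne_zero hfR hNR
  have hqC : (q : ℂ) ≠ 0 := by exact_mod_cast hq0
  set d : ℂ := Fintype.card κ / 2 with hd
  set p : V → ℂ := fun x => cexp (Real.pi * I * q * (B x x : ℝ) - 2 * Real.pi * I * (B ξ x : ℝ))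
    with hp
  set p' : V → ℂ := fun x => cexp (-(Real.pi * I / q) * (B x x : ℝ)) with hp'
  -- A shift by `N y` changes the exponent by `2πi (f ⟨v,y⟩ + f N |y|²/2 - ⟨Nξ,y⟩)`; integrality
  -- uses duality for the outer terms and evenness for the middle one.
  have hpper : ∀ k n, p (v k + (N : ℝ) • e (intVec n)) = p (v k) := by
    intro k n
    obtain ⟨m, hm⟩ := hξ
    obtain ⟨z1, hz1⟩ := hint (φ (k, 0)) n
    obtain ⟨z2, hz2⟩ := hint m n
    obtain ⟨z3, hz3⟩ := heven n
    have h0 : v k = dualVec M e (intVec (φ (k, 0))) := by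
      rw [hφ]
      have : intVec (0 : κ → ℤ) = 0 := by ext; simp [intVec]
      simp [this]
    rw [← hm, map_smul, LinearMap.smul_apply, smul_eq_mul] at hz2
    rw [← h0] at hz1
    simp only [hp, Complex.exp_eq_exp_iff_exists_int]
    refine ⟨f * z1 + f * N * z3 - z2, ?_⟩
    simp only [map_add, map_smul, LinearMap.add_apply, LinearMap.smul_apply, smul_eq_mul,
      hsymm (e (intVec n)) (v k), hz1, hz3]
    rw [← Complex.ofReal_intCast] 
    push_cast [hq]
    have hz2' : (N : ℂ) * (B ξ (e (intVec n)) : ℝ) = z2 := by exact_mod_cast hz2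
    rw [← hz2']
    field_simp
    ring
  have hp'per : ∀ k n, p' ((s k + ξ) + (f : ℝ) • e (intVec n)) = p' (s k + ξ) := by
    intro k n
    obtain ⟨m, hm⟩ := hξ
    obtain ⟨z2, hz2⟩ := hint m n
    obtain ⟨z3, hz3⟩ := heven n
    have hz1 : ∃ z1 : ℤ, B (s k) (e (intVec n)) = z1 := by
      obtain ⟨y1, hy1⟩ := heven (φ' (k, 0) + n)
      obtain ⟨y2, hy2⟩ := heven (φ' (k, 0))
      have h0 : s k = e (intVec (φ' (k, 0))) := by
        rw [hφ']
        have : intVec (0 : κ → ℤ) = 0 := by ext; simp [intVec]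
        simp [this]
      have hadd : intVec (φ' (k, 0) + n) = intVec (φ' (k, 0)) + intVec n := by
        ext; simp [intVec]
      rw [hadd, map_add, ← h0] at hy1
      rw [← h0] at hy2
      simp only [map_add, LinearMap.add_apply, hsymm (e (intVec n)) (s k), hy2, hz3] at hy1
      refine ⟨y1 - y2 - z3, ?_⟩
      push_cast
      linarith
    obtain ⟨z1, hz1⟩ := hz1
    rw [← hm, map_smul, LinearMap.smul_apply, smul_eq_mul] at hz2
    simp only [hp', Complex.exp_eq_exp_iff_exists_int]
    refine ⟨-(N * z1 + z2 + f * N * z3), ?_⟩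
    have hz2' : (N : ℂ) * (B ξ (e (intVec n)) : ℝ) = z2 := by exact_mod_cast hz2
    simp only [map_add, map_smul, LinearMap.add_apply, LinearMap.smul_apply, smul_eq_mul,
      hsymm (e (intVec n)) (s k), hsymm (e (intVec n)) ξ, hsymm ξ (s k), hz1, hz3]
    push_cast [hq]
    rw [← hz2']
    field_simp
    ring
  -- `b ε` approaches the singular point `-iq`. Its inverse splits as `i/q + a' ε`: the constant
  -- part is the phase `p'`, and `a' ε → 0` is the damping on the other side.
  set b : ℝ → ℂ := fun ε => ε - I * q with hb
  set a' : ℝ → ℂ := fun ε => ε / (q * (q + I * ε)) with ha'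
  have hbre : ∀ ε, (b ε).re = ε := by intro ε; simp [hb]
  have hb0 : ∀ ε, b ε ≠ 0 := by
    intro ε h
    have := congrArg Complex.im h
    simp [hb] at this
    exact hq0 this
  have hqe0 : ∀ ε : ℝ, (q : ℂ) + I * ε ≠ 0 := by
    intro ε h
    have := congrArg Complex.re h
    simp at this
    exact hq0 this
  have hinvb : ∀ ε, 1 / b ε = I / q + a' ε := by
    intro ε
    have h1 := hb0 ε
    have h2 := hqe0 ε
    have h3 : (q : ℂ) + I * ε = I * b ε := by
      simp only [hb]
      linear_combination (q : ℂ) * Complex.I_sq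
    simp only [ha', h3]
    field_simp
    simp only [hb]
    linear_combination (q * I - ε : ℂ) * Complex.I_sq
  have hinva' : ∀ ε : ℝ, 1 / a' ε = ((1 / ε : ℝ) : ℂ) * (q * (q + I * ε)) := by
    intro ε
    simp only [ha']
    rw [one_div_div]
    push_cast
    ring
  have hinva're : ∀ ε : ℝ, (1 / a' ε).re = 1 / ε * (q ^ 2) := by
    intro ε
    rw [hinva', Complex.re_ofReal_mul]
    congr 1
    simp [sq]
  have hpos : ∀ᶠ ε : ℝ in 𝓝[>] 0, 0 < ε := eventually_mem_nhdsWithin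
  have hatTop : Tendsto (fun ε : ℝ => 1 / ε) (𝓝[>] 0) atTop := by
    simpa only [one_div] using tendsto_inv_nhdsGT_zero
  have ha're : ∀ ε : ℝ, 0 < ε → 0 < (a' ε).re := by
    intro ε hε
    have h1 : 0 < (1 / a' ε).re := by rw [hinva're]; positivity
    rw [one_div, Complex.inv_re] at h1
    exact (pos_iff_pos_of_mul_pos (by simpa [div_eq_mul_inv] using h1)).2 (inv_pos.2
      (Complex.normSq_pos.2 fun h => by simp [h] at h1))
  set S₁ : ℝ → ℂ := fun ε => ∑' k : κ → ℤ, p (dualVec M e (intVec k)) *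
    cexp (-(Real.pi * (ε : ℂ)) * (B (dualVec M e (intVec k)) (dualVec M e (intVec k)) : ℝ))
  set S₂ : ℝ → ℂ := fun ε => ∑' n : κ → ℤ, p' (e (intVec n) + ξ) *
    cexp (-(Real.pi * a' ε) * (B (e (intVec n) + ξ) (e (intVec n) + ξ) : ℝ))
  have hterm₁ : ∀ (ε : ℝ) (x : V), p x * cexp (-(Real.pi * (ε : ℂ)) * (B x x : ℝ)) =
      cexp (-(Real.pi * b ε) * (B x x : ℝ)) * cexp (2 * Real.pi * I * (B x (-ξ) : ℝ)) := by
    intro ε x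
    simp only [hp, hb, ← Complex.exp_add, map_neg, hsymm ξ x]
    congr 1
    push_cast
    ring
  have hterm₂ : ∀ (ε : ℝ) (x : V), p' x * cexp (-(Real.pi * a' ε) * (B x x : ℝ)) =
      cexp (-(Real.pi * (1 / b ε)) * (B x x : ℝ)) := by
    intro ε x
    simp only [hp', ← Complex.exp_add, hinvb]
    congr 1
    ring
  have hL₁ : Tendsto (fun ε : ℝ => S₁ ε / (1 / (ε : ℂ)) ^ d) (𝓝[>] 0)
      (𝓝 ((∑ k, p (v k)) * ((|M.det|⁻¹ * (|(N : ℝ)| ^ Fintype.card κ)⁻¹ : ℝ) : ℂ))) := by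
    refine tendsto_theta_classes hM he (a := fun ε : ℝ => (ε : ℂ)) (by simpa using hpos) ?_ hN v φ
      (fun k => dualVec M e (intVec k)) hφ p hpper ?_
    · refine hatTop.congr fun ε => ?_
      rw [← Complex.ofReal_one, ← Complex.ofReal_div, Complex.ofReal_re]
    · filter_upwards [hpos] with ε hε
      simp only [hterm₁]
      refine Summable.of_norm ?_
      have h1 := (summable_gaussian hM' (a := b ε) (by rwa [hbre]) 0).norm
      refine h1.congr fun k => ?_
      rw [zero_add, norm_mul]
      have h2 : ‖cexp (2 * Real.pi * I * (B (dualVec M e (intVec k)) (-ξ) : ℝ))‖ = 1 := by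
        rw [norm_exp]
        simp
      rw [h2, mul_one, gaussian_dual_eq hM he]
      rfl
  have hL₂ : Tendsto (fun ε : ℝ => S₂ ε / (1 / a' ε) ^ d) (𝓝[>] 0)
      (𝓝 ((∑ k, p' (s k + ξ)) * ((|M.det|⁻¹ * (|(f : ℝ)| ^ Fintype.card κ)⁻¹ : ℝ) : ℂ))) := by
    refine tendsto_theta_classes hM he (hpos.mono ha're) ?_ hf (fun k => s k + ξ) φ'
      (fun n => e (intVec n) + ξ) (fun k n => by rw [hφ', add_right_comm]) p' hp'per ?_
    · simp only [hinva're]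
      exact hatTop.atTop_mul_const (by positivity)
    · filter_upwards [hpos] with ε hε
      simp only [hterm₂]
      obtain ⟨x, rfl⟩ := e.surjective ξ
      refine (summable_gaussian hM (a := 1 / b ε) ?_ x).congr fun n => ?_
      · rw [one_div, Complex.inv_re, hbre]
        have := Complex.normSq_pos.2 (hb0 ε)
        positivity
      · rw [gaussian_eq he, map_add, add_comm]
        rfl
  -- For each `ε > 0` the inversion law is an exact identity between the two damped sums. Negating
  -- the summation index matches the shift `-ξ` with `ξ`.
  have hS : ∀ ε : ℝ, 0 < ε → S₂ ε = ((|M.det|⁻¹ : ℝ) : ℂ) * b ε ^ d * S₁ ε := by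
    intro ε hε
    have h1 := tsum_theta_eq hM he (a := 1 / b ε) (by
      rw [one_div, Complex.inv_re, hbre]
      have := Complex.normSq_pos.2 (hb0 ε)
      positivity) (-ξ)
    simp only [S₁, S₂, hterm₁, hterm₂]
    rw [one_div_one_div] at h1
    rw [← h1, ← (Equiv.neg (κ → ℤ)).tsum_eq]
    refine tsum_congr fun n => ?_
    have h2 : e (intVec ((Equiv.neg (κ → ℤ)) n)) + ξ = -(-ξ + e (intVec n)) := by
      have : intVec ((Equiv.neg (κ → ℤ)) n) = -intVec n := by ext; simp [intVec]
      rw [this, map_neg]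
      abel
    rw [h2]
    simp only [map_neg, LinearMap.neg_apply, neg_neg]
  have hL₃ : Tendsto (fun ε : ℝ => S₂ ε / (1 / a' ε) ^ d) (𝓝[>] 0)
      (𝓝 (((|M.det|⁻¹ : ℝ) : ℂ) * (-I * q) ^ d / ((q ^ 2 : ℝ) : ℂ) ^ d *
        ((∑ k, p (v k)) * ((|M.det|⁻¹ * (|(N : ℝ)| ^ Fintype.card κ)⁻¹ : ℝ) : ℂ)))) := by
    have hε0 : Tendsto (fun ε : ℝ => (ε : ℂ)) (𝓝[>] 0) (𝓝 0) :=
      (Complex.continuous_ofReal.tendsto' 0 0 (by simp)).mono_left nhdsWithin_le_nhds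
    have hbl : Tendsto (fun ε => b ε ^ d) (𝓝[>] 0) (𝓝 ((-I * q) ^ d)) := by
      -- The limit `-iq` has nonzero imaginary part and so avoids the branch cut; below, `q²` avoids
      -- it by being positive.
      refine (continuousAt_cpow_const ?_).tendsto.comp ?_
      · right
        simpa using hq0
      · have := hε0.sub_const (I * q)
        simpa [hb, neg_mul] using this
    have hql : Tendsto (fun ε : ℝ => ((q : ℂ) * (q + I * ε)) ^ d) (𝓝[>] 0)
        (𝓝 (((q ^ 2 : ℝ) : ℂ) ^ d)) := by
      refine (continuousAt_cpow_const ?_).tendsto.comp ?_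
      · left
        rw [Complex.ofReal_re]
        positivity
      · have := ((hε0.const_mul I).const_add (q : ℂ)).const_mul (q : ℂ)
        simpa [sq] using this
    have hq2 : ((q ^ 2 : ℝ) : ℂ) ^ d ≠ 0 := by
      rw [cpow_def_of_ne_zero (by rw [Complex.ofReal_ne_zero]; positivity)]
      exact Complex.exp_ne_zero _
    refine (((hbl.const_mul _).div hql hq2).mul hL₁).congr' ?_
    filter_upwards [hpos] with ε hε
    rw [hS ε hε, hinva', ofReal_mul_cpow (by positivity) (mul_ne_zero hqC (hqe0 ε)),
      Complex.ofReal_div, Complex.ofReal_one, Pi.div_apply, div_mul_div_comm]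
    congr 1
    ring
  -- One quotient has been evaluated directly and through the inversion law; equating the limits is
  -- the reciprocity, up to elementary factors.
  have hfin := tendsto_nhds_unique hL₂ hL₃
  have hqd : ((q ^ 2 : ℝ) : ℂ) ^ d = ((|q| ^ Fintype.card κ : ℝ) : ℂ) := by
    have : d = ((Fintype.card κ / 2 : ℝ) : ℂ) := by rw [hd]; push_cast; rfl
    rw [this, ← Complex.ofReal_cpow (by positivity), ← sq_abs, ← Real.rpow_natCast _ 2,
      ← Real.rpow_mul (abs_nonneg _), ← Real.rpow_natCast]
    congr 2
    push_cast
    ring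
  rw [hqd, show |q| = |(f : ℝ)| / |(N : ℝ)| by rw [hq, abs_div], div_pow] at hfin
  have hN1 : ((|(N : ℝ)| ^ Fintype.card κ : ℝ) : ℂ) ≠ 0 := by
    rw [Complex.ofReal_ne_zero]; positivity
  have hf1 : ((|(f : ℝ)| ^ Fintype.card κ : ℝ) : ℂ) ≠ 0 := by
    rw [Complex.ofReal_ne_zero]; positivity
  have hM1 : ((|M.det| : ℝ) : ℂ) ≠ 0 := by
    rw [Complex.ofReal_ne_zero]; positivity
  have hqdef : (q : ℂ) = f / N := by push_cast [hq]; rfl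
  have e1 : ∑ k, cexp (Real.pi * I * (f / N) * (B (v k) (v k) : ℝ) -
      2 * Real.pi * I * (B ξ (v k) : ℝ)) = ∑ k, p (v k) := by
    simp only [hp, hqdef]
  have e2 : ∑ k, cexp (-(Real.pi * I * (N / f)) * (B (s k + ξ) (s k + ξ) : ℝ)) =
      ∑ k, p' (s k + ξ) := by
    simp only [hp', hqdef, div_div_eq_mul_div, mul_div_assoc]
  rw [e1, e2]
  rw [← hqdef]
  simp only [Complex.ofReal_mul, Complex.ofReal_inv, Complex.ofReal_div] at hfin
  set F1 := ((|(f : ℝ)| ^ Fintype.card κ : ℝ) : ℂ)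
  set N1 := ((|(N : ℝ)| ^ Fintype.card κ : ℝ) : ℂ)
  have hfin2 : (∑ k, p' (s k + ξ)) = ((|M.det| : ℝ) : ℂ)⁻¹ * (-I * q) ^ d * ∑ k, p (v k) := by
    field_simp at hfin
    field_simp
    linear_combination hfin
  rw [hfin2]
  field_simp

end Reciprocity

end SimplyLaced

end

/-! ### The Cartan form: invariance and positive definiteness -/

noncomputable section

namespace SimplyLaced

-- Supplies a factorization of the Gram matrix as `Xᵀ X`, the shape in which the theta function
-- results are available.
open scoped MatrixOrder in
theorem exists_transpose_eq_mul_self {κ : Type*} [Fintype κ] [DecidableEq κ] {G : Matrix κ κ ℝ}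
    (hG : G.PosSemidef) : ∃ X : Matrix κ κ ℝ, X.transpose = X ∧ X * X = G := by
  obtain ⟨X, hX, -, hX2⟩ := CFC.exists_sqrt_of_isSelfAdjoint_of_quasispectrumRestricts
    hG.isHermitian (QuasispectrumRestricts.nnreal_of_nonneg hG.nonneg)
  refine ⟨X, ?_, hX2⟩
  have := hX.star_eq
  rwa [Matrix.star_eq_conjTranspose, Matrix.conjTranspose_eq_transpose_of_trivial] at this

section RootGeometry

open RootPairing

variable {ι V N : Type*} [AddCommGroup V] [Module ℝ V] [AddCommGroup N] [Module ℝ N]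
  {P : RootPairing ι ℝ V N} [P.IsRootSystem] [P.IsCrystallographic] {b : P.Base}

theorem form_simple_simple (i j : b.support) :
    form b (P.root i) (P.root j) = P.pairing i j := by
  classical
  have h := Matrix.toBilin_apply b.toWeightBasis (b.cartanMatrix.map (fun z : ℤ => (z : ℝ)))
    (P.root i) (P.root j)
  have h2 : form b (P.root i) (P.root j) = (b.cartanMatrix.map (fun z : ℤ => (z : ℝ))) i j := by
    unfold form
    rw [← b.toWeightBasis_apply, ← b.toWeightBasis_apply]
    convert! congrFun (congrFun (LinearMap.BilinForm.toMatrix_toBilin b.toWeightBasis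
      (b.cartanMatrix.map (fun z : ℤ => (z : ℝ)))) i) j
    rw [LinearMap.BilinForm.toMatrix_apply]
  rw [h2, Matrix.map_apply]
  exact b.algebraMap_cartanMatrixIn_apply ℤ i j

omit [P.IsRootSystem] in
theorem pairing_symm (hb : b.cartanMatrix.IsSimplyLaced) (i j : b.support) :
    P.pairing i j = P.pairing j i := by
  rw [← b.algebraMap_cartanMatrixIn_apply ℤ i j, ← b.algebraMap_cartanMatrixIn_apply ℤ j i]
  congr 1
  rcases eq_or_ne i j with rfl | hij
  · rfl
  · have h1 := b.cartanMatrix_apply_eq_zero_iff_symm (i := i) (j := j)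
    have h2 := hb hij
    have h3 := hb hij.symm
    change b.cartanMatrix i j = b.cartanMatrix j i
    rcases h2 with h2 | h2 <;> rcases h3 with h3 | h3 <;> simp_all

theorem form_symm (hb : b.cartanMatrix.IsSimplyLaced) (x y : V) : form b x y = form b y x := by
  suffices h : form b = LinearMap.flip (form b) from LinearMap.congr_fun₂ h x y
  refine LinearMap.BilinForm.ext_basis b.toWeightBasis fun i j => ?_
  rw [LinearMap.flip_apply, b.toWeightBasis_apply, b.toWeightBasis_apply, form_simple_simple,
    form_simple_simple, pairing_symm hb]

theorem form_simple (x : V) (i : b.support) : form b x (P.root i) = P.coroot' i x := by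
  suffices h : LinearMap.flip (form b) (P.root i) = P.coroot' i from LinearMap.congr_fun h x
  refine b.toWeightBasis.ext fun j => ?_
  rw [LinearMap.flip_apply, b.toWeightBasis_apply, form_simple_simple]
  rfl

theorem form_reflection_simple (hb : b.cartanMatrix.IsSimplyLaced) (i : b.support) (x y : V) :
    form b (P.reflection i x) (P.reflection i y) = form b x y := by
  simp only [reflection_apply, map_sub, map_smul, LinearMap.sub_apply, LinearMap.smul_apply,
    smul_eq_mul, form_simple, form_symm hb (P.root i)]
  simp
  ring

variable [Finite ι] [P.IsReduced]

/-- The form identifies roots with coroots. For simple roots this is the definition of the form;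
simple reflections preserve the form and reach every root. -/
theorem form_root (hb : b.cartanMatrix.IsSimplyLaced) (i : ι) (x : V) :
    form b x (P.root i) = P.coroot' i x := by
  revert x
  induction i using b.induction_reflect with
  | h₀ i hi =>
    intro x
    rw [root_reflectionPerm, reflection_apply_self, map_neg, hi, coroot'_reflectionPerm,
      LinearMap.comp_apply]
    simp [reflection_apply]
    ring
  | h₁ i hi => exact fun x => form_simple x ⟨i, hi⟩
  | h₂ i j hi hj =>
    intro x
    rw [root_reflectionPerm, coroot'_reflectionPerm, LinearMap.comp_apply, LinearEquiv.coe_coe,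
      ← hi, ← form_reflection_simple hb ⟨j, hj⟩, reflection_same]

theorem form_root_self (hb : b.cartanMatrix.IsSimplyLaced) (i : ι) :
    form b (P.root i) (P.root i) = 2 := by
  rw [form_root hb]
  simp

theorem form_root_root (hb : b.cartanMatrix.IsSimplyLaced) (i j : ι) :
    form b (P.root i) (P.root j) = P.pairingIn ℤ i j := by
  rw [form_root hb]
  exact (P.algebraMap_pairingIn ℤ i j).symm

theorem reflection_eq (hb : b.cartanMatrix.IsSimplyLaced) (i : ι) (x : V) :
    P.reflection i x = x - form b x (P.root i) • P.root i := by
  rw [form_root hb, reflection_apply]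

theorem ofIdx_smul_eq (hb : b.cartanMatrix.IsSimplyLaced) (i : ι) (x : V) :
    weylGroup.ofIdx P i • x = x - form b x (P.root i) • P.root i := by
  rw [← reflection_eq hb]
  rfl

theorem form_smul_smul (hb : b.cartanMatrix.IsSimplyLaced) (w : P.weylGroup) (x y : V) :
    form b (w • x) (w • y) = form b x y := by
  obtain ⟨w, hw⟩ := w
  revert x y
  induction hw using weylGroup.induction with
  | mem i =>
    intro x y
    change form b (P.reflection i x) (P.reflection i y) = _
    simp only [reflection_eq hb, map_sub, map_smul, LinearMap.sub_apply, LinearMap.smul_apply,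
      smul_eq_mul, form_symm hb (P.root i), form_root_self hb]
    ring
  | one => exact fun x y => rfl
  | mul u v hu hv h1 h2 => exact fun x y => (h1 _ _).trans (h2 _ _)

theorem form_smul_left (hb : b.cartanMatrix.IsSimplyLaced) (w : P.weylGroup) (x y : V) :
    form b (w • x) y = form b x (w⁻¹ • y) := by
  rw [← form_smul_smul hb w x, smul_inv_smul]

-- Comparison with the positive definite `RootForm`. Non-orthogonal simple roots have equal
-- `RootForm` length because the pairing is symmetric, so the Cartan matrix is twice the Gram matrix
-- of the simple roots normalized to unit length. No connectedness is needed, since lengths may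
-- differ between orthogonal roots.
omit [P.IsReduced] in
theorem form_pos (hb : b.cartanMatrix.IsSimplyLaced) {x : V} (hx : x ≠ 0) : 0 < form b x x := by
  classical
  have := Fintype.ofFinite ι
  set R := P.RootForm
  have hRpos : ∀ {z : V}, z ≠ 0 → 0 < R z z := fun hz =>
    P.rootForm_pos_of_ne_zero (by simp) hz
  set d : b.support → ℝ := fun i => R (P.root i) (P.root i)
  have hd : ∀ i, 0 < d i := fun i => hRpos (P.ne_zero i)
  have hR : ∀ i j : b.support, 2 * R (P.root i) (P.root j) = P.pairing i j * d j := by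
    intro i j
    have h := P.rootForm_reflection_reflection_apply j (P.root i) (P.root j)
    rw [reflection_apply_self, reflection_apply_root] at h
    simp only [map_neg, map_sub, map_smul, LinearMap.sub_apply, LinearMap.smul_apply,
      smul_eq_mul] at h
    linarith
  have hkey : ∀ i j : b.support, form b (P.root i) (P.root j) =
      2 * R ((√(d i))⁻¹ • P.root i) ((√(d j))⁻¹ • P.root j) := by
    intro i j
    simp only [map_smul, LinearMap.smul_apply, smul_eq_mul]
    rw [form_simple_simple]
    have h1 := hR i j
    have h2 := hR j i
    have hsym : R (P.root j) (P.root i) = R (P.root i) (P.root j) := by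
      have := P.rootForm_symmetric.eq (P.root i) (P.root j)
      simpa using this.symm
    rw [hsym, pairing_symm hb j i] at h2
    rcases eq_or_ne (P.pairing i j) 0 with h0 | h0
    · rw [h0, zero_mul] at h1
      have : R (P.root i) (P.root j) = 0 := by linarith
      rw [h0, this]
      simp
    · have h3 : d i = d j := mul_left_cancel₀ h0 (h2.symm.trans h1)
      have h4 : √(d j) * √(d j) = d j := Real.mul_self_sqrt (hd j).le
      have h5 : √(d j) ≠ 0 := (Real.sqrt_pos.2 (hd j)).ne'
      rw [h3]
      field_simp
      rw [sq, h4]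
      linarith
  set c := b.toWeightBasis.repr x
  have hx' : x = ∑ i, c i • P.root i := by
    conv_lhs => rw [← b.toWeightBasis.sum_repr x]
    simp [c]
  set y : V := ∑ i : b.support, c i • (√(d i))⁻¹ • P.root i
  have hy : y ≠ 0 := by
    intro hy0
    apply hx
    have h1 : ∀ i, c i * (√(d i))⁻¹ = 0 := by
      have h2 : y = ∑ i, (c i * (√(d i))⁻¹) • b.toWeightBasis i := by
        simp [y, smul_smul]
      rw [h2] at hy0
      exact Fintype.linearIndependent_iff.1 b.toWeightBasis.linearIndependent _ hy0
    have h3 : ∀ i, c i = 0 := by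
      intro i
      have h5 : √(d i) ≠ 0 := (Real.sqrt_pos.2 (hd i)).ne'
      simpa [h5] using h1 i
    rw [hx']
    simp [h3]
  have h6 : form b x x = 2 * R y y := by
    rw [hx']
    simp only [y, map_sum, LinearMap.sum_apply, Finset.mul_sum]
    refine Finset.sum_congr rfl fun i _ => Finset.sum_congr rfl fun j _ => ?_
    have h := hkey j i
    simp only [map_smul, LinearMap.smul_apply, smul_eq_mul] at h ⊢
    rw [h]
    ring
  rw [h6]
  have := hRpos hy
  positivity

omit [P.IsReduced] in
/-- The form is a sum of squares of linear coordinates. -/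
theorem exists_form_eq_dotProduct (hb : b.cartanMatrix.IsSimplyLaced) :
    ∃ M : Matrix b.support b.support ℝ, ∃ (_ : DecidableEq b.support), M.det ≠ 0 ∧ ∀ x y,
      form b (b.toWeightBasis.equivFun.symm x) (b.toWeightBasis.equivFun.symm y) =
        dotProduct (M.mulVec x) (M.mulVec y) := by
  classical
  set e := b.toWeightBasis.equivFun.symm
  set G : Matrix b.support b.support ℝ := Matrix.of fun i j => form b (P.root i) (P.root j)
  have hG : ∀ x y, form b (e x) (e y) = dotProduct x (G.mulVec y) := by
    intro x y
    simp only [e, Module.Basis.equivFun_symm_apply, map_sum, LinearMap.sum_apply, map_smul,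
      LinearMap.smul_apply, smul_eq_mul, dotProduct, Matrix.mulVec, Finset.mul_sum,
      Base.toWeightBasis_apply, G, Matrix.of_apply]
    rw [Finset.sum_comm]
    refine Finset.sum_congr rfl fun i _ => Finset.sum_congr rfl fun j _ => ?_
    ring
  have hpd : G.PosDef := by
    refine Matrix.posDef_iff_dotProduct_mulVec.2 ⟨?_, fun x hx => ?_⟩
    · ext i j
      simp [G, form_symm hb (P.root i)]
    · rw [star_trivial, ← hG]
      exact form_pos hb (by simpa using hx)
  obtain ⟨X, hXs, hX2⟩ := exists_transpose_eq_mul_self hpd.posSemidef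
  refine ⟨X, inferInstance, fun h0 => ?_, fun x y => ?_⟩
  · have := hpd.det_pos
    rw [← hX2, Matrix.det_mul, h0] at this
    simp at this
  · rw [hG, ← hX2, ← Matrix.mulVec_mulVec, Matrix.dotProduct_mulVec, ← Matrix.mulVec_transpose, hXs]

end RootGeometry

end SimplyLaced

end

/-! ### The Weyl group: determinants, words in simple reflections, exchange -/

noncomputable section

namespace SimplyLaced

section WeylGroup

open RootPairing

variable {ι V N : Type*} [AddCommGroup V] [Module ℝ V] [AddCommGroup N] [Module ℝ N]
  {P : RootPairing ι ℝ V N} [P.IsRootSystem] [P.IsCrystallographic] {b : P.Base}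

omit [P.IsRootSystem] [P.IsCrystallographic] in
theorem weylGroup_ext {u v : P.weylGroup} (h : ∀ x : V, u • x = v • x) : u = v := by
  apply Subtype.ext
  apply Equiv.weightHom_injective P
  ext x
  exact h x

omit [P.IsCrystallographic] in
theorem weylGroup_ext_root {u v : P.weylGroup} (h : ∀ i, u • P.root i = v • P.root i) : u = v := by
  refine weylGroup_ext fun x => ?_
  have hx : x ∈ Submodule.span ℝ (Set.range P.root) := by
    have := IsRootSystem.span_root_eq_top (P := P)
    rw [this]; trivial
  induction hx using Submodule.span_induction with
  | mem x hx => obtain ⟨i, rfl⟩ := hx; exact h i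
  | zero => simp
  | add x y _ _ hx hy => rw [smul_add, smul_add, hx, hy]
  | smul a x _ hx => rw [smul_comm, smul_comm v, hx]

/-- The roots span, so an element is determined by its permutation of the finitely many roots. -/
instance [Finite ι] : Finite P.weylGroup := by
  refine Finite.of_injective (fun w : P.weylGroup => (P.weylGroupToPerm w : ι → ι)) ?_
  intro u v huv
  refine weylGroup_ext_root fun i => ?_
  rw [weylGroup_apply_root, weylGroup_apply_root]
  exact congrArg _ (congrFun huv i)

omit [P.IsRootSystem] [P.IsCrystallographic] in
theorem weylDet_mul (u v : P.weylGroup) : weylDet (u * v) = weylDet u * weylDet v := by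
  rw [weylDet, map_mul, Module.End.mul_eq_comp, LinearMap.det_comp]
  rfl

omit [P.IsRootSystem] [P.IsCrystallographic] in
theorem weylDet_one : weylDet (1 : P.weylGroup) = 1 := by
  rw [weylDet, map_one]
  exact LinearMap.det_id

omit [P.IsRootSystem] [P.IsCrystallographic] in
theorem weylDet_ofIdx [FiniteDimensional ℝ V] (i : ι) : weylDet (weylGroup.ofIdx P i) = -1 := by
  have h : P.weylGroupRootRep (weylGroup.ofIdx P i) =
      LinearMap.transvection (-P.coroot' i) (P.root i) := by
    ext x
    change P.reflection i x = _
    simp [reflection_apply, LinearMap.transvection, sub_eq_add_neg]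
  rw [weylDet, h, LinearMap.transvection.det]
  simp
  norm_num

omit [P.IsRootSystem] [P.IsCrystallographic] in
theorem weylDet_mul_self [FiniteDimensional ℝ V] (w : P.weylGroup) : weylDet w * weylDet w = 1 := by
  obtain ⟨w, hw⟩ := w
  induction hw using weylGroup.induction with
  | mem i =>
    have := weylDet_ofIdx (P := P) i
    rw [weylGroup.ofIdx] at this
    rw [this]
    norm_num
  | one =>
    have := weylDet_one (P := P)
    change weylDet (1 : P.weylGroup) * weylDet (1 : P.weylGroup) = 1
    rw [this, one_mul]
  | mul u v hu hv h1 h2 =>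
    have := weylDet_mul (P := P) ⟨u, hu⟩ ⟨v, hv⟩
    change weylDet (⟨u, hu⟩ * ⟨v, hv⟩ : P.weylGroup) * weylDet (⟨u, hu⟩ * ⟨v, hv⟩ : P.weylGroup) = 1
    rw [this]
    linear_combination (weylDet (⟨v, hv⟩ : P.weylGroup) * weylDet (⟨v, hv⟩ : P.weylGroup)) * h1 + h2

variable [Finite ι] [P.IsReduced]

theorem mul_ofIdx (hb : b.cartanMatrix.IsSimplyLaced) (w : P.weylGroup) (i : ι) :
    w * weylGroup.ofIdx P i = weylGroup.ofIdx P (P.weylGroupToPerm w i) * w := by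
  refine weylGroup_ext fun x => ?_
  rw [mul_smul, mul_smul, ofIdx_smul_eq hb, ofIdx_smul_eq hb, ← weylGroup_apply_root,
    form_smul_smul hb, smul_sub, smul_comm w]

omit [P.IsRootSystem] [P.IsCrystallographic] [Finite ι] [P.IsReduced] in
theorem ofIdx_mul_self (i : ι) :
    weylGroup.ofIdx P i * weylGroup.ofIdx P i = 1 := by
  refine weylGroup_ext fun x => ?_
  rw [mul_smul, one_smul]
  exact P.reflection_same i x

theorem ofIdx_mem_closure (hb : b.cartanMatrix.IsSimplyLaced) (i : ι) :
    weylGroup.ofIdx P i ∈ Subgroup.closure (weylGroup.ofIdx P '' b.support) := by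
  induction i using b.induction_reflect with
  | h₀ i hi =>
    have : weylGroup.ofIdx P (P.reflectionPerm i i) = weylGroup.ofIdx P i := by
      refine weylGroup_ext fun x => ?_
      rw [ofIdx_smul_eq hb, ofIdx_smul_eq hb, root_reflectionPerm, reflection_apply_self]
      simp
    rwa [this]
  | h₁ i hi => exact Subgroup.subset_closure ⟨i, hi, rfl⟩
  | h₂ i j hi hj =>
    have hj' : weylGroup.ofIdx P j ∈ Subgroup.closure (weylGroup.ofIdx P '' b.support) :=
      Subgroup.subset_closure ⟨j, hj, rfl⟩
    have : weylGroup.ofIdx P (P.reflectionPerm j i) =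
        weylGroup.ofIdx P j * weylGroup.ofIdx P i * (weylGroup.ofIdx P j)⁻¹ := by
      rw [mul_ofIdx hb, mul_inv_cancel_right]
      rfl
    rw [this]
    exact mul_mem (mul_mem hj' hi) (inv_mem hj')

/-- The product of the simple reflections in a list. -/
def wordProd (b : P.Base) (l : List b.support) : P.weylGroup :=
  (l.map fun i => weylGroup.ofIdx P (i : ι)).prod

theorem exists_word (hb : b.cartanMatrix.IsSimplyLaced) (w : P.weylGroup) :
    ∃ l : List b.support, w = wordProd b l := by
  have hw : w ∈ Subgroup.closure (weylGroup.ofIdx P '' b.support) := by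
    obtain ⟨w, hw⟩ := w
    induction hw using weylGroup.induction with
    | mem i => exact ofIdx_mem_closure hb i
    | one => exact one_mem _
    | mul u v hu hv h1 h2 => exact mul_mem h1 h2
  induction hw using Subgroup.closure_induction'' with
  | one => exact ⟨[], rfl⟩
  | mem x hx => obtain ⟨i, hi, rfl⟩ := hx; exact ⟨[⟨i, hi⟩], by simp [wordProd]⟩
  | inv_mem x hx =>
    obtain ⟨i, hi, rfl⟩ := hx
    exact ⟨[⟨i, hi⟩], by simp [wordProd, inv_eq_of_mul_eq_one_left (ofIdx_mul_self i)]⟩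
  | mul x y _ _ hx hy =>
    obtain ⟨l1, rfl⟩ := hx
    obtain ⟨l2, rfl⟩ := hy
    exact ⟨l1 ++ l2, by simp [wordProd]⟩

/-- Exchange condition. Apply the letters to `α_k` from the right; where positivity is first lost,
at a letter `j`, the root just before must be `α_j`, because `s_j` permutes the other positive
roots. So the suffix `u` maps `α_k` to `α_j`, whence `s_j u = u s_k`. -/
theorem exists_split_word (hb : b.cartanMatrix.IsSimplyLaced) (k : b.support) (l : List b.support)
    (hl : ¬ b.IsPos (P.weylGroupToPerm (wordProd b l) k)) :
    ∃ (l₁ : List b.support) (j : b.support) (l₂ : List b.support), l = l₁ ++ j :: l₂ ∧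
      weylGroup.ofIdx P (j : ι) * wordProd b l₂ = wordProd b l₂ * weylGroup.ofIdx P (k : ι) := by
  induction l with
  | nil => exact absurd (Base.isPos_of_mem_support k.2) hl
  | cons j l ih =>
    by_cases h : b.IsPos (P.weylGroupToPerm (wordProd b l) k)
    · refine ⟨[], j, l, rfl, ?_⟩
      have h1 : P.weylGroupToPerm (wordProd b (j :: l)) k =
          P.reflectionPerm j (P.weylGroupToPerm (wordProd b l) k) := rfl
      rw [h1] at hl
      have h2 : P.weylGroupToPerm (wordProd b l) k = j := by
        by_contra h2
        exact hl (h.reflectionPerm j.2 h2)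
      rw [mul_ofIdx hb, h2]
    · obtain ⟨l₁, i, l₂, rfl, h2⟩ := ih h
      exact ⟨j :: l₁, i, l₂, rfl, h2⟩

/-- If `w = w' s_k` preserves positivity, then `w' α_k = -w α_k` is negative. The exchange condition
for `w'` cancels the last letter against an earlier one, leaving a word shorter by two letters. -/
theorem wordProd_eq_one (hb : b.cartanMatrix.IsSimplyLaced) (l : List b.support)
    (hl : ∀ i, b.IsPos i → b.IsPos (P.weylGroupToPerm (wordProd b l) i)) : wordProd b l = 1 := by
  induction hn : l.length using Nat.strong_induction_on generalizing l with
  | _ n ih =>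
    rcases List.eq_nil_or_concat l with rfl | ⟨l', k, rfl⟩
    · rfl
    · have hw : wordProd b (l'.concat k) = wordProd b l' * weylGroup.ofIdx P (k : ι) := by
        simp [wordProd]
      have hneg : ¬ b.IsPos (P.weylGroupToPerm (wordProd b l') k) := by
        have h1 := hl k (Base.isPos_of_mem_support k.2)
        rw [hw, map_mul] at h1
        intro h2
        let _ := P.indexNeg
        refine (Base.IsPos.neg_iff_not b _).1 ?_ h2
        convert h1 using 1
        apply P.root.injective
        change P.root (P.reflectionPerm (P.weylGroupToPerm (wordProd b l') k)
          (P.weylGroupToPerm (wordProd b l') k)) = _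
        rw [root_reflectionPerm, reflection_apply_self, Equiv.Perm.mul_apply,
          ← weylGroup_apply_root, ← weylGroup_apply_root]
        change _ = wordProd b l' • P.root (P.reflectionPerm k k)
        rw [root_reflectionPerm, reflection_apply_self, smul_neg]
      obtain ⟨l₁, j, l₂, rfl, h⟩ := exists_split_word hb k l' hneg
      have h3 : wordProd b ((l₁ ++ j :: l₂).concat k) = wordProd b (l₁ ++ l₂) := by
        rw [hw]
        have : wordProd b (l₁ ++ j :: l₂) =
            wordProd b l₁ * (weylGroup.ofIdx P (j : ι) * wordProd b l₂) := by simp [wordProd]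
        rw [this, h, mul_assoc, mul_assoc, ofIdx_mul_self, mul_one]
        simp [wordProd]
      rw [h3] at hl ⊢
      refine ih _ ?_ _ hl rfl
      rw [← hn]
      simp

/-- A Weyl group element preserving the positive roots is trivial. -/
theorem eq_one_of_isPos (hb : b.cartanMatrix.IsSimplyLaced) (w : P.weylGroup)
    (hw : ∀ i, b.IsPos i → b.IsPos (P.weylGroupToPerm w i)) : w = 1 := by
  obtain ⟨l, rfl⟩ := exists_word hb w
  exact wordProd_eq_one hb l hw

end WeylGroup

end SimplyLaced

end

/-! ### Root and weight lattices, and representatives modulo sublattices -/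

noncomputable section

namespace SimplyLaced

section Lattices

open RootPairing

variable {ι V N : Type*} [AddCommGroup V] [Module ℝ V] [AddCommGroup N] [Module ℝ N]
  {P : RootPairing ι ℝ V N} [P.IsRootSystem] [P.IsCrystallographic] {b : P.Base} [Finite ι]

theorem eq_zero_of_form_simple (hb : b.cartanMatrix.IsSimplyLaced) {x : V}
    (hx : ∀ j : b.support, form b x (P.root j) = 0) : x = 0 := by
  by_contra h
  have h1 := form_pos hb h
  have h2 : ∀ y, form b x y = 0 := by
    intro y
    have : form b x = 0 := b.toWeightBasis.ext fun j => by simp [hx j]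
    rw [this]; rfl
  rw [h2] at h1
  exact lt_irrefl _ h1

theorem eq_of_form_simple (hb : b.cartanMatrix.IsSimplyLaced) {x y : V}
    (hx : ∀ j : b.support, form b x (P.root j) = form b y (P.root j)) : x = y := by
  rw [← sub_eq_zero]
  refine eq_zero_of_form_simple hb fun j => ?_
  rw [map_sub, LinearMap.sub_apply, hx, sub_self]

theorem root_mem_rootLattice (i : ι) : P.root i ∈ rootLattice b := b.root_mem_span_int i

theorem mem_rootLattice_iff {x : V} :
    x ∈ rootLattice b ↔ ∃ n : b.support → ℤ, x = b.toWeightBasis.equivFun.symm (intVec n) := by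
  have he : ∀ n : b.support → ℤ, b.toWeightBasis.equivFun.symm (intVec n) =
      ∑ j, n j • P.root j := by
    intro n
    simp [Module.Basis.equivFun_symm_apply, intVec, Int.cast_smul_eq_zsmul]
  constructor
  · intro hx
    induction hx using Submodule.span_induction with
    | mem x hx =>
      classical
      obtain ⟨i, hi, rfl⟩ := hx
      refine ⟨Pi.single ⟨i, hi⟩ 1, ?_⟩
      rw [he, Finset.sum_eq_single ⟨i, hi⟩] <;> simp +contextual
    | zero => exact ⟨0, by rw [he]; simp⟩
    | add x y _ _ hx hy =>
      obtain ⟨n, rfl⟩ := hx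
      obtain ⟨m, rfl⟩ := hy
      exact ⟨n + m, by rw [he, he, he]; simp [add_smul, Finset.sum_add_distrib]⟩
    | smul a x _ hx =>
      obtain ⟨n, rfl⟩ := hx
      exact ⟨a • n, by rw [he, he]; simp [mul_smul, Finset.smul_sum]⟩
  · rintro ⟨n, rfl⟩
    rw [he]
    exact Submodule.sum_mem _ fun j _ => Submodule.smul_mem _ _ (root_mem_rootLattice _)

theorem root_eq_equivFun_symm [DecidableEq b.support] (j : b.support) :
    P.root j = b.toWeightBasis.equivFun.symm (Pi.single j 1) := by
  rw [Module.Basis.equivFun_symm_apply, Finset.sum_eq_single j] <;>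
    simp +contextual

theorem exists_isFundamentalWeight (hb : b.cartanMatrix.IsSimplyLaced) (i : b.support) :
    ∃ x, IsFundamentalWeight b i x := by
  obtain ⟨M, hdec, hM, he⟩ := exists_form_eq_dotProduct hb
  classical
  refine ⟨dualVec M b.toWeightBasis.equivFun.symm (Pi.single i 1), fun j => ?_⟩
  rw [root_eq_equivFun_symm, form_dualVec hM he]
  simp [Pi.single_apply, eq_comm]

theorem mem_weightLattice_iff (hb : b.cartanMatrix.IsSimplyLaced) {x : V} :
    x ∈ weightLattice b ↔ ∀ j : b.support, ∃ z : ℤ, form b x (P.root j) = z := by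
  constructor
  · intro hx j
    induction hx using Submodule.span_induction with
    | mem x hx =>
      obtain ⟨i, hi⟩ := hx
      rw [hi j]
      split_ifs
      · exact ⟨1, by simp⟩
      · exact ⟨0, by simp⟩
    | zero => exact ⟨0, by simp⟩
    | add x y _ _ hx hy =>
      obtain ⟨n, hn⟩ := hx
      obtain ⟨m, hm⟩ := hy
      exact ⟨n + m, by simp [hn, hm]⟩
    | smul a x _ hx =>
      obtain ⟨n, hn⟩ := hx
      exact ⟨a * n, by rw [← Int.cast_smul_eq_zsmul ℝ]; simp [hn]⟩
  · intro h
    choose z hz using h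
    choose f hf using exists_isFundamentalWeight hb
    have hx : x = ∑ i, z i • f i := by
      refine eq_of_form_simple hb fun j => ?_
      simp only [← Int.cast_smul_eq_zsmul ℝ, map_sum, LinearMap.sum_apply, map_smul,
        LinearMap.smul_apply, hf _ j, hz]
      simp
    rw [hx]
    exact Submodule.sum_mem _ fun i _ => Submodule.smul_mem _ _ (Submodule.subset_span ⟨i, hf i⟩)

/-- Exhibits the weight lattice as the dual lattice produced by Poisson summation on the root
lattice. -/
theorem mem_weightLattice_iff_dualVec (hb : b.cartanMatrix.IsSimplyLaced)
    {M : Matrix b.support b.support ℝ} [DecidableEq b.support] (hM : M.det ≠ 0)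
    (he : ∀ x y, form b (b.toWeightBasis.equivFun.symm x) (b.toWeightBasis.equivFun.symm y) =
        dotProduct (M.mulVec x) (M.mulVec y)) {x : V} :
    x ∈ weightLattice b ↔
      ∃ k : b.support → ℤ, x = dualVec M b.toWeightBasis.equivFun.symm (intVec k) := by
  have h1 : ∀ (k : b.support → ℤ) (j : b.support),
      form b (dualVec M b.toWeightBasis.equivFun.symm (intVec k)) (P.root j) = k j := by
    intro k j
    rw [root_eq_equivFun_symm, form_dualVec hM he]
    simp [intVec]
  rw [mem_weightLattice_iff hb]
  constructor
  · intro h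
    choose k hk using h
    exact ⟨k, eq_of_form_simple hb fun j => by rw [hk, h1]⟩
  · rintro ⟨k, rfl⟩ j
    exact ⟨k j, h1 k j⟩

theorem form_weight_rootLattice (hb : b.cartanMatrix.IsSimplyLaced) {x y : V}
    (hx : x ∈ weightLattice b) (hy : y ∈ rootLattice b) : ∃ z : ℤ, form b x y = z := by
  induction hy using Submodule.span_induction with
  | mem y hy =>
    obtain ⟨i, hi, rfl⟩ := hy
    exact (mem_weightLattice_iff hb).1 hx ⟨i, hi⟩
  | zero => exact ⟨0, by simp⟩
  | add y z _ _ hy hz =>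
    obtain ⟨n, hn⟩ := hy
    obtain ⟨m, hm⟩ := hz
    exact ⟨n + m, by simp [hn, hm]⟩
  | smul a y _ hy =>
    obtain ⟨n, hn⟩ := hy
    exact ⟨a * n, by rw [← Int.cast_smul_eq_zsmul ℝ]; simp [hn]⟩

variable [P.IsReduced]

theorem rootLattice_le_weightLattice (hb : b.cartanMatrix.IsSimplyLaced) :
    rootLattice b ≤ weightLattice b := by
  refine Submodule.span_le.2 ?_
  rintro _ ⟨i, _, rfl⟩
  exact (mem_weightLattice_iff hb).2 fun j => ⟨_, form_root_root hb i j⟩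

/-- Generators have norm 2 and cross terms occur twice. Evenness makes the quadratic phases of the
Gauss sums and of `ThetaT` periodic. -/
theorem form_rootLattice_even (hb : b.cartanMatrix.IsSimplyLaced) {y : V}
    (hy : y ∈ rootLattice b) : ∃ z : ℤ, form b y y = 2 * z := by
  induction hy using Submodule.span_induction with
  | mem y hy =>
    obtain ⟨i, hi, rfl⟩ := hy
    exact ⟨1, by rw [form_root_self hb]; simp⟩
  | zero => exact ⟨0, by simp⟩
  | add y z hy' hz' hy hz =>
    obtain ⟨n, hn⟩ := hy
    obtain ⟨m, hm⟩ := hz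
    obtain ⟨p, hp⟩ := form_weight_rootLattice hb (rootLattice_le_weightLattice hb hy') hz'
    refine ⟨n + m + p, ?_⟩
    simp only [map_add, LinearMap.add_apply, hn, hm, form_symm hb z y, hp]
    push_cast
    ring
  | smul a y _ hy =>
    obtain ⟨n, hn⟩ := hy
    refine ⟨a * a * n, ?_⟩
    rw [← Int.cast_smul_eq_zsmul ℝ]
    simp only [map_smul, LinearMap.smul_apply, smul_eq_mul, hn]
    push_cast
    ring

theorem smul_mem_rootLattice (w : P.weylGroup) {y : V} (hy : y ∈ rootLattice b) :
    w • y ∈ rootLattice b := by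
  induction hy using Submodule.span_induction with
  | mem y hy =>
    obtain ⟨i, hi, rfl⟩ := hy
    rw [weylGroup_apply_root]
    exact root_mem_rootLattice _
  | zero => simp
  | add y z _ _ hy hz => rw [smul_add]; exact add_mem hy hz
  | smul a y _ hy => rw [smul_comm]; exact Submodule.smul_mem _ _ hy

theorem smul_mem_weightLattice (hb : b.cartanMatrix.IsSimplyLaced) (w : P.weylGroup) {x : V}
    (hx : x ∈ weightLattice b) : w • x ∈ weightLattice b := by
  rw [mem_weightLattice_iff hb]
  intro j
  rw [form_smul_left hb]
  exact form_weight_rootLattice hb hx (smul_mem_rootLattice _ (root_mem_rootLattice _))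

/-- `v` lists representatives of the classes of `L` modulo `n R`. -/
structure IsReps (L R : Submodule ℤ V) (n : ℤ) {K : Type*} (v : K → V) : Prop where
  mem : ∀ k, v k ∈ L
  existsUnique : ∀ x ∈ L, ∃! k, ∃ y ∈ R, x = v k + (n : ℝ) • y

theorem IsReps.sum_eq {L R : Submodule ℤ V} {n : ℤ} {K K' : Type*} [Fintype K] [Fintype K']
    {v : K → V} {v' : K' → V} (hv : IsReps L R n v) (hv' : IsReps L R n v') (f : V → ℂ)
    (hf : ∀ x ∈ L, ∀ y ∈ R, f (x + (n : ℝ) • y) = f x) : ∑ k, f (v k) = ∑ k, f (v' k) := by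
  choose i hi _ using fun k => hv'.existsUnique (v k) (hv.mem k)
  refine Fintype.sum_bijective i ⟨fun k l h => ?_, fun k' => ?_⟩ _ _ fun k => ?_
  · obtain ⟨y, hy, h1⟩ := hi k
    obtain ⟨z, hz, h2⟩ := hi l
    refine (hv.existsUnique (v k) (hv.mem k)).unique ⟨0, zero_mem _, by simp⟩
      ⟨y - z, sub_mem hy hz, ?_⟩
    rw [smul_sub, h2, ← h, h1]
    abel
  · obtain ⟨k, ⟨y, hy, h1⟩, _⟩ := hv.existsUnique (v' k') (hv'.mem k')
    refine ⟨k, (hv'.existsUnique (v k) (hv.mem k)).unique (hi k) ⟨-y, neg_mem hy, ?_⟩⟩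
    rw [h1]
    simp
  · obtain ⟨y, hy, h1⟩ := hi k
    rw [h1, hf _ (hv'.mem _) _ hy]

/-- The tower `L ⊇ n R ⊇ m n R`. It merges the class sum from the alcove with the one from the
induction hypothesis. -/
theorem IsReps.trans {L R : Submodule ℤ V} {n m : ℤ} (hRL : R ≤ L) {K K' : Type*} {v : K → V}
    {s : K' → V} (hn : n ≠ 0) (hv : IsReps L R n v) (hs : IsReps R R m s) :
    IsReps L R (m * n) fun p : K × K' => v p.1 + (n : ℝ) • s p.2 where
  mem p := by
    rw [Int.cast_smul_eq_zsmul]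
    exact add_mem (hv.mem _) (Submodule.smul_mem _ _ (hRL (hs.mem _)))
  existsUnique x hx := by
    have hn' : (n : ℝ) ≠ 0 := by exact_mod_cast hn
    obtain ⟨k, ⟨y, hy, h1⟩, hk⟩ := hv.existsUnique x hx
    obtain ⟨k', ⟨z, hz, h2⟩, hk'⟩ := hs.existsUnique y hy
    refine ⟨(k, k'), ⟨z, hz, ?_⟩, ?_⟩
    · rw [h1, h2]
      push_cast
      rw [smul_add, smul_smul, mul_comm (m : ℝ), add_assoc]
    · rintro ⟨l, l'⟩ ⟨u, hu, h3⟩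
      have h4 : x = v l + (n : ℝ) • (s l' + (m : ℝ) • u) := by
        rw [h3]
        push_cast
        rw [smul_add, smul_smul, mul_comm (m : ℝ), add_assoc]
      have hmem : s l' + (m : ℝ) • u ∈ R := by
        rw [Int.cast_smul_eq_zsmul]
        exact add_mem (hs.mem _) (Submodule.smul_mem _ _ hu)
      have hl : l = k := hk l ⟨_, hmem, h4⟩
      subst hl
      have h5 : y = s l' + (m : ℝ) • u := by
        have := add_left_cancel (h1.symm.trans h4)
        exact smul_right_injective _ hn' this
      rw [hk' l' ⟨u, hu, h5⟩]

theorem IsReps.smul (hb : b.cartanMatrix.IsSimplyLaced) {n : ℤ} {K : Type*} {v : K → V}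
    (hv : IsReps (weightLattice b) (rootLattice b) n v) (w : P.weylGroup) :
    IsReps (weightLattice b) (rootLattice b) n fun k => w • v k where
  mem k := smul_mem_weightLattice hb w (hv.mem k)
  existsUnique x hx := by
    obtain ⟨k, ⟨y, hy, h1⟩, hk⟩ := hv.existsUnique (w⁻¹ • x) (smul_mem_weightLattice hb _ hx)
    refine ⟨k, ⟨w • y, smul_mem_rootLattice w hy, ?_⟩, ?_⟩
    · rw [← smul_comm w, ← smul_add, ← h1, smul_inv_smul]
    · rintro l ⟨z, hz, h2⟩
      refine hk l ⟨w⁻¹ • z, smul_mem_rootLattice _ hz, ?_⟩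
      rw [h2, smul_add, inv_smul_smul, smul_comm w⁻¹]

end Lattices

end SimplyLaced

end

/-! ### Covolumes and finiteness of the quotients -/

noncomputable section

namespace SimplyLaced

section Volumes

open RootPairing Complex

variable {ι V N : Type*} [AddCommGroup V] [Module ℝ V] [AddCommGroup N] [Module ℝ N]
  {P : RootPairing ι ℝ V N} [P.IsRootSystem] [P.IsCrystallographic] {b : P.Base}

theorem vol_span_range {κ : Type*} [Fintype κ] [DecidableEq κ] {v : κ → V}
    (hv : LinearIndependent ℝ v) :
    vol b (Submodule.span ℤ (Set.range v)) =
      √|(Matrix.of fun i j => form b (v i) (v j)).det| := by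
  have hv' : LinearIndependent ℤ v := by
    refine hv.restrict_scalars fun x y h => ?_
    simpa using h
  rw [vol_eq b _ (Module.Basis.span hv')]
  simp only [Module.Basis.span_apply]

variable [Finite ι]

theorem vol_rootLattice [DecidableEq b.support] : vol b (rootLattice b) =
    √|(Matrix.of fun i j : b.support => form b (P.root i) (P.root j)).det| := by
  have h : rootLattice b = Submodule.span ℤ (Set.range fun i : b.support => P.root i) := by
    rw [rootLattice, Set.image_eq_range]
    rfl
  have hli : LinearIndependent ℝ fun i : b.support => P.root i := b.linearIndepOn_root
  rw [h, vol_span_range hli]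

theorem linearIndependent_of_isFundamentalWeight {f : b.support → V}
    (hf : ∀ i, IsFundamentalWeight b i (f i)) : LinearIndependent ℝ f := by
  rw [Fintype.linearIndependent_iff]
  intro g hg j
  have := congrArg (fun x => form b x (P.root j)) hg
  simpa [hf _ j] using this

theorem weightLattice_eq_span (hb : b.cartanMatrix.IsSimplyLaced) {f : b.support → V}
    (hf : ∀ i, IsFundamentalWeight b i (f i)) :
    weightLattice b = Submodule.span ℤ (Set.range f) := by
  have h : {x | ∃ i, IsFundamentalWeight b i x} = Set.range f := by
    ext x
    constructor
    · rintro ⟨i, hi⟩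
      exact ⟨i, eq_of_form_simple hb fun j => by rw [hf i j, hi j]⟩
    · rintro ⟨i, rfl⟩
      exact ⟨i, hf i⟩
  rw [weightLattice, h]

theorem finite_weightLattice (hb : b.cartanMatrix.IsSimplyLaced) :
    Module.Finite ℤ (weightLattice b) := by
  choose f hf using exists_isFundamentalWeight hb
  rw [weightLattice_eq_span hb hf]
  exact Module.Finite.span_of_finite ℤ (Set.finite_range f)

variable [P.IsReduced]

theorem det_form_simple_ne_zero [DecidableEq b.support] (hb : b.cartanMatrix.IsSimplyLaced) :
    (Matrix.of fun i j : b.support => form b (P.root i) (P.root j)).det ≠ 0 := by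
  intro h
  obtain ⟨v, hv, hv'⟩ := Matrix.exists_vecMul_eq_zero_iff.2 h
  refine hv (b.toWeightBasis.equivFun.symm.map_eq_zero_iff.1 (eq_zero_of_form_simple hb fun j => ?_))
  have := congrFun hv' j
  simpa [Module.Basis.equivFun_symm_apply, Matrix.vecMul, dotProduct] using this

theorem vol_rootLattice_pos (hb : b.cartanMatrix.IsSimplyLaced) : 0 < vol b (rootLattice b) := by
  classical
  rw [vol_rootLattice]
  exact Real.sqrt_pos.2 (abs_pos.2 (det_form_simple_ne_zero hb))

/-- The simple roots are expressed in the fundamental weights by their own Gram matrix `C`, so the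
Gram matrix of the weights is inverse to `Cᵀ`. -/
theorem vol_weightLattice_mul_vol_rootLattice (hb : b.cartanMatrix.IsSimplyLaced) :
    vol b (weightLattice b) * vol b (rootLattice b) = 1 := by
  classical
  choose f hf using exists_isFundamentalWeight hb
  rw [weightLattice_eq_span hb hf,
    vol_span_range (linearIndependent_of_isFundamentalWeight hf), vol_rootLattice,
    ← Real.sqrt_mul (abs_nonneg _), ← abs_mul]
  set C : Matrix b.support b.support ℝ := Matrix.of fun i j => form b (P.root i) (P.root j) with hC
  have h1 : ∀ k : b.support, P.root k = ∑ j, C k j • f j := by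
    intro k
    refine eq_of_form_simple hb fun j => ?_
    simp [hf _ j, hC]
  have h2 : (Matrix.of fun i j => form b (f i) (f j)) * C.transpose = 1 := by
    ext i k
    have := hf i k
    rw [h1 k] at this
    simp only [map_sum, map_smul, smul_eq_mul] at this
    simp only [Matrix.mul_apply, Matrix.of_apply, Matrix.transpose_apply, Matrix.one_apply]
    rw [← this]
    exact Finset.sum_congr rfl fun j _ => mul_comm _ _
  have h3 := congrArg Matrix.det h2
  rw [Matrix.det_mul, Matrix.det_transpose, Matrix.det_one] at h3
  rw [h3]
  simp

theorem vol_rootLattice_eq_abs_det [DecidableEq b.support] {M : Matrix b.support b.support ℝ}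
    (he : ∀ x y, form b (b.toWeightBasis.equivFun.symm x) (b.toWeightBasis.equivFun.symm y) =
        dotProduct (M.mulVec x) (M.mulVec y)) :
    vol b (rootLattice b) = |M.det| := by
  have h : (Matrix.of fun i j : b.support => form b (P.root i) (P.root j)) = M.transpose * M := by
    ext i j
    rw [Matrix.of_apply, root_eq_equivFun_symm i, root_eq_equivFun_symm j, he]
    simp [Matrix.mul_apply, dotProduct]
  rw [vol_rootLattice, h, Matrix.det_mul, Matrix.det_transpose, abs_mul, Real.sqrt_mul_self (abs_nonneg _)]

/-- The weight lattice modulo the root lattice is torsion. -/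
theorem exists_smul_mem_rootLattice (hb : b.cartanMatrix.IsSimplyLaced) :
    ∃ d : ℤ, d ≠ 0 ∧ ∀ x ∈ weightLattice b, d • x ∈ rootLattice b := by
  classical
  choose z hz using fun i j : b.support => (⟨_, form_root_root hb i j⟩ :
    ∃ z : ℤ, form b (P.root i) (P.root j) = z)
  set C : Matrix b.support b.support ℤ := Matrix.of z with hC
  have hdet : ((C.det : ℤ) : ℝ) ≠ 0 := by
    have h := det_form_simple_ne_zero hb
    have h2 : (Matrix.of fun i j : b.support => form b (P.root i) (P.root j)) =
        C.map (Int.castRingHom ℝ) := by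
      ext i j
      simp [hC, hz]
    rwa [h2, ← RingHom.mapMatrix_apply, ← RingHom.map_det] at h
  refine ⟨C.det, by exact_mod_cast hdet, fun x hx => ?_⟩
  choose k hk using (mem_weightLattice_iff hb).1 hx
  -- The adjugate inverts the integral Gram matrix up to `det C`, so `det C` clears the denominators
  -- of all weights.
  set n := Matrix.vecMul k C.adjugate with hn
  have hn' : Matrix.vecMul n C = C.det • k := by
    rw [hn, Matrix.vecMul_vecMul, Matrix.adjugate_mul, Matrix.vecMul_smul, Matrix.vecMul_one]
  refine mem_rootLattice_iff.2 ⟨n, eq_of_form_simple hb fun j => ?_⟩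
  have h3 := congrArg (fun z : ℤ => (z : ℝ)) (congrFun hn' j)
  have hCz : ∀ i j, C i j = z i j := fun _ _ => rfl
  simp only [Matrix.vecMul, dotProduct, Pi.smul_apply, smul_eq_mul, Int.cast_sum, Int.cast_mul,
    hCz] at h3
  rw [← Int.cast_smul_eq_zsmul ℝ, map_smul, LinearMap.smul_apply, smul_eq_mul, hk, ← h3]
  simp [Module.Basis.equivFun_symm_apply, intVec, hz]

theorem isReps_of_section {L R : Submodule ℤ V} {n : ℤ} {S : Submodule ℤ L}
    (hS : ∀ x : L, x ∈ S ↔ ∃ y ∈ R, (x : V) = (n : ℝ) • y) (s : L ⧸ S → L)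
    (hs : ∀ q, Submodule.Quotient.mk (s q) = q) : IsReps L R n fun q => (s q : V) where
  mem q := (s q).2
  existsUnique x hx := by
    have key : ∀ q, (∃ y ∈ R, x = s q + (n : ℝ) • y) ↔ Submodule.Quotient.mk ⟨x, hx⟩ = q := by
      intro q
      conv_rhs => rw [← hs q]
      rw [Submodule.Quotient.eq, hS]
      simp only [Submodule.coe_sub, sub_eq_iff_eq_add, add_comm]
    exact ⟨_, (key _).2 rfl, fun q hq => ((key q).1 hq).symm⟩

theorem isReps_modN {n : ℤ} (s : ModN (rootLattice b) n → rootLattice b)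
    (hs : ∀ q, Submodule.Quotient.mk (s q) = q) :
    IsReps (rootLattice b) (rootLattice b) n fun q => (s q : V) := by
  refine isReps_of_section (fun x => ?_) s hs
  simp only [LinearMap.mem_range, LinearMap.smul_apply, LinearMap.id_apply, Subtype.exists,
    Subtype.ext_iff, exists_prop, Submodule.coe_smul, Int.cast_smul_eq_zsmul, eq_comm]

theorem IsReps.comp_equiv {L R : Submodule ℤ V} {n : ℤ} {K K' : Type*} {v : K → V}
    (hv : IsReps L R n v) (ε : K' ≃ K) : IsReps L R n fun k => v (ε k) where
  mem _ := hv.mem _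
  existsUnique x hx := ε.bijective.existsUnique_iff.1 (hv.existsUnique x hx)

/-- The quotient is finitely generated and killed by `n d`, where `d` carries weights into the root
lattice; hence it is finite. -/
theorem exists_isReps (hb : b.cartanMatrix.IsSimplyLaced) {n : ℤ} (hn : n ≠ 0) :
    ∃ (k : ℕ) (v : Fin k → V), IsReps (weightLattice b) (rootLattice b) n v := by
  set S : Submodule ℤ (weightLattice b) :=
    ((rootLattice b).map (n • (LinearMap.id : V →ₗ[ℤ] V))).comap (weightLattice b).subtype
  have hS : ∀ x : weightLattice b, x ∈ S ↔ ∃ y ∈ rootLattice b, (x : V) = (n : ℝ) • y := by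
    intro x
    simp [S, Int.cast_smul_eq_zsmul, eq_comm]
  have := finite_weightLattice hb
  have hfin : Finite (weightLattice b ⧸ S) := by
    refine Module.finite_of_fg_torsion _ fun {q} => ?_
    obtain ⟨x, rfl⟩ := Submodule.Quotient.mk_surjective _ q
    obtain ⟨d, hd, h⟩ := exists_smul_mem_rootLattice hb
    refine ⟨⟨n * d, mem_nonZeroDivisors_of_ne_zero (mul_ne_zero hn hd)⟩, ?_⟩
    change (n * d) • (Submodule.Quotient.mk x : _ ⧸ S) = 0
    rw [← Submodule.Quotient.mk_smul, Submodule.Quotient.mk_eq_zero, hS]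
    exact ⟨d • (x : V), h x x.2, by simp [mul_smul, Int.cast_smul_eq_zsmul]⟩
  have h1 := isReps_of_section hS _ Submodule.Quotient.mk_out
  have ε := Finite.equivFin (weightLattice b ⧸ S)
  exact ⟨_, _, h1.comp_equiv ε.symm⟩

theorem finite_modN {n : ℤ} (hn : n ≠ 0) :
    Finite (ModN (rootLattice b) n) := by
  have : Module.Finite ℤ (rootLattice b) :=
    Module.Finite.span_of_finite ℤ ((Finset.finite_toSet _).image _)
  refine Module.finite_of_fg_torsion _ fun {q} => ?_
  obtain ⟨x, rfl⟩ := Submodule.Quotient.mk_surjective _ q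
  refine ⟨⟨n, mem_nonZeroDivisors_of_ne_zero hn⟩, ?_⟩
  change n • (Submodule.Quotient.mk x : ModN (rootLattice b) n) = 0
  rw [← Submodule.Quotient.mk_smul, Submodule.Quotient.mk_eq_zero]
  exact ⟨x, rfl⟩

/-- Coordinate form of the class decomposition: the integer vectors parametrizing `L` are reindexed
by a class and a vector parametrizing `R`, as splitting a theta series requires. -/
theorem IsReps.exists_equiv {L R : Submodule ℤ V} {n : ℤ} (hn : n ≠ 0) (hRL : R ≤ L) {A K : Type*}
    {v : K → V} (hv : IsReps L R n v) {E F : A → V} (hE : ∀ x, x ∈ L ↔ ∃ k, x = E k)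
    (hE' : Function.Injective E) (hF : ∀ x, x ∈ R ↔ ∃ k, x = F k) (hF' : Function.Injective F) :
    ∃ φ : K × A ≃ A, ∀ k m, E (φ (k, m)) = v k + (n : ℝ) • F m := by
  have hn' : (n : ℝ) ≠ 0 := by exact_mod_cast hn
  have h1 : ∀ p : K × A, ∃ l, v p.1 + (n : ℝ) • F p.2 = E l := by
    intro p
    rw [← hE, Int.cast_smul_eq_zsmul]
    exact add_mem (hv.mem _) (Submodule.smul_mem _ _ (hRL ((hF _).2 ⟨_, rfl⟩)))
  choose φ hφ using h1
  refine ⟨Equiv.ofBijective φ ⟨?_, fun l => ?_⟩, fun k m => (hφ (k, m)).symm⟩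
  · rintro ⟨k, m⟩ ⟨k', m'⟩ h
    have h2 := hφ (k, m)
    rw [h, ← hφ] at h2
    obtain rfl : k = k' := (hv.existsUnique (E (φ (k', m'))) ((hE _).2 ⟨_, rfl⟩)).unique
      ⟨F m, (hF _).2 ⟨_, rfl⟩, by rw [← hφ, ← h2]⟩ ⟨F m', (hF _).2 ⟨_, rfl⟩, by rw [← hφ]⟩
    have h3 : F m = F m' := smul_right_injective V hn' (add_left_cancel h2)
    rw [hF' h3]
  · obtain ⟨k, ⟨y, hy, h2⟩, _⟩ := hv.existsUnique (E l) ((hE _).2 ⟨l, rfl⟩)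
    obtain ⟨m, rfl⟩ := (hF y).1 hy
    exact ⟨(k, m), hE' (by rw [h2, ← hφ])⟩

end Volumes

end SimplyLaced

end

/-! ### Reciprocity over the weight lattice, with explicit eighth roots of unity -/

noncomputable section

namespace SimplyLaced

section GaussSums

open RootPairing Complex

/-- On the principal branch the argument of `-iq` is `-π/2` or `π/2` according to the sign of `q`;
raising to the power `l/2` gives `ζ` to the power `∓l`. -/
theorem neg_I_mul_cpow {q : ℝ} (hq : q ≠ 0) (l : ℕ) :
    (-I * q : ℂ) ^ (l / 2 : ℂ) =
      ((|q| ^ (l / 2 : ℝ) : ℝ) : ℂ) * exp (Real.pi * I / 4) ^ (-(l : ℤ) * SignType.sign q) := by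
  have h1 : (-I * q : ℂ) = (|q| : ℝ) * (-I * (SignType.sign q : ℝ)) := by
    conv_lhs => rw [← abs_mul_sign q]
    push_cast
    ring
  have h2 : (((|q| ^ (l / 2 : ℝ) : ℝ)) : ℂ) = ((|q| : ℝ) : ℂ) ^ (l / 2 : ℂ) := by
    rw [Complex.ofReal_cpow (abs_nonneg _)]
    push_cast
    ring_nf
  have h3 : ∀ z : ℂ, z ≠ 0 → ∀ w : ℂ, z ^ w = exp (log z * w) := fun z hz w =>
    cpow_def_of_ne_zero hz w
  rcases lt_or_gt_of_ne hq with h | h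
  · have hs : SignType.sign q = -1 := sign_neg h
    rw [h1, ofReal_mul_cpow (abs_pos.2 hq) (by simp [hs]), h2, hs, ← Complex.exp_int_mul]
    congr 1
    rw [h3 _ (by simp)]
    congr 1
    simp [log_I]
    ring
  · have hs : SignType.sign q = 1 := sign_pos h
    rw [h1, ofReal_mul_cpow (abs_pos.2 hq) (by simp [hs]), h2, hs, ← Complex.exp_int_mul]
    congr 1
    rw [h3 _ (by simp)]
    congr 1
    simp [log_neg_I]
    ring

variable {ι V N : Type*} [AddCommGroup V] [Module ℝ V] [AddCommGroup N] [Module ℝ N]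
  {P : RootPairing ι ℝ V N} [P.IsRootSystem] [P.IsCrystallographic] {b : P.Base}
  [Finite ι] [P.IsReduced]

/-- Reciprocity for quadratic Gauss sums over the weight lattice. -/
theorem gauss_reciprocity (hb : b.cartanMatrix.IsSimplyLaced) {n f : ℤ} (hn : n ≠ 0) (hf : f ≠ 0)
    {ξ : V} (hξ : (n : ℝ) • ξ ∈ weightLattice b) {K K' : Type*} [Fintype K] [Fintype K']
    {v : K → V} (hv : IsReps (weightLattice b) (rootLattice b) n v)
    {s : K' → V} (hs : IsReps (rootLattice b) (rootLattice b) f s) :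
    ∑ k, exp (Real.pi * I * (f / n) * (form b (v k) (v k) : ℝ) -
        2 * Real.pi * I * (form b ξ (v k) : ℝ)) =
      (vol b (rootLattice b) * |(n : ℝ) / f| ^ ((rank b : ℝ) / 2) : ℝ) *
        exp (Real.pi * I / 4) ^ ((rank b : ℤ) * Int.sign (n * f)) *
        ∑ k, exp (-(Real.pi * I * (n / f)) * (form b (s k + ξ) (s k + ξ) : ℝ)) := by
  obtain ⟨M, hdec, hM, he⟩ := exists_form_eq_dotProduct hb
  set e := b.toWeightBasis.equivFun.symm
  have hint : Function.Injective (intVec : (b.support → ℤ) → b.support → ℝ) := fun x y h =>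
    funext fun i => by simpa [intVec] using congrFun h i
  have hF : Function.Injective fun k : b.support → ℤ => e (intVec k) := e.injective.comp hint
  have hE : Function.Injective fun k : b.support → ℤ => dualVec M e (intVec k) := by
    refine fun x y h => hint (funext fun i => ?_)
    have h1 := congrArg (fun z => form b z (P.root i)) h
    simp only [root_eq_equivFun_symm] at h1
    rw [form_dualVec hM he, form_dualVec hM he] at h1
    simpa using h1
  obtain ⟨φ, hφ⟩ := hv.exists_equiv hn (rootLattice_le_weightLattice hb)
    (fun _ => mem_weightLattice_iff_dualVec hb hM he) hE (fun _ => mem_rootLattice_iff) hF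
  obtain ⟨φ', hφ'⟩ := hs.exists_equiv hf le_rfl (fun _ => mem_rootLattice_iff) hF
    (fun _ => mem_rootLattice_iff) hF
  have key := gauss_reciprocity_aux hM he
    (fun n => form_rootLattice_even hb (mem_rootLattice_iff.2 ⟨n, rfl⟩)) hn hf
    ((mem_weightLattice_iff_dualVec hb hM he).1 hξ) v φ hφ s φ' hφ'
  have hn' : (n : ℝ) ≠ 0 := by exact_mod_cast hn
  have hf' : (f : ℝ) ≠ 0 := by exact_mod_cast hf
  have hq : (f / n : ℝ) ≠ 0 := div_ne_zero hf' hn'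
  have hcard : Fintype.card b.support = rank b := Fintype.card_coe _
  have hq2 := neg_I_mul_cpow hq (rank b)
  push_cast at hq2
  rw [hcard, hq2, ← vol_rootLattice_eq_abs_det he] at key
  have hsign : ((SignType.sign (f / n : ℝ) : SignType) : ℤ) = Int.sign (n * f) := by
    rcases lt_or_gt_of_ne hn with h1 | h1 <;> rcases lt_or_gt_of_ne hf with h2 | h2 <;>
    · have h1' := h1
      have h2' := h2
      rw [← Int.cast_lt (R := ℝ), Int.cast_zero] at h1' h2'
      simp [Int.sign_eq_sign, div_eq_mul_inv, sign_mul, h1, h2, h1', h2', sign_pos, sign_neg]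
  have hpos : 0 < |(f : ℝ) / n| ^ ((rank b : ℝ) / 2) := by positivity
  have hinv : |(n : ℝ) / f| ^ ((rank b : ℝ) / 2) = (|(f : ℝ) / n| ^ ((rank b : ℝ) / 2))⁻¹ := by
    rw [← Real.inv_rpow (abs_nonneg _), ← abs_inv, inv_div]
  have hζ : exp (Real.pi * I / 4) ≠ 0 := exp_ne_zero _
  rw [hsign, neg_mul, zpow_neg] at key
  have hpos' : ((|(f : ℝ) / n| ^ ((rank b : ℝ) / 2) : ℝ) : ℂ) ≠ 0 := by exact_mod_cast hpos.ne'
  rw [← div_eq_mul_inv, ← mul_div_assoc, div_eq_iff (zpow_ne_zero _ hζ)] at key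
  rw [hinv, ofReal_mul, ofReal_inv]
  refine mul_right_cancel₀ hpos' (key.trans ?_)
  field_simp

end GaussSums

end SimplyLaced

end

/-! ### The alcove as a fundamental domain for the affine Weyl group -/

noncomputable section

namespace SimplyLaced

section Alcoves

open RootPairing

variable {ι V N : Type*} [AddCommGroup V] [Module ℝ V] [AddCommGroup N] [Module ℝ N]
  {P : RootPairing ι ℝ V N} [P.IsRootSystem] [P.IsCrystallographic] {b : P.Base}
  [Finite ι] [P.IsReduced] {θ : ι} {r : ℕ}

/-- The interior of the `r`-alcove. -/
def openAlcove (b : P.Base) (θ : ι) (r : ℕ) : Set V :=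
  {x | (∀ i : b.support, 0 < form b x (P.root i)) ∧ form b x (P.root θ) < r}

theorem root_reflectionPerm_self (i : ι) : P.root (P.reflectionPerm i i) = -P.root i := by
  simp

theorem form_root_pos {x : V} (hx : ∀ i : b.support, 0 < form b x (P.root i)) {i : ι}
    (hi : b.IsPos i) : 0 < form b x (P.root i) := by
  refine hi.induction_on_add (p := fun i => 0 < form b x (P.root i)) (fun i hi => hx ⟨i, hi⟩) ?_
  intro i j k hk h1 hj
  rw [hk, map_add]
  exact add_pos h1 (hx ⟨j, hj⟩)

theorem isPos_of_form_root_pos {x : V} (hx : ∀ i : b.support, 0 < form b x (P.root i)) {i : ι}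
    (hi : 0 < form b x (P.root i)) : b.IsPos i := by
  by_contra h
  have := form_root_pos hx ((Base.IsPos.neg_iff_not b i).2 h)
  rw [indexNeg_neg, root_reflectionPerm_self, map_neg] at this
  linarith

theorem form_root_le (hθ : IsHighestRoot b θ) {x : V} (hx : x ∈ closedChamber b) (i : ι) :
    form b x (P.root i) ≤ form b x (P.root θ) := by
  suffices h : ∀ y ∈ AddSubmonoid.closure (P.root '' b.support), 0 ≤ form b x y by
    have := h _ (hθ i)
    rw [map_sub] at this
    linarith
  intro y hy
  induction hy using AddSubmonoid.closure_induction with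
  | mem y hy =>
    obtain ⟨i, hi, rfl⟩ := hy
    exact hx ⟨i, hi⟩
  | zero => simp
  | add y z _ _ hy hz => rw [map_add]; exact add_nonneg hy hz

theorem openAlcove_subset_closedChamber : openAlcove b θ r ⊆ closedChamber b :=
  fun _ hx i => (hx.1 i).le

theorem abs_form_root_lt (hθ : IsHighestRoot b θ) {x : V} (hx : x ∈ openAlcove b θ r) (i : ι) :
    |form b x (P.root i)| < r := by
  have h : ∀ i, form b x (P.root i) < r := fun i =>
    (form_root_le hθ (openAlcove_subset_closedChamber hx) i).trans_lt hx.2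
  have h1 := h (P.reflectionPerm i i)
  rw [root_reflectionPerm_self, map_neg] at h1
  exact abs_lt.2 ⟨by linarith, h i⟩

theorem exists_list_of_mem_rootLattice {y : V} (hy : y ∈ rootLattice b) :
    ∃ l : List ι, y = (l.map P.root).sum := by
  rw [rootLattice, ← Submodule.mem_toAddSubgroup, Submodule.span_int_eq_addSubgroupClosure] at hy
  induction hy using AddSubgroup.closure_induction with
  | mem y hy =>
    obtain ⟨i, _, rfl⟩ := hy
    exact ⟨[i], by simp⟩
  | zero => exact ⟨[], by simp⟩
  | add y z _ _ hy hz =>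
    obtain ⟨l, rfl⟩ := hy
    obtain ⟨l', rfl⟩ := hz
    exact ⟨l ++ l', by simp⟩
  | neg y _ hy =>
    obtain ⟨l, rfl⟩ := hy
    refine ⟨l.map fun i => P.reflectionPerm i i, ?_⟩
    rw [List.map_map, List.sum_neg, List.map_map]
    congr 2
    ext i
    simp

/-- The leading root `α` contributes 2 to the pairing of the sum with `α`, so some later `β` pairs
negatively with `α`. Then `α + β` is zero or a root, and the list shortens. -/
theorem list_sum_eq_zero (hb : b.cartanMatrix.IsSimplyLaced) (l : List ι)
    (hl : ∀ i, form b (l.map P.root).sum (P.root i) < 2) : (l.map P.root).sum = 0 := by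
  induction hn : l.length using Nat.strong_induction_on generalizing l with
  | _ n ih =>
    rcases l with _ | ⟨i, l⟩
    · rfl
    have h1 := hl i
    rw [List.map_cons, List.sum_cons, map_add, LinearMap.add_apply, form_root_self hb] at h1
    have h2 : ∃ j ∈ l, form b (P.root j) (P.root i) < 0 := by
      by_contra! h
      have : 0 ≤ form b (l.map P.root).sum (P.root i) := by
        clear h1 hl hn
        induction l with
        | nil => simp
        | cons j l ih' =>
          rw [List.map_cons, List.sum_cons, map_add, LinearMap.add_apply]
          exact add_nonneg (h j (by simp)) (ih' fun k hk => h k (by simp [hk]))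
      linarith
    obtain ⟨j, hj, hneg⟩ := h2
    classical
    have hperm := ((List.perm_cons_erase hj).map P.root).sum_eq
    have hlen := List.length_erase_add_one hj
    rw [List.length_cons] at hn
    rw [List.map_cons, List.sum_cons] at hperm
    by_cases h3 : P.root i = -P.root j
    · have h4 : ((i :: l).map P.root).sum = ((l.erase j).map P.root).sum := by
        rw [List.map_cons, List.sum_cons, hperm, h3, neg_add_cancel_left]
      rw [h4] at hl ⊢
      exact ih _ (by lia) _ hl rfl
    · rw [form_symm hb, form_root_root hb, ← Int.cast_zero, Int.cast_lt] at hneg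
      obtain ⟨k, hk⟩ := P.root_add_root_mem_of_pairingIn_neg hneg h3
      have h4 : ((i :: l).map P.root).sum = ((k :: l.erase j).map P.root).sum := by
        rw [List.map_cons, List.sum_cons, hperm, List.map_cons, List.sum_cons, hk, add_assoc]
      rw [h4] at hl ⊢
      exact ih _ (by rw [List.length_cons]; lia) _ hl rfl

theorem eq_zero_of_abs_form_root_lt (hb : b.cartanMatrix.IsSimplyLaced) {y : V}
    (hy : y ∈ rootLattice b) (h : ∀ i, form b y (P.root i) < 2) : y = 0 := by
  obtain ⟨l, rfl⟩ := exists_list_of_mem_rootLattice hy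
  exact list_sum_eq_zero hb l h

/-- Points of the open alcove pair with every root strictly between `-r` and `r`, so `y` pairs with
every root to less than 2 and vanishes. Then `w` keeps a regular dominant point dominant, so it
preserves the positive roots. -/
theorem eq_one_of_smul_add_mem_openAlcove (hb : b.cartanMatrix.IsSimplyLaced)
    (hθ : IsHighestRoot b θ) {x x' y : V} {w : P.weylGroup} (hx : x ∈ openAlcove b θ r)
    (hx' : x' ∈ openAlcove b θ r) (hy : y ∈ rootLattice b) (h : x' = w • x + (r : ℝ) • y) :
    w = 1 ∧ x' = x := by
  have h1 : y = 0 := by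
    refine eq_zero_of_abs_form_root_lt hb hy fun i => ?_
    have h2 := abs_lt.1 (abs_form_root_lt hθ hx' i)
    have h3 := abs_lt.1 (abs_form_root_lt hθ hx (P.weylGroupToPerm w⁻¹ i))
    rw [← weylGroup_apply_root, ← form_smul_left hb] at h3
    rw [h, map_add, (form b).map_smul, LinearMap.add_apply, LinearMap.smul_apply, smul_eq_mul] at h2
    have h4 : (r : ℝ) * form b y (P.root i) < r * 2 := by linarith
    exact lt_of_mul_lt_mul_left h4 r.cast_nonneg
  rw [h1, smul_zero, add_zero] at h
  have h2 : w = 1 := by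
    refine eq_one_of_isPos hb w fun i hi => isPos_of_form_root_pos hx'.1 ?_
    rw [h, ← weylGroup_apply_root, form_smul_smul hb]
    exact form_root_pos hx.1 hi
  exact ⟨h2, by rw [h, h2, one_smul]⟩

/-- Take the shortest translate `z` of `x` by `r Λ^R`; it exists because norms of weights have a
common denominator. Then `|z - rα|² ≥ |z|²` says precisely `⟨z,α⟩ ≤ r`. -/
theorem exists_forall_form_root_le (hb : b.cartanMatrix.IsSimplyLaced) (hr : 0 < r) {x : V}
    (hx : x ∈ weightLattice b) :
    ∃ y ∈ rootLattice b, ∀ i, form b (x + (r : ℝ) • y) (P.root i) ≤ r := by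
  obtain ⟨d, hd, hd'⟩ := exists_smul_mem_rootLattice hb
  have hr' : (0 : ℝ) < r := by exact_mod_cast hr
  have hmem : ∀ y ∈ rootLattice b, x + (r : ℝ) • y ∈ weightLattice b := by
    intro y hy
    rw [Nat.cast_smul_eq_nsmul]
    exact add_mem hx (nsmul_mem (rootLattice_le_weightLattice hb hy) _)
  have hnat : ∀ z ∈ weightLattice b, ∃ n : ℕ, |(d : ℝ)| * form b z z = n := by
    intro z hz
    obtain ⟨n, hn⟩ := form_weight_rootLattice hb hz (hd' z hz)
    rw [← Int.cast_smul_eq_zsmul ℝ, map_smul, smul_eq_mul] at hn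
    have hpos : 0 ≤ form b z z := by
      rcases eq_or_ne z 0 with rfl | h
      · simp
      · exact (form_pos hb h).le
    refine ⟨n.natAbs, ?_⟩
    rw [Nat.cast_natAbs, Int.cast_abs, ← hn, abs_mul, abs_of_nonneg hpos]
  choose f hf using fun y : rootLattice b => hnat _ (hmem y y.2)
  obtain ⟨y, -, hy⟩ := (measure f).wf.has_min Set.univ ⟨0, trivial⟩
  refine ⟨y, y.2, fun i => ?_⟩
  have h1 : f y ≤ f (y - ⟨P.root i, root_mem_rootLattice i⟩) := not_lt.1 (hy _ trivial)
  have h2 : ((f y : ℕ) : ℝ) ≤ f (y - ⟨P.root i, root_mem_rootLattice i⟩) := by exact_mod_cast h1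
  rw [← hf, ← hf] at h2
  have h3 := le_of_mul_le_mul_left h2 (abs_pos.2 (by exact_mod_cast hd))
  set z := x + (r : ℝ) • (y : V) with hz
  have h4 : x + (r : ℝ) • ((y - ⟨P.root i, root_mem_rootLattice i⟩ : rootLattice b) : V) =
      z - (r : ℝ) • P.root i := by
    rw [hz, Submodule.coe_sub, smul_sub]
    abel
  rw [h4] at h3
  simp only [map_sub, map_smul, LinearMap.sub_apply, LinearMap.smul_apply, smul_eq_mul,
    form_root_self hb, form_symm hb (P.root i)] at h3
  have h5 : (r : ℝ) * form b z (P.root i) ≤ r * r := by linarith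
  exact le_of_mul_le_mul_left h5 hr'

/-- Maximize the pairing with the sum of the fundamental weights over the finite orbit; the simple
reflection `s_i` lowers it by `⟨w x, α_i⟩`, which is therefore nonnegative. -/
theorem exists_smul_mem_closedChamber (hb : b.cartanMatrix.IsSimplyLaced) (x : V) :
    ∃ w : P.weylGroup, w • x ∈ closedChamber b := by
  choose f hf using exists_isFundamentalWeight hb
  obtain ⟨w, hw⟩ := Finite.exists_max fun w : P.weylGroup => form b (w • x) (∑ i, f i)
  refine ⟨w, fun i => ?_⟩
  have h1 := hw (weylGroup.ofIdx P i * w)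
  have h2 : form b (P.root i) (∑ j, f j) = 1 := by
    rw [form_symm hb]
    simp [hf _ i]
  rw [mul_smul, ofIdx_smul_eq hb, map_sub, (form b).map_smul, LinearMap.sub_apply, LinearMap.smul_apply, h2,
    smul_eq_mul, mul_one] at h1
  linarith

theorem exists_smul_add_mem_alcove (hb : b.cartanMatrix.IsSimplyLaced) (hr : 0 < r) (θ : ι) {x : V}
    (hx : x ∈ weightLattice b) :
    ∃ w : P.weylGroup, ∃ y ∈ rootLattice b, w • x + (r : ℝ) • y ∈ alcove b θ r := by
  obtain ⟨y, hy, h1⟩ := exists_forall_form_root_le hb hr hx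
  obtain ⟨w, hw⟩ := exists_smul_mem_closedChamber hb (x + (r : ℝ) • y)
  refine ⟨w, w • y, smul_mem_rootLattice w hy, ?_⟩
  rw [← smul_comm w, ← smul_add]
  refine ⟨hw, ?_⟩
  -- The bound by `r` was obtained for all roots at once, so it survives the move into the chamber
  -- by `w`.
  rw [form_smul_left hb, weylGroup_apply_root]
  exact h1 _

theorem finite_alcove_inter_weightLattice (hb : b.cartanMatrix.IsSimplyLaced)
    (hθ : IsHighestRoot b θ) : (alcove b θ r ∩ (weightLattice b : Set V)).Finite := by
  have hfin : (Set.univ.pi fun _ : b.support => ((↑) : ℤ → ℝ) '' Set.Icc 0 (r : ℤ)).Finite :=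
    Set.Finite.pi fun _ => (Set.finite_Icc _ _).image _
  refine Set.Finite.of_injOn (f := fun x (j : b.support) => form b x (P.root j)) ?_ ?_ hfin
  · rintro x ⟨hx, hx'⟩ j -
    obtain ⟨z, hz⟩ := (mem_weightLattice_iff hb).1 hx' j
    have h1 := hx.1 j
    have h2 := (form_root_le hθ hx.1 j).trans hx.2
    simp only at h1 h2 ⊢
    rw [hz] at h1 h2 ⊢
    exact ⟨z, ⟨by exact_mod_cast h1, by exact_mod_cast h2⟩, rfl⟩
  · intro x _ y _ h
    exact eq_of_form_simple hb fun j => congrFun h j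

/-- A sum over the weights in the alcove of a function invariant under the affine Weyl group and
vanishing on the walls. -/
theorem card_mul_sum_alcove (hb : b.cartanMatrix.IsSimplyLaced) (hθ : IsHighestRoot b θ)
    (hr : 0 < r) {A : Finset V} (hA : ∀ x, x ∈ A ↔ x ∈ alcove b θ r ∩ (weightLattice b : Set V))
    {f : V → ℂ} (hfw : ∀ x ∈ weightLattice b, ∀ w : P.weylGroup, f (w • x) = f x)
    (hfr : ∀ x ∈ weightLattice b, ∀ y ∈ rootLattice b, f (x + (r : ℝ) • y) = f x)
    (hf0 : ∀ x ∈ weightLattice b, x ∈ alcove b θ r → f x ≠ 0 → x ∈ openAlcove b θ r)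
    {K : Type*} [Fintype K] {v : K → V} (hv : IsReps (weightLattice b) (rootLattice b) r v) :
    (Nat.card P.weylGroup : ℂ) * ∑ x ∈ A, f x = ∑ k, f (v k) := by
  have := Fintype.ofFinite P.weylGroup
  have h1 : (Nat.card P.weylGroup : ℂ) * ∑ x ∈ A, f x =
      ∑ p ∈ (Finset.univ : Finset P.weylGroup) ×ˢ A, f p.2 := by
    rw [Finset.sum_product]
    simp
  have hrep : ∀ p : P.weylGroup × V, ∀ _ : p.2 ∈ A, ∃ k, ∃ y ∈ rootLattice b,
      p.1 • p.2 = v k + (r : ℝ) • y := fun p hp => by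
    have := (hv.existsUnique _ (smul_mem_weightLattice hb p.1 ((hA _).1 hp).2)).exists
    simpa using this
  choose κ hκ using hrep
  rw [h1]
  -- A pair `(w, x)` goes to the class of `w x`. Where `f` vanishes this need not be injective, for
  -- instance on walls; on the support it is a bijection onto the classes where `f` is nonzero.
  refine Finset.sum_bij_ne_zero (fun p hp _ => κ p (Finset.mem_product.1 hp).2) (fun _ _ _ => Finset.mem_univ _) ?_ ?_ ?_
  · rintro ⟨w, x⟩ hp hp0 ⟨w', x'⟩ hp' hp0' h
    have hxA := (Finset.mem_product.1 hp).2
    have hxA' := (Finset.mem_product.1 hp').2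
    obtain ⟨y, hy, e1⟩ := hκ (w, x) hxA
    obtain ⟨y', hy', e2⟩ := hκ (w', x') hxA'
    rw [h] at e1
    simp only at e1 e2 hp0 hp0' hxA hxA'
    rw [hA] at hxA hxA'
    have e3 : x' = (w'⁻¹ * w) • x + (r : ℝ) • (w'⁻¹ • (y' - y)) := by
      rw [mul_smul, e1, ← smul_comm w'⁻¹, ← smul_add, eq_inv_smul_iff, e2, smul_sub]
      abel
    obtain ⟨e4, rfl⟩ := eq_one_of_smul_add_mem_openAlcove hb hθ (hf0 _ hxA.2 hxA.1 hp0)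
      (hf0 _ hxA'.2 hxA'.1 hp0') (smul_mem_rootLattice _ (sub_mem hy' hy)) e3
    rw [inv_mul_eq_one] at e4
    rw [e4]
  · intro k _ hk
    obtain ⟨w, y, hy, h2⟩ := exists_smul_add_mem_alcove hb hr θ (hv.mem k)
    have hwv := smul_mem_weightLattice hb w (hv.mem k)
    have h3 : w • v k + (r : ℝ) • y ∈ A := by
      refine (hA _).2 ⟨h2, ?_⟩
      rw [Nat.cast_smul_eq_nsmul]
      exact add_mem hwv (nsmul_mem (rootLattice_le_weightLattice hb hy) _)
    refine ⟨(w⁻¹, w • v k + (r : ℝ) • y), by simp [h3], ?_, ?_⟩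
    · simp only
      rwa [hfr _ hwv _ hy, hfw _ (hv.mem k)]
    · obtain ⟨y', hy', e1⟩ := hκ (w⁻¹, w • v k + (r : ℝ) • y) h3
      simp only [smul_add, inv_smul_smul] at e1
      refine (hv.existsUnique (v k) (hv.mem k)).unique
        ⟨y' - w⁻¹ • y, sub_mem hy' (smul_mem_rootLattice _ hy), ?_⟩ ⟨0, zero_mem _, by simp⟩
      rw [Int.cast_natCast, smul_sub, ← add_sub_assoc, ← e1, smul_comm w⁻¹]
      abel
  · rintro ⟨w, x⟩ hp _
    have hxA := (Finset.mem_product.1 hp).2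
    obtain ⟨y, hy, e1⟩ := hκ (w, x) hxA
    have hx := ((hA _).1 hxA).2
    rw [← hfr _ (hv.mem _) _ hy, ← e1, hfw _ hx]

end Alcoves

end SimplyLaced

end

/-! ### Alternating functions and the inductive step as a Gauss sum -/

noncomputable section

namespace SimplyLaced

section AlternatingSums

open RootPairing Complex

variable {ι V N : Type*} [AddCommGroup V] [Module ℝ V] [AddCommGroup N] [Module ℝ N]
  {P : RootPairing ι ℝ V N} [P.IsRootSystem] [P.IsCrystallographic] {b : P.Base}
  [Finite ι] [P.IsReduced] [FiniteDimensional ℝ V] {θ : ι} {r : ℕ}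

/-- The normalizing constant of `XiT`. -/
def xiConst (b : P.Base) (r : ℕ) : ℂ :=
  I ^ numPos b / (((r : ℝ) ^ ((rank b : ℝ) / 2) * vol b (rootLattice b) : ℝ) : ℂ)

/-- `F` is antisymmetric under the Weyl group and periodic modulo `r Λ^R` on the weight lattice. -/
structure IsAlternating (b : P.Base) (r : ℕ) (F : V → ℂ) : Prop where
  smul : ∀ x ∈ weightLattice b, ∀ w : P.weylGroup, F (w • x) = weylDet w * F x
  add : ∀ x ∈ weightLattice b, ∀ y ∈ rootLattice b, F (x + (r : ℝ) • y) = F x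

theorem exp_neg_two_pi_div_mul_add (hr : 0 < r) (x : ℝ) (z : ℤ) :
    exp (-(2 * Real.pi * I / r) * ((x + r * z : ℝ) : ℂ)) =
      exp (-(2 * Real.pi * I / r) * (x : ℂ)) := by
  have hr' : (r : ℂ) ≠ 0 := by exact_mod_cast hr.ne'
  have h : -(2 * Real.pi * I / r) * ((x + r * z : ℝ) : ℂ) =
      -(2 * Real.pi * I / r) * (x : ℂ) + (-z : ℤ) * (2 * Real.pi * I) := by
    push_cast
    field_simp
    ring
  rw [h, exp_add, exp_int_mul_two_pi_mul_I, mul_one]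

/-- The two covolumes are mutually inverse, so the square root of their ratio is `1 / vol(Λ^R)`. -/
theorem xiT_eq (hb : b.cartanMatrix.IsSimplyLaced) [Fintype P.weylGroup] (x y : V) :
    XiT b r x y = xiConst b r * ∑ w : P.weylGroup, (weylDet w : ℂ) *
      exp (-(2 * Real.pi * I / r) * (form b (w • x) y : ℝ)) := by
  have h1 : |vol b (weightLattice b) / vol b (rootLattice b)| ^ (1 / 2 : ℝ) =
      (vol b (rootLattice b))⁻¹ := by
    have h2 := vol_rootLattice_pos hb
    rw [eq_inv_of_mul_eq_one_left (vol_weightLattice_mul_vol_rootLattice hb), ← Real.sqrt_eq_rpow,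
      div_eq_mul_inv, abs_mul_self, Real.sqrt_mul_self (inv_pos.2 h2).le]
  rw [XiT, h1, finsum_eq_sum_of_fintype, xiConst]
  push_cast
  rw [← div_eq_mul_inv, div_div]

theorem xiT_smul_left (hb : b.cartanMatrix.IsSimplyLaced) (w : P.weylGroup) (x y : V) :
    XiT b r (w • x) y = weylDet w * XiT b r x y := by
  have := Fintype.ofFinite P.weylGroup
  rw [xiT_eq hb, xiT_eq hb, mul_left_comm, Finset.mul_sum (a := (weylDet w : ℂ))]
  congr 1
  refine Fintype.sum_equiv (Equiv.mulRight w) _ _ fun u => ?_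
  rw [Equiv.coe_mulRight, weylDet_mul, mul_smul, ← mul_assoc]
  congr 1
  rw [← ofReal_mul, mul_left_comm, weylDet_mul_self, mul_one]

theorem xiT_smul_right (hb : b.cartanMatrix.IsSimplyLaced) (w : P.weylGroup) (x y : V) :
    XiT b r x (w • y) = weylDet w * XiT b r x y := by
  have := Fintype.ofFinite P.weylGroup
  rw [xiT_eq hb, xiT_eq hb, mul_left_comm, Finset.mul_sum (a := (weylDet w : ℂ))]
  congr 1
  refine (Fintype.sum_equiv (Equiv.mulLeft w) _ _ fun u => ?_).symm
  rw [Equiv.coe_mulLeft, weylDet_mul, mul_smul, ← mul_assoc, form_smul_smul hb]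
  push_cast
  rfl

theorem xiT_add_left (hb : b.cartanMatrix.IsSimplyLaced) (hr : 0 < r) (x : V) {y z : V}
    (hy : y ∈ rootLattice b) (hz : z ∈ weightLattice b) :
    XiT b r (x + (r : ℝ) • y) z = XiT b r x z := by
  have := Fintype.ofFinite P.weylGroup
  rw [xiT_eq hb, xiT_eq hb]
  congr 1
  refine Finset.sum_congr rfl fun w _ => ?_
  obtain ⟨n, hn⟩ := form_weight_rootLattice hb hz (smul_mem_rootLattice w hy)
  rw [smul_add, smul_comm w, map_add, (form b).map_smul, LinearMap.add_apply, LinearMap.smul_apply,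
    form_symm hb (w • y), hn, smul_eq_mul, exp_neg_two_pi_div_mul_add hr]

theorem xiT_add_right (hb : b.cartanMatrix.IsSimplyLaced) (hr : 0 < r) {x : V} (z : V) {y : V}
    (hx : x ∈ weightLattice b) (hy : y ∈ rootLattice b) :
    XiT b r x (z + (r : ℝ) • y) = XiT b r x z := by
  have := Fintype.ofFinite P.weylGroup
  rw [xiT_eq hb, xiT_eq hb]
  congr 1
  refine Finset.sum_congr rfl fun w _ => ?_
  obtain ⟨n, hn⟩ := form_weight_rootLattice hb (smul_mem_weightLattice hb w hx) hy
  rw [map_add, (form b (w • x)).map_smul, hn, smul_eq_mul, exp_neg_two_pi_div_mul_add hr]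

theorem thetaT_smul (hb : b.cartanMatrix.IsSimplyLaced) (w : P.weylGroup) (x : V) :
    ThetaT b θ r (w • x) (w • x) = ThetaT b θ r x x := by
  rw [ThetaT, ThetaT, if_pos rfl, if_pos rfl, form_smul_smul hb]

/-- The change in `|x|²/r` is `2⟨x,y⟩ + r|y|²`, an even integer. -/
theorem thetaT_add (hb : b.cartanMatrix.IsSimplyLaced) (hr : 0 < r) {x y : V}
    (hx : x ∈ weightLattice b) (hy : y ∈ rootLattice b) :
    ThetaT b θ r (x + (r : ℝ) • y) (x + (r : ℝ) • y) = ThetaT b θ r x x := by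
  have hr' : (r : ℂ) ≠ 0 := by exact_mod_cast hr.ne'
  rw [ThetaT, ThetaT, if_pos rfl, if_pos rfl, exp_sub, exp_sub]
  congr 1
  obtain ⟨n, hn⟩ := form_weight_rootLattice hb hx hy
  obtain ⟨p, hp⟩ := form_rootLattice_even hb hy
  have h : Real.pi * I / r * ((form b (x + (r : ℝ) • y) (x + (r : ℝ) • y) : ℝ) : ℂ) =
      Real.pi * I / r * ((form b x x : ℝ) : ℂ) + (n + r * p : ℤ) * (2 * Real.pi * I) := by
    simp only [map_add, map_smul, LinearMap.add_apply, LinearMap.smul_apply, smul_eq_mul, hn, hp,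
      form_symm hb y x]
    push_cast
    field_simp
    ring
  rw [h, exp_add, exp_int_mul_two_pi_mul_I, mul_one]

theorem isAlternating_xiT (hb : b.cartanMatrix.IsSimplyLaced) (hr : 0 < r) {z : V}
    (hz : z ∈ weightLattice b) : IsAlternating b r fun x => XiT b r x z where
  smul x _ w := xiT_smul_left hb w x z
  add x _ _ hy := xiT_add_left hb hr x hy hz

theorem IsAlternating.thetaT_zpow_mul (hb : b.cartanMatrix.IsSimplyLaced) (hr : 0 < r) {F : V → ℂ}
    (hF : IsAlternating b r F) (n : ℤ) :
    IsAlternating b r fun x => ThetaT b θ r x x ^ n * F x where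
  smul x hx w := by rw [thetaT_smul hb, hF.smul x hx]; ring
  add x hx y hy := by rw [thetaT_add hb hr hx hy, hF.add x hx y hy]

/-- On a wall a reflection of determinant `-1` does not change the value: simple reflections fix
their walls, and on the upper wall `s_θ` translates by the period `-rθ`. -/
theorem IsAlternating.mem_openAlcove (hb : b.cartanMatrix.IsSimplyLaced) {F : V → ℂ}
    (hF : IsAlternating b r F) {x : V} (hx : x ∈ weightLattice b) (hx' : x ∈ alcove b θ r)
    (h : F x ≠ 0) : x ∈ openAlcove b θ r := by
  have h0 : F x ≠ -F x := fun h1 => h (self_eq_neg.1 h1)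
  refine ⟨fun i => lt_of_le_of_ne (hx'.1 i) fun h1 => h0 ?_, lt_of_le_of_ne hx'.2 fun h1 => h0 ?_⟩
  · have h2 := hF.smul x hx (weylGroup.ofIdx P i)
    rw [ofIdx_smul_eq hb, ← h1, weylDet_ofIdx] at h2
    simpa using h2
  · have h2 := hF.smul x hx (weylGroup.ofIdx P θ)
    have h3 : x - form b x (P.root θ) • P.root θ = x + (r : ℝ) • -P.root θ := by
      rw [h1, smul_neg, sub_eq_add_neg]
    rw [ofIdx_smul_eq hb, h3, hF.add x hx _ (neg_mem (root_mem_rootLattice θ)), weylDet_ofIdx] at h2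
    simpa using h2

/-- Pass to class representatives modulo `r Λ^R`. In the term of `XiT` indexed by `w`, substitute
`w⁻¹ x` for `x`: the two signs cancel, all terms agree, and their number cancels the `|W|` from
unfolding the alcove. -/
theorem sum_xiT_mul (hb : b.cartanMatrix.IsSimplyLaced) (hθ : IsHighestRoot b θ) (hr : 0 < r)
    {A : Finset V} (hA : ∀ x, x ∈ A ↔ x ∈ alcove b θ r ∩ (weightLattice b : Set V))
    {G : V → ℂ} (hG : IsAlternating b r G) {ν : V} (hν : ν ∈ weightLattice b)
    {K : Type*} [Fintype K] {v : K → V} (hv : IsReps (weightLattice b) (rootLattice b) r v) :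
    ∑ x ∈ A, XiT b r ν x * G x =
      xiConst b r * ∑ k, exp (-(2 * Real.pi * I / r) * (form b ν (v k) : ℝ)) * G (v k) := by
  have := Fintype.ofFinite P.weylGroup
  have hdet : ∀ w : P.weylGroup, (weylDet w : ℂ) * weylDet w = 1 := fun w => by
    exact_mod_cast weylDet_mul_self w
  have h1 := card_mul_sum_alcove hb hθ hr hA (f := fun x => XiT b r ν x * G x)
    (fun x hx w => by
      rw [xiT_smul_right hb, hG.smul x hx, mul_mul_mul_comm, hdet, one_mul])
    (fun x hx y hy => by rw [xiT_add_right hb hr x hν hy, hG.add x hx y hy])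
    (fun x hx hx' h => hG.mem_openAlcove hb hx hx' (right_ne_zero_of_mul h)) hv
  have h2 : ∀ w : P.weylGroup,
      ∑ k, weylDet w * exp (-(2 * Real.pi * I / r) * (form b (w • ν) (v k) : ℝ)) * G (v k) =
        ∑ k, exp (-(2 * Real.pi * I / r) * (form b ν (v k) : ℝ)) * G (v k) := by
    intro w
    rw [← (hv.smul hb w⁻¹).sum_eq hv
      fun x => exp (-(2 * Real.pi * I / r) * (form b ν x : ℝ)) * G x]
    · refine Finset.sum_congr rfl fun k _ => ?_
      have h3 := hG.smul _ (smul_mem_weightLattice hb w⁻¹ (hv.mem k)) w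
      rw [smul_inv_smul] at h3
      rw [h3, form_smul_left hb, mul_right_comm, ← mul_assoc, hdet, one_mul, mul_comm]
    · intro x hx y hy
      obtain ⟨n, hn⟩ := form_weight_rootLattice hb hν hy
      rw [Int.cast_natCast, hG.add x hx y hy, map_add, map_smul, smul_eq_mul, hn,
        exp_neg_two_pi_div_mul_add hr]
  have h4 : ∑ k, XiT b r ν (v k) * G (v k) = (Nat.card P.weylGroup : ℂ) *
      (xiConst b r * ∑ k, exp (-(2 * Real.pi * I / r) * (form b ν (v k) : ℝ)) * G (v k)) := by
    simp only [xiT_eq hb, mul_assoc, ← Finset.mul_sum, Finset.sum_mul]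
    rw [Finset.sum_comm]
    simp only [← mul_assoc, h2]
    rw [Finset.sum_const, nsmul_eq_mul, Finset.card_univ, ← Nat.card_eq_fintype_card]
    ring
  rw [h4] at h1
  exact mul_left_cancel₀ (by exact_mod_cast Nat.card_pos.ne') h1

/-- All exponents combine into one: the quadratic coefficient is `n/r - c/(a r) = a'/(a r)` and the
linear part is the pairing with `ξ w`. Reciprocity with modulus `a r` and numerator `a'` then
applies for each `w`. -/
theorem sum_xiT_mul_thetaT_mul (hb : b.cartanMatrix.IsSimplyLaced) (hθ : IsHighestRoot b θ)
    (hr : 0 < r) {A : Finset V}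
    (hA : ∀ x, x ∈ A ↔ x ∈ alcove b θ r ∩ (weightLattice b : Set V))
    {F : V → ℂ} (hF : IsAlternating b r F) {lam ν : V} (hlam : lam ∈ weightLattice b)
    (hν : ν ∈ weightLattice b) {a a' c n : ℤ} (ha : a ≠ 0) (ha' : a' ≠ 0) (h : a' = n * a - c)
    {K K' : Type*} [Fintype K] [Fintype K'] [Fintype P.weylGroup] {s : K → V}
    (hs : IsReps (rootLattice b) (rootLattice b) a s) {s' : K' → V}
    (hs' : IsReps (rootLattice b) (rootLattice b) a' s') {J : ℂ}
    (hFJ : ∀ x ∈ weightLattice b, F x = J * ∑ w : P.weylGroup, weylDet w * ∑ q,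
      exp (-(Real.pi * I * c / (a * r)) * (form b (x + (r : ℝ) • s q) (x + (r : ℝ) • s q) : ℝ) -
        2 * Real.pi * I / (a * r) * (form b (x + (r : ℝ) • s q) (w • lam) : ℝ))) :
    ∑ x ∈ A, XiT b r ν x * (ThetaT b θ r x x ^ n * F x) =
      xiConst b r * J * (vol b (rootLattice b) * |(a * r : ℝ) / a'| ^ ((rank b : ℝ) / 2) : ℝ) *
        exp (Real.pi * I / 4) ^ ((rank b : ℤ) * Int.sign (a * a')) *
        exp (-(Real.pi * I / (coxeterNumber b θ : ℂ)) * n * (normSq b (rho b) : ℝ)) *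
        ∑ w : P.weylGroup, weylDet w * ∑ q, exp (-(Real.pi * I * a / (a' * r)) *
          (normSq b (ν + (r : ℝ) • s' q + (a : ℝ)⁻¹ • (w • lam)) : ℝ)) := by
  have hrZ : (r : ℤ) ≠ 0 := by exact_mod_cast hr.ne'
  have hrR : (r : ℝ) ≠ 0 := by exact_mod_cast hr.ne'
  have hrC : (r : ℂ) ≠ 0 := by exact_mod_cast hr.ne'
  have haR : (a : ℝ) ≠ 0 := by exact_mod_cast ha
  have haC : (a : ℂ) ≠ 0 := by exact_mod_cast ha
  have haC' : (a' : ℂ) ≠ 0 := by exact_mod_cast ha'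
  obtain ⟨k, v, hv⟩ := exists_isReps hb hrZ
  rw [sum_xiT_mul hb hθ hr hA (hF.thetaT_zpow_mul hb hr n) hν hv]
  have hvs := hv.trans (rootLattice_le_weightLattice hb) hrZ hs
  set ξ : P.weylGroup → V := fun w => (r : ℝ)⁻¹ • (ν + (a : ℝ)⁻¹ • (w • lam)) with hξ
  have h1 : ∀ (w : P.weylGroup) (x : V),
      exp (-(2 * Real.pi * I / r) * (form b ν x : ℝ)) * (ThetaT b θ r x x ^ n *
        exp (-(Real.pi * I * c / (a * r)) * (form b x x : ℝ) -
          2 * Real.pi * I / (a * r) * (form b x (w • lam) : ℝ))) =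
      exp (-(Real.pi * I / (coxeterNumber b θ : ℂ)) * n * (normSq b (rho b) : ℝ)) *
        exp (Real.pi * I * (a' / (a * r : ℤ)) * (form b x x : ℝ) -
          2 * Real.pi * I * (form b (ξ w) x : ℝ)) := by
    intro w x
    rw [ThetaT, if_pos rfl, ← exp_int_mul, ← exp_add, ← exp_add, ← exp_add, normSq, hξ, h]
    congr 1
    simp only [map_add, (form b).map_smul, LinearMap.add_apply, LinearMap.smul_apply, smul_eq_mul,
      form_symm hb x (w • lam)]
    push_cast
    field_simp
    ring
  -- The factors besides the Gaussian are periodic modulo `r Λ^R`, so they may be evaluated at `v k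
  -- + r s q`; the double sum then depends on this one point.
  have h2 : ∀ k q, exp (-(2 * Real.pi * I / r) * (form b ν (v k) : ℝ)) =
      exp (-(2 * Real.pi * I / r) * (form b ν (v k + (r : ℝ) • s q) : ℝ)) := by
    intro k q
    obtain ⟨z, hz⟩ := form_weight_rootLattice hb hν (hs.mem q)
    rw [map_add, map_smul, hz, smul_eq_mul, exp_neg_two_pi_div_mul_add hr]
  have h3 : ∀ k q, ThetaT b θ r (v k) (v k) =
      ThetaT b θ r (v k + (r : ℝ) • s q) (v k + (r : ℝ) • s q) := fun k q =>
    (thetaT_add hb hr (hv.mem k) (hs.mem q)).symm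
  have h4 : ∀ w, ∑ p : Fin k × K, exp (Real.pi * I * (a' / (a * r : ℤ)) *
        (form b (v p.1 + (r : ℝ) • s p.2) (v p.1 + (r : ℝ) • s p.2) : ℝ) -
          2 * Real.pi * I * (form b (ξ w) (v p.1 + (r : ℝ) • s p.2) : ℝ)) =
      (vol b (rootLattice b) * |(a * r : ℝ) / a'| ^ ((rank b : ℝ) / 2) : ℝ) *
        exp (Real.pi * I / 4) ^ ((rank b : ℤ) * Int.sign (a * a')) *
        ∑ q, exp (-(Real.pi * I * a / (a' * r)) *
          (normSq b (ν + (r : ℝ) • s' q + (a : ℝ)⁻¹ • (w • lam)) : ℝ)) := by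
    intro w
    have hmem : ((a * r : ℤ) : ℝ) • ξ w ∈ weightLattice b := by
      have : ((a * r : ℤ) : ℝ) • ξ w = a • ν + w • lam := by
        rw [hξ, smul_smul, smul_add, smul_smul, ← Int.cast_smul_eq_zsmul ℝ]
        push_cast
        rw [mul_inv_cancel_right₀ hrR, mul_inv_cancel₀ haR, one_smul]
      rw [this]
      exact add_mem (Submodule.smul_mem _ _ hν) (smul_mem_weightLattice hb w hlam)
    have h5 := gauss_reciprocity hb (mul_ne_zero ha hrZ) ha' hmem hvs hs'
    simp only [Int.cast_natCast] at h5
    rw [h5]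
    have h6 : Int.sign (a * r * a') = Int.sign (a * a') := by
      rw [mul_right_comm, Int.sign_mul, Int.sign_natCast_of_ne_zero hr.ne', mul_one]
    rw [h6]
    push_cast
    congr 1
    refine Finset.sum_congr rfl fun q _ => ?_
    congr 1
    -- Extracting `r` from the norm turns the coefficient `a r / a'` given by reciprocity into `a /
    -- (a' r)`.
    have h7 : ν + (r : ℝ) • s' q + (a : ℝ)⁻¹ • (w • lam) = (r : ℝ) • (s' q + ξ w) := by
      rw [hξ, smul_add, smul_smul, mul_inv_cancel₀ hrR, one_smul]
      abel
    rw [h7, normSq, map_smul, (form b).map_smul, LinearMap.smul_apply, smul_eq_mul, smul_eq_mul]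
    push_cast
    field_simp
  calc _ = xiConst b r * ∑ k, ∑ w : P.weylGroup, ∑ q, J * (weylDet w *
        (exp (-(Real.pi * I / (coxeterNumber b θ : ℂ)) * n * (normSq b (rho b) : ℝ)) *
        exp (Real.pi * I * (a' / (a * r : ℤ)) *
          (form b (v k + (r : ℝ) • s q) (v k + (r : ℝ) • s q) : ℝ) -
          2 * Real.pi * I * (form b (ξ w) (v k + (r : ℝ) • s q) : ℝ)))) := by
        congr 1
        refine Finset.sum_congr rfl fun k _ => ?_
        simp only [hFJ _ (hv.mem k), Finset.mul_sum]
        refine Finset.sum_congr rfl fun w _ => Finset.sum_congr rfl fun q _ => ?_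
        rw [← h1, ← h2, ← h3]
        ring
    _ = xiConst b r * ∑ w : P.weylGroup, J * (weylDet w *
        (exp (-(Real.pi * I / (coxeterNumber b θ : ℂ)) * n * (normSq b (rho b) : ℝ)) *
        ∑ p : Fin k × K, exp (Real.pi * I * (a' / (a * r : ℤ)) *
        (form b (v p.1 + (r : ℝ) • s p.2) (v p.1 + (r : ℝ) • s p.2) : ℝ) -
          2 * Real.pi * I * (form b (ξ w) (v p.1 + (r : ℝ) • s p.2) : ℝ)))) := by
        rw [Finset.sum_comm]
        simp only [Finset.mul_sum, Fintype.sum_prod_type]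
    _ = _ := by
        simp only [h4, Finset.mul_sum]
        refine Finset.sum_congr rfl fun w _ => Finset.sum_congr rfl fun q _ => ?_
        ring

end AlternatingSums

end SimplyLaced

end

/-! ### Recursion in the length of the sequence and tracking of the constants -/

noncomputable section

namespace SimplyLaced

section Recursion

open RootPairing Complex

theorem a_zero (m : ℕ → ℤ) : a m 0 = 1 := by simp [a, B]

theorem c_zero (m : ℕ → ℤ) : c m 0 = 0 := by simp [c, B]

theorem a_succ (m : ℕ → ℤ) (t : ℕ) : a m (t + 1) = m (t + 1) * a m t - c m t := by
  simp [a, c, B, ModularGroup.coe_T_zpow, ModularGroup.coe_S, Matrix.mul_apply, Fin.sum_univ_two]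
  ring

theorem c_succ (m : ℕ → ℤ) (t : ℕ) : c m (t + 1) = a m t := by
  simp [a, c, B, ModularGroup.coe_T_zpow, ModularGroup.coe_S, Matrix.mul_apply, Fin.sum_univ_two]

variable {ι V N : Type*} [AddCommGroup V] [Module ℝ V] [AddCommGroup N] [Module ℝ N]
  {P : RootPairing ι ℝ V N} [P.IsRootSystem] [P.IsCrystallographic] {b : P.Base}
  [Finite ι] [P.IsReduced] [FiniteDimensional ℝ V] {θ : ι} {r : ℕ}

theorem paths_zero (x y : V) : paths b θ r 0 x y = {![x, y]} := by
  ext p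
  simp only [paths, Set.mem_ofPred_eq, IsEmpty.forall_iff, and_true, Set.mem_singleton_iff]
  constructor
  · rintro ⟨h0, h1⟩
    ext i
    fin_cases i
    · exact h0
    · exact h1
  · rintro rfl
    exact ⟨rfl, rfl⟩

theorem paths_succ (t : ℕ) (x y : V) {A : Finset V}
    (hA : ∀ x, x ∈ A ↔ x ∈ alcove b θ r ∩ (weightLattice b : Set V)) :
    paths b θ r (t + 1) x y =
      ⋃ z ∈ (A : Set V), (fun p => Fin.snoc (α := fun _ => V) p y) '' paths b θ r t x z := by
  ext p
  simp only [Set.mem_iUnion, Set.mem_image, exists_prop, Finset.mem_coe]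
  constructor
  · rintro ⟨h0, h1, h2⟩
    refine ⟨p (Fin.last (t + 1)).castSucc, (hA _).2 (h2 (Fin.last t)), Fin.init p,
      ⟨h0, rfl, fun k => h2 k.castSucc⟩, ?_⟩
    rw [← h1]
    exact Fin.snoc_init_self p
  · rintro ⟨z, hz, p, ⟨h0, h1, h2⟩, rfl⟩
    refine ⟨?_, ?_, fun k => ?_⟩
    · rw [← h0, ← Fin.castSucc_zero, Fin.snoc_castSucc]
    · simp
    · rw [Fin.snoc_castSucc]
      induction k using Fin.lastCases with
      | last =>
        rw [Fin.succ_last, h1]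
        exact (hA _).1 hz
      | cast k =>
        exact h2 k

theorem exists_finset_alcove (hb : b.cartanMatrix.IsSimplyLaced) (hθ : IsHighestRoot b θ) (r : ℕ) :
    ∃ A : Finset V, ∀ x, x ∈ A ↔ x ∈ alcove b θ r ∩ (weightLattice b : Set V) :=
  ⟨(finite_alcove_inter_weightLattice hb hθ).toFinset, fun _ => Set.Finite.mem_toFinset _⟩

theorem finite_paths (hb : b.cartanMatrix.IsSimplyLaced) (hθ : IsHighestRoot b θ) (t : ℕ)
    (x y : V) : (paths b θ r t x y).Finite := by
  induction t generalizing y with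
  | zero => rw [paths_zero]; exact Set.finite_singleton _
  | succ t ih =>
    obtain ⟨A, hA⟩ := exists_finset_alcove hb hθ r
    rw [paths_succ t x y hA]
    exact Set.Finite.biUnion (Finset.finite_toSet _) fun z _ => (ih z).image _

theorem tSum_zero (m : ℕ → ℤ) (x y : V) : TSum b θ r 0 m x y = XiT b r y x := by
  rw [TSum, paths_zero, finsum_mem_singleton]
  simp

theorem tSum_succ (hb : b.cartanMatrix.IsSimplyLaced) (hθ : IsHighestRoot b θ) (t : ℕ)
    (m : ℕ → ℤ) (x y : V) {A : Finset V}
    (hA : ∀ x, x ∈ A ↔ x ∈ alcove b θ r ∩ (weightLattice b : Set V)) :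
    TSum b θ r (t + 1) m x y =
      ∑ z ∈ A, XiT b r y z * (ThetaT b θ r z z ^ m (t + 1) * TSum b θ r t m x z) := by
  have hinj : ∀ p q : Fin (t + 2) → V, Fin.snoc (α := fun _ => V) p y = Fin.snoc q y → p = q :=
    fun p q h => (Fin.snoc_injective2 h).1
  rw [TSum, paths_succ t x y hA, finsum_mem_biUnion, finsum_mem_coe_finset]
  · refine Finset.sum_congr rfl fun z _ => ?_
    rw [finsum_mem_image fun p _ q _ h => hinj p q h, TSum, mul_finsum_mem' _ _ (finite_paths hb hθ t x z),
      mul_finsum_mem' _ _ (finite_paths hb hθ t x z)]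
    refine finsum_mem_congr rfl fun p hp => ?_
    have hlast : p (Fin.last (t + 1)) = z := hp.2.1
    rw [Fin.prod_univ_castSucc (n := t + 1), Fin.prod_univ_castSucc (n := t) fun k =>
      ThetaT b θ r (Fin.snoc (α := fun _ => V) p y k.succ.castSucc)
        (Fin.snoc (α := fun _ => V) p y k.succ.castSucc) ^ m ((k : ℕ) + 1)]
    simp only [Fin.succ_last, Fin.snoc_last, Fin.snoc_castSucc, hlast, Fin.succ_castSucc,
      Fin.val_last, Fin.val_castSucc]
    ring
  · intro z _ z' _ hzz'
    refine Set.disjoint_left.2 ?_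
    rintro _ ⟨p, hp, rfl⟩ ⟨q, hq, h⟩
    refine hzz' ?_
    rw [← hp.2.1, ← hq.2.1, hinj _ _ h]
  · exact Finset.finite_toSet A
  · exact fun z _ => (finite_paths hb hθ t x z).image _

/-- The last weight enters only through the outermost `XiT`, so its symmetry passes to the whole
sum. -/
theorem isAlternating_tSum (hb : b.cartanMatrix.IsSimplyLaced) (hθ : IsHighestRoot b θ)
    (hr : 0 < r) (t : ℕ) (m : ℕ → ℤ) {x : V} (hx : x ∈ weightLattice b) :
    IsAlternating b r (TSum b θ r t m x) := by
  rcases t with _ | t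
  · simpa only [← tSum_zero (θ := θ) m] using isAlternating_xiT hb hr hx
  · obtain ⟨A, hA⟩ := exists_finset_alcove hb hθ r
    refine ⟨fun y _ w => ?_, fun y _ z hz => ?_⟩
    · rw [tSum_succ hb hθ t m x _ hA, tSum_succ hb hθ t m x _ hA, Finset.mul_sum]
      exact Finset.sum_congr rfl fun u _ => by rw [xiT_smul_left hb, mul_assoc]
    · rw [tSum_succ hb hθ t m x _ hA, tSum_succ hb hθ t m x _ hA]
      exact Finset.sum_congr rfl fun u hu => by
        rw [xiT_add_left hb hr y hz ((hA u).1 hu).2]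

/-- The constant in front of the sum of Gaussian exponentials with the square not completed. -/
def gaussConst (b : P.Base) (θ : ι) (r t : ℕ) (m : ℕ → ℤ) (lam : V) : ℂ :=
  I ^ ((t + 1) * numPos b) /
      (((r * |(a m t : ℝ)|) ^ ((rank b : ℝ) / 2) * vol b (rootLattice b) : ℝ) : ℂ) *
    exp (Real.pi * I / 4) ^ ((rank b : ℤ) * D m t) *
    exp (-(Real.pi * I / (coxeterNumber b θ : ℂ)) *
      (∑ i ∈ Finset.Icc 1 t, (m i : ℂ)) * (normSq b (rho b) : ℝ)) *
    exp (-(Real.pi * I / r) *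
      (∑ i ∈ Finset.Ico 1 (t + 1), 1 / ((a m (i - 1) : ℂ) * (a m i : ℂ))) * (normSq b lam : ℝ))

theorem gaussConst_zero (m : ℕ → ℤ) (lam : V) : gaussConst b θ r 0 m lam = xiConst b r := by
  simp [gaussConst, xiConst, a_zero, D]

/-- The extra factor is the term `|λ|²/c²` of the multiplied-out square, with `c_{t+1} = a_t`; it is
the next summand in the exponent of the constant. -/
theorem gaussConst_succ (t : ℕ) (m : ℕ → ℤ) (lam : V) :
    gaussConst b θ r (t + 1) m lam = K b θ r (t + 1) m lam *
      exp (-(Real.pi * I / r) * (1 / ((a m t : ℂ) * (a m (t + 1) : ℂ))) * (normSq b lam : ℝ)) := by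
  have h : ∀ x y z w : ℂ, exp (x * (y + z) * w) = exp (x * y * w) * exp (x * z * w) := by
    intro x y z w
    rw [mul_add, add_mul, exp_add]
  rw [gaussConst, K, Finset.sum_Ico_succ_top (b := t + 1) (by lia), h, ← mul_assoc,
    Nat.add_sub_cancel]

/-- The factor `(r |a_t|)^{l/2}` from reciprocity cancels the old denominator, its `r^{l/2}` cancels
that of `XiT`, and one of the two volumes cancels; `D` and the sum of the `m i` each gain a term. -/
theorem K_succ (hb : b.cartanMatrix.IsSimplyLaced) (hr : 0 < r) (t : ℕ) (m : ℕ → ℤ) (lam : V)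
    (ha : a m t ≠ 0) (ha' : a m (t + 1) ≠ 0) :
    xiConst b r * gaussConst b θ r t m lam * (vol b (rootLattice b) *
      |(a m t * r : ℝ) / a m (t + 1)| ^ ((rank b : ℝ) / 2) : ℝ) *
        exp (Real.pi * I / 4) ^ ((rank b : ℤ) * Int.sign (a m t * a m (t + 1))) *
        exp (-(Real.pi * I / (coxeterNumber b θ : ℂ)) * m (t + 1) * (normSq b (rho b) : ℝ)) =
      K b θ r (t + 1) m lam := by
  have hr' : (0 : ℝ) < r := by exact_mod_cast hr
  have hv := vol_rootLattice_pos hb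
  have ha1 : 0 < |(a m t : ℝ)| := abs_pos.2 (by exact_mod_cast ha)
  have ha2 : 0 < |(a m (t + 1) : ℝ)| := abs_pos.2 (by exact_mod_cast ha')
  have h1 : |(a m t * r : ℝ) / a m (t + 1)| ^ ((rank b : ℝ) / 2) =
      (r * |(a m t : ℝ)|) ^ ((rank b : ℝ) / 2) * (r : ℝ) ^ ((rank b : ℝ) / 2) /
        (r * |(a m (t + 1) : ℝ)|) ^ ((rank b : ℝ) / 2) := by
    rw [abs_div, abs_mul, abs_of_pos hr', ← Real.mul_rpow (by positivity) (by positivity),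
      ← Real.div_rpow (by positivity) (by positivity)]
    congr 1
    field_simp
  have h2 : D m (t + 1) = D m t + Int.sign (a m t * a m (t + 1)) := by
    rw [D, Finset.sum_Icc_succ_top (by lia)]
    rfl
  have h3 : exp (-(Real.pi * I / (coxeterNumber b θ : ℂ)) *
      (∑ i ∈ Finset.Icc 1 (t + 1), (m i : ℂ)) * (normSq b (rho b) : ℝ)) =
      exp (-(Real.pi * I / (coxeterNumber b θ : ℂ)) *
        (∑ i ∈ Finset.Icc 1 t, (m i : ℂ)) * (normSq b (rho b) : ℝ)) *
      exp (-(Real.pi * I / (coxeterNumber b θ : ℂ)) * m (t + 1) * (normSq b (rho b) : ℝ)) := by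
    rw [← exp_add, Finset.sum_Icc_succ_top (by lia)]
    congr 1
    ring
  have p1 : ((((r : ℝ) ^ ((rank b : ℝ) / 2) : ℝ)) : ℂ) ≠ 0 := by
    exact_mod_cast (Real.rpow_pos_of_pos hr' _).ne'
  have p2 : (((r * |(a m t : ℝ)|) ^ ((rank b : ℝ) / 2) : ℝ) : ℂ) ≠ 0 := by
    exact_mod_cast (Real.rpow_pos_of_pos (by positivity) _).ne'
  have p3 : (((r * |(a m (t + 1) : ℝ)|) ^ ((rank b : ℝ) / 2) : ℝ) : ℂ) ≠ 0 := by
    exact_mod_cast (Real.rpow_pos_of_pos (by positivity) _).ne'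
  have p4 : ((vol b (rootLattice b) : ℝ) : ℂ) ≠ 0 := by exact_mod_cast hv.ne'
  rw [K, h1, h2, h3, mul_add, zpow_add₀ (exp_ne_zero _), gaussConst, xiConst, add_mul (t + 1) 1,
    one_mul, pow_add]
  simp only [ofReal_mul, ofReal_div]
  field_simp

theorem exp_normSq_add (hb : b.cartanMatrix.IsSimplyLaced) (hr : 0 < r) {a c : ℤ} (ha : a ≠ 0)
    (hc : c ≠ 0) (x lam : V) (w : P.weylGroup) :
    exp (-(Real.pi * I * c / (a * r)) * (normSq b (x + (c : ℝ)⁻¹ • (w • lam)) : ℝ)) =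
      exp (-(Real.pi * I / r) * (1 / ((c : ℂ) * a)) * (normSq b lam : ℝ)) *
        exp (-(Real.pi * I * c / (a * r)) * (form b x x : ℝ) -
          2 * Real.pi * I / (a * r) * (form b x (w • lam) : ℝ)) := by
  have hrC : (r : ℂ) ≠ 0 := by exact_mod_cast hr.ne'
  have haC : (a : ℂ) ≠ 0 := by exact_mod_cast ha
  have hcC : (c : ℂ) ≠ 0 := by exact_mod_cast hc
  rw [← exp_add]
  congr 1
  simp only [normSq, map_add, (form b).map_smul, (form b x).map_smul,
    (form b (w • lam)).map_smul, LinearMap.add_apply, LinearMap.smul_apply, smul_eq_mul,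
    form_symm hb (w • lam) x, form_smul_smul hb]
  push_cast
  field_simp
  ring

/-- Takes the formula with the square multiplied out and returns it with the square completed. The
input makes sense at `t = 0`, where `c_0 = 0`; in the output the divisor is `c_{t+1} = a_t ≠ 0`. -/
theorem tSum_succ_eq_of_gaussConst (hb : b.cartanMatrix.IsSimplyLaced) (hθ : IsHighestRoot b θ)
    (hr : 0 < r) (t : ℕ) (m : ℕ → ℤ) {lam ν : V} (hlam : lam ∈ weightLattice b)
    (hν : ν ∈ weightLattice b) (ha : a m t ≠ 0) (ha' : a m (t + 1) ≠ 0)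
    {K₁ K₂ : Type*} [Fintype K₁] [Fintype K₂] [Fintype P.weylGroup] {s : K₁ → V}
    (hs : IsReps (rootLattice b) (rootLattice b) (a m t) s) {s' : K₂ → V}
    (hs' : IsReps (rootLattice b) (rootLattice b) (a m (t + 1)) s')
    (hF : ∀ x ∈ weightLattice b, TSum b θ r t m lam x =
      gaussConst b θ r t m lam * ∑ w : P.weylGroup, weylDet w * ∑ q,
      exp (-(Real.pi * I * c m t / (a m t * r)) *
        (form b (x + (r : ℝ) • s q) (x + (r : ℝ) • s q) : ℝ) -
        2 * Real.pi * I / (a m t * r) * (form b (x + (r : ℝ) • s q) (w • lam) : ℝ))) :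
    TSum b θ r (t + 1) m lam ν = K b θ r (t + 1) m lam * ∑ w : P.weylGroup, weylDet w * ∑ q,
      exp (-(Real.pi * I * c m (t + 1) / (a m (t + 1) * r)) *
        (normSq b (ν + (r : ℝ) • s' q + (c m (t + 1) : ℝ)⁻¹ • (w • lam)) : ℝ)) := by
  obtain ⟨A, hA⟩ := exists_finset_alcove hb hθ r
  rw [tSum_succ hb hθ t m lam ν hA, sum_xiT_mul_thetaT_mul hb hθ hr hA
    (isAlternating_tSum hb hθ hr t m hlam) hlam hν ha ha' (a_succ m t) hs hs' hF,
    K_succ hb hr t m lam ha ha', c_succ]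

theorem isReps_one : IsReps (rootLattice b) (rootLattice b) 1 fun _ : Unit => (0 : V) where
  mem _ := zero_mem _
  existsUnique x hx := ⟨(), ⟨x, hx, by simp⟩, fun _ _ => rfl⟩

theorem weylDet_inv (w : P.weylGroup) : weylDet w⁻¹ = weylDet w := by
  have h := weylDet_mul w⁻¹ w
  rw [inv_mul_cancel, weylDet_one] at h
  rw [← mul_one (weylDet w⁻¹), ← weylDet_mul_self w, ← mul_assoc, ← h, one_mul]

/-- Pair with the sum of the fundamental weights, which is strictly dominant: if `-θ` were positive,
it would pair strictly more than `θ`, against maximality. -/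
theorem IsHighestRoot.isPos (hb : b.cartanMatrix.IsSimplyLaced) (hθ : IsHighestRoot b θ) :
    b.IsPos θ := by
  choose f hf using exists_isFundamentalWeight hb
  have h1 : ∀ i : b.support, 0 < form b (∑ j, f j) (P.root i) := fun i => by simp [hf _ i]
  by_contra h
  have h2 := form_root_pos h1 ((Base.IsPos.neg_iff_not b θ).2 h)
  have h3 := form_root_le hθ (fun i => (h1 i).le) (P.reflectionPerm θ θ)
  rw [indexNeg_neg] at h2
  rw [root_reflectionPerm_self, map_neg] at h2 h3
  linarith

theorem tSum_eq (hb : b.cartanMatrix.IsSimplyLaced) (hθ : IsHighestRoot b θ) (hr : 0 < r)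
    (m : ℕ → ℤ) {lam : V} (hlam : lam ∈ weightLattice b) (t : ℕ)
    (ha : ∀ k ∈ Finset.Icc 1 (t + 1), a m k ≠ 0) {ν : V} (hν : ν ∈ weightLattice b)
    (s : ModN (rootLattice b) (a m (t + 1)) → rootLattice b)
    (hs : ∀ q, Submodule.Quotient.mk (s q) = q) :
    TSum b θ r (t + 1) m lam ν = K b θ r (t + 1) m lam *
      ∑ᶠ w : P.weylGroup, (weylDet w : ℂ) *
        ∑ᶠ q : ModN (rootLattice b) (a m (t + 1)),
          exp (-(Real.pi * I * c m (t + 1) / (a m (t + 1) * r)) *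
            (normSq b (ν + (r : ℝ) • (s q : V) + (c m (t + 1) : ℝ)⁻¹ • (w • lam)) : ℝ)) := by
  have := Fintype.ofFinite P.weylGroup
  have ha1 := ha (t + 1) (by simp)
  have := finite_modN (b := b) ha1
  have := Fintype.ofFinite (ModN (rootLattice b) (a m (t + 1)))
  simp only [finsum_eq_sum_of_fintype]
  induction t generalizing ν with
  | zero =>
    refine tSum_succ_eq_of_gaussConst hb hθ hr 0 m hlam hν (by simp [a_zero]) ha1
      (by rw [a_zero]; exact isReps_one) (isReps_modN s hs) fun x _ => ?_
    rw [tSum_zero, gaussConst_zero, xiT_eq hb]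
    congr 1
    -- In `XiT` the group acts on the running weight, in the target on the fixed one; inversion
    -- exchanges the two and preserves the determinant.
    refine Fintype.sum_equiv (Equiv.inv _) _ _ fun w => ?_
    rw [Equiv.inv_apply, weylDet_inv, form_smul_left hb]
    simp [a_zero, c_zero]
  | succ t ih =>
    have ha2 := ha (t + 1) (by simp)
    have := finite_modN (b := b) ha2
    have := Fintype.ofFinite (ModN (rootLattice b) (a m (t + 1)))
    have hout : ∀ q : ModN (rootLattice b) (a m (t + 1)), Submodule.Quotient.mk (Quotient.out q) = q :=
      Submodule.Quotient.mk_out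
    refine tSum_succ_eq_of_gaussConst hb hθ hr (t + 1) m hlam hν ha2 ha1
      (isReps_modN _ hout) (isReps_modN s hs) fun x hx => ?_
    -- This number is `a_t`, nonzero by assumption for positive index and equal to 1 for index zero.
    have hc : c m (t + 1) ≠ 0 := by
      rw [c_succ]
      rcases t with _ | t
      · simp [a_zero]
      · exact ha _ (by simp)
    rw [ih (fun k hk => ha k (by simp at hk ⊢; lia)) hx _ hout ha2
      (finite_modN ha2), gaussConst_succ,
      mul_assoc (K b θ r (t + 1) m lam)]
    refine congrArg (K b θ r (t + 1) m lam * ·) ?_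
    rw [Finset.mul_sum]
    refine Finset.sum_congr rfl fun w _ => ?_
    rw [mul_left_comm]
    refine congrArg ((weylDet w : ℂ) * ·) ?_
    rw [Finset.mul_sum]
    refine Finset.sum_congr rfl fun q _ => ?_
    rw [exp_normSq_add hb hr ha2 hc, c_succ]

end Recursion

end SimplyLaced

end

/-! ### Application to the root system of the Lie algebra -/

noncomputable section

namespace SimplyLaced

/-- Independence over `ℂ` implies independence over `ℝ`, so a real dependence of two roots is a
complex one and reducedness descends to the real form. -/
instance isReduced_realRootSystem {𝔤 : Type*} [LieRing 𝔤] [LieAlgebra ℂ 𝔤] [FiniteDimensional ℂ 𝔤]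
    [LieAlgebra.IsSimple ℂ 𝔤] (H : LieSubalgebra ℂ 𝔤) [H.IsCartanSubalgebra] :
    (realRootSystem H).IsReduced where
  eq_or_eq_neg i j h := by
    have h1 : ¬ LinearIndependent ℂ ![(LieAlgebra.IsKilling.rootSystem H).root i,
        (LieAlgebra.IsKilling.rootSystem H).root j] := by
      refine fun h2 => h ?_
      rw [LinearIndependent.pair_iff] at h2 ⊢
      intro x y hxy
      have h3 := h2 x y (by simpa [Complex.coe_smul] using congrArg Subtype.val hxy)
      exact_mod_cast h3
    rcases RootPairing.IsReduced.eq_or_eq_neg i j h1 with h2 | h2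
    · exact Or.inl (Subtype.ext h2)
    · exact Or.inr (Subtype.ext h2)

end SimplyLaced

end

theorem lemma5p1 {𝔤 : Type*} [LieRing 𝔤] [LieAlgebra ℂ 𝔤] [FiniteDimensional ℂ 𝔤]
    [LieAlgebra.IsSimple ℂ 𝔤] (H : LieSubalgebra ℂ 𝔤) [H.IsCartanSubalgebra]
    (b : (SimplyLaced.realRootSystem H).Base) (hb : b.cartanMatrix.IsSimplyLaced)
    (θ : H.root) (hθ : SimplyLaced.IsHighestRoot b θ)
    (r : ℕ) (hr : SimplyLaced.coxeterNumber b θ ≤ r)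
    (t : ℕ) (ht : 1 ≤ t) (m : ℕ → ℤ) (hm : ∀ k ∈ Finset.Icc 1 t, SimplyLaced.a m k ≠ 0)
    (lam0 lam1 : SimplyLaced.HR H)
    (h0 : lam0 ∈ SimplyLaced.alcove b θ r ∩ (SimplyLaced.weightLattice b : Set _))
    (h1 : lam1 ∈ SimplyLaced.alcove b θ r ∩ (SimplyLaced.weightLattice b : Set _))
    (s : SimplyLaced.ModN (SimplyLaced.rootLattice b) (SimplyLaced.a m t) →
      SimplyLaced.rootLattice b)
    (hs : ∀ q, Submodule.Quotient.mk (s q) = q) :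
    SimplyLaced.TSum b θ r t m lam0 lam1 =
      SimplyLaced.K b θ r t m lam0 *
        ∑ᶠ w : (SimplyLaced.realRootSystem H).weylGroup, (SimplyLaced.weylDet w : ℂ) *
          ∑ᶠ q : SimplyLaced.ModN (SimplyLaced.rootLattice b) (SimplyLaced.a m t),
            Complex.exp (-(Real.pi * Complex.I * (SimplyLaced.c m t : ℂ) /
                ((SimplyLaced.a m t : ℂ) * r)) *
              (SimplyLaced.normSq b (lam1 + (r : ℝ) • (s q : SimplyLaced.HR H) +
                (SimplyLaced.c m t : ℝ)⁻¹ • (w • lam0)) : ℝ)) := by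
  -- The highest root is positive and so has positive height, which makes the Coxeter number, and
  -- with it `r`, positive.
  have hpos : 0 < r := by
    have := hθ.isPos hb
    rw [RootPairing.Base.isPos_iff] at this
    rw [SimplyLaced.coxeterNumber] at hr
    lia
  have : FiniteDimensional ℝ (SimplyLaced.HR H) := Module.Basis.finiteDimensional_of_finite b.toWeightBasis
  obtain ⟨t, rfl⟩ := Nat.exists_eq_add_of_le' ht
  exact SimplyLaced.tSum_eq hb hθ hpos m h0.2 t hm h1.2 s hs
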